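/- Let $k\ge 2$ and $d\ge 0$ be integers. Let $\mathbb Z_k=\{e,g,\dots,g^{k-1}\}$ be the cyclic group of order $k$ with generator $g$, let $\Lambda=\mathbb Z[\mathbb Z_k]$ be its group ring, and put $\tau=g-e$, $\sigma=e+g+\dots+g^{k-1}$ and $\sigma_a=e+g+\dots+g^{a-1}$ for $0\le a\le k$. **The complex.** The join $(\mathbb Z_k)^{*(d+2)}$ is the simplicial complex with vertex set $\mathbb Z_k\times\{0,\dots,d+1\}$ whose simplices are the non-empty sets of vertices with pairwise different second components. It is realized geometrically with the standard basis vectors of $\mathbb R^{\mathbb Z_k\times\{0,\dots,d+1\}}$ as vertices, and $\mathbb Z_k$ acts by $h\cdot(s,c)=(hs,c)$, extended linearly. Let $X$ be a $\mathbb Z_k$-equivariant subdivision of it: a geometric simplicial complex, invariant under $\mathbb Z_k$, such that every simplex of $X$ lies in a simplex of the join and every simplex of the join is a union of finitely many simplices of $X$. **Labellings.** A labelling $\ell\colon V(X)\to\mathbb Z_k\times\mathbb N$ assigns to each vertex a sign (first component) and a color (second component). It is admissible if any two adjacent vertices have different colors or the same sign, and equivariant if $\ell(v)=(s,c)$ implies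 $\ell(hv)=(hs,c)$ for all $h\in\mathbb Z_k$. **Patterns.** Let $h_0,\dots,h_r\in\mathbb Z_k$ and write $h_{j}^{-1}h_{j+1}=g^{a_{j+1}}$ with $0\le a_{j+1}<k$. For even $r$ the pattern $h_0\otimes\dots\otimes h_r$ is strongly alternating if $a_{2i+1}+a_{2i+2}\ge k$ for all $0\le i<r/2$. For odd $r$ it is strongly alternating if $h_0\neq h_1$ and $h_1\otimes\dots\otimes h_r$ is strongly alternating. Let $f_r$ be the $\mathbb Z$-linear map from formal sums of patterns $h_0\otimes\dots\otimes h_r$ to $\Lambda$ that sends a pattern that is not strongly alternating to $0$, and a strongly alternating one to $h_0$ if $r$ is even and to $h_0\,\sigma_{a_1}$ if $r$ is odd. **The count.** Let $C_r(X)$ be the group of simplicial $r$-chains with integer coefficients. For a labelling $\ell$, let $h^\ell_r$ be the linear map on $C_r(X)$ that sends an oriented simplex $\langle v_0,\dots,v_r\rangle$ to $0$ if two of its vertices have the same color, and otherwise to $\operatorname{sign}(\pi)\, s_{\pi(0)}\otimes\dots\otimes s_{\pi(r)}$, where $s_i$ is the sign of $v_i$ and $\pi$ is the permutation that sorts the vertices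 by increasing color. Let $u\colon\Lambda\to\mathbb Z$ be the coefficient of $e$. For $x\in C_r(X)$ put $$\alpha_r(x,\ell)=u\bigl(\sigma\cdot f_r(h^\ell_r(x))\bigr).$$ Thus $\alpha_r(x,\ell)$ counts the simplices of $x$ with strongly alternating patterns, with their coefficients in $x$ and according to orientation, each one with weight $1$ if $r$ is even and with weight $a_1$ if $r$ is odd. **Claim.** There are a subcomplex $Y$ of $X$ homeomorphic to the sphere $S^{d+1}$ and chains $x_i\in C_i(X)$, $0\le i\le d+1$, such that 1. $(x_i)$ is a generalized $(d+1)$-sphere: for $0<i\le d+1$ we have $\partial x_i=\sigma x_{i-1}$ if $i$ is even and $\partial x_i=\tau x_{i-1}$ if $i$ is odd; 2. the chain $\tau x_{d+1}$ if $d+1$ is even, respectively $\sigma x_{d+1}$ if $d+1$ is odd, is an orientation chain of $Y$, that is, a cycle with coefficient $\pm1$ on every $(d+1)$-simplex of $Y$ and coefficient $0$ on all others; and the translates $hx_{d+1}$, $h\in\mathbb Z_k$, have pairwise disjoint supports (hence $x_{d+1}$ has coefficients in $\{0,1,-1\}$ and is supported on $Y$); 3. for every admissible equivariant labelling $\ell\colon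 V(X)\to\mathbb Z_k\times\mathbb N$, the number $\alpha_{d+1}(x_{d+1},\ell)$ of $(d+1)$-simplices of $Y$ with strongly alternating patterns, so counted, satisfies $$\alpha_{d+1}(x_{d+1},\ell)\equiv 1\pmod k.$$ Neither $Y$ nor the chains $x_i$ depend on $\ell$. -/

import Mathlib

noncomputable section

namespace ZkTucker

open Geometry

/-! The cyclic group with `k` elements is `ZMod k`, written additively, with generator `1`. -/

/-! ### The join, its subdivisions, and the group action -/

/-- The ambient space of the geometric realization: one coordinate for each vertex `(s, c)` of the
`m`-fold join of `ZMod k`, where `s` is the sign and `c` is the index of the copy. -/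
abbrev Space (k m : ℕ) : Type := ZMod k × Fin m → ℝ

/-- The abstract `m`-fold join of the discrete set `ZMod k`: the simplices are the non-empty
finite sets of vertices with at most one vertex in each copy of `ZMod k`. -/
def abstractJoin (k m : ℕ) : PreAbstractSimplicialComplex (ZMod k × Fin m) where
  faces := {s | s.Nonempty ∧ Set.InjOn Prod.snd (s : Set (ZMod k × Fin m))}
  isRelLowerSet_faces := fun _ hs =>
    ⟨hs.1, fun _ hts ht => ⟨ht, hs.2.mono (Finset.coe_subset.2 hts)⟩⟩

open Classical in
/-- The `m`-fold join of `ZMod k` realized geometrically: the vertex `(s, c)` is placed at the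
corresponding standard basis vector. -/
def joinComplex (k m : ℕ) : SimplicialComplex ℝ (Space k m) :=
  SimplicialComplex.ofAffineIndependent (𝕜 := ℝ)
    ((abstractJoin k m).map (fun i => (Pi.single i (1 : ℝ) : Space k m)))
    (by
      refine (Pi.linearIndependent_single_one (ZMod k × Fin m) ℝ).affineIndependent.range.mono
        fun x hx => ?_
      simp only [Set.mem_iUnion, Finset.mem_coe] at hx
      obtain ⟨_, ⟨t, _, rfl⟩, hx⟩ := hx
      obtain ⟨i, _, rfl⟩ := Finset.mem_image.1 hx
      exact ⟨i, by congr⟩)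

/-- The linear action of `g : ZMod k` on the ambient space, permuting the coordinates. It maps the
basis vector of `(s, c)` to the basis vector of `(g + s, c)`. -/
def rot {k m : ℕ} (g : ZMod k) : Space k m ≃ₗ[ℝ] Space k m :=
  LinearEquiv.funCongrLeft ℝ ℝ ((Equiv.addLeft (-g)).prodCongr (Equiv.refl (Fin m)))

/-- `K'` is a (linear) subdivision of `K`: every simplex of `K'` is contained in a simplex of `K`,
and every simplex of `K` is the union of finitely many simplices of `K'`. -/
def IsSubdivision {E : Type*} [AddCommGroup E] [Module ℝ E] (K' K : SimplicialComplex ℝ E) : Prop :=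
  (∀ s ∈ K'.faces, ∃ t ∈ K.faces, convexHull ℝ (s : Set E) ⊆ convexHull ℝ (t : Set E)) ∧
  ∀ t ∈ K.faces, ∃ F : Set (Finset E), F.Finite ∧ F ⊆ K'.faces ∧
    convexHull ℝ (t : Set E) = ⋃ s ∈ F, convexHull ℝ (s : Set E)

/-- The action of `ZMod k` maps simplices of `X` to simplices of `X`. -/
def IsInvariant {k m : ℕ} (X : SimplicialComplex ℝ (Space k m)) : Prop :=
  ∀ g : ZMod k, ∀ s ∈ X.faces, s.map (rot g).toEquiv.toEmbedding ∈ X.faces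

/-! ### Simplicial chains with integer coefficients -/

/-- `c` is a simplicial `r`-chain of `X`, given by its coefficients on ordered simplices:
an alternating finitely supported integer valued function on `(r+1)`-tuples of points that vanishes
unless the entries of the tuple are the `r + 1` distinct vertices of an `r`-simplex of `X`.
The oriented simplex `⟨v₀, …, vᵣ⟩` is the function with value `sign π` on `v ∘ π`, and `0` on the
other tuples. -/
structure IsChain {E : Type*} [AddCommGroup E] [Module ℝ E] (X : SimplicialComplex ℝ E) (r : ℕ)
    (c : (Fin (r + 1) → E) → ℤ) : Prop where
  alternating : ∀ (π : Equiv.Perm (Fin (r + 1))) (v : Fin (r + 1) → E),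
    c (v ∘ π) = (Equiv.Perm.sign π : ℤ) * c v
  supported : ∀ v, c v ≠ 0 →
    Function.Injective v ∧ ∃ s ∈ X.faces, (s : Set E) = Set.range v
  finite : (Function.support c).Finite

/-- The simplicial boundary: the coefficient of `⟨w₀, …, wᵣ⟩` in `∂ c` is the sum over all `v` of
the coefficients of `⟨v, w₀, …, wᵣ⟩` in `c`. -/
def bdry {E : Type*} {r : ℕ} (c : (Fin (r + 2) → E) → ℤ) : (Fin (r + 1) → E) → ℤ :=
  fun w => ∑ᶠ v : E, c (Fin.cons v w)

/-- The action of `g : ZMod k` on chains: `⟨v₀, …, vᵣ⟩ ↦ ⟨g v₀, …, g vᵣ⟩`. -/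
def translate {k m r : ℕ} (g : ZMod k) (c : (Fin (r + 1) → Space k m) → ℤ) :
    (Fin (r + 1) → Space k m) → ℤ :=
  fun v => c (fun i => rot (-g) (v i))

/-- The action of the element `σ = e + g + ⋯ + g ^ (k - 1)` of the group ring on chains. -/
def sigmaMul {k m r : ℕ} (c : (Fin (r + 1) → Space k m) → ℤ) : (Fin (r + 1) → Space k m) → ℤ :=
  ∑ j ∈ Finset.range k, translate (j : ZMod k) c

/-- The action of the element `τ = g - e` of the group ring on chains. -/
def tauMul {k m r : ℕ} (c : (Fin (r + 1) → Space k m) → ℤ) : (Fin (r + 1) → Space k m) → ℤ :=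
  translate 1 c - c

/-- `x 0, …, x n` is a generalized `n`-sphere in the chain complex of `X`: `∂ xᵢ = σ xᵢ₋₁` for even
`i` and `∂ xᵢ = τ xᵢ₋₁` for odd `i`, where `0 < i ≤ n`. -/
def IsGeneralizedSphere {k m : ℕ} (X : SimplicialComplex ℝ (Space k m)) (n : ℕ)
    (x : (i : ℕ) → (Fin (i + 1) → Space k m) → ℤ) : Prop :=
  (∀ i ≤ n, IsChain X i (x i)) ∧
  ∀ i < n, bdry (x (i + 1)) = if Even (i + 1) then sigmaMul (x i) else tauMul (x i)

/-- `o` is an orientation chain of the closed `(n+1)`-dimensional complex `Y`: an `(n+1)`-chain of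
`Y` with coefficient `1` or `-1` on every `(n+1)`-simplex of `Y` and with `∂ o = 0`. -/
def IsOrientationChain {E : Type*} [AddCommGroup E] [Module ℝ E] (Y : SimplicialComplex ℝ E) (n : ℕ)
    (o : (Fin (n + 2) → E) → ℤ) : Prop :=
  IsChain Y (n + 1) o ∧
  (∀ v : Fin (n + 2) → E, Function.Injective v → (∃ s ∈ Y.faces, (s : Set E) = Set.range v) →
    o v = 1 ∨ o v = -1) ∧
  bdry o = 0

/-! ### Labellings

A labelling of the vertices by `ZMod k × ℕ` is given as a function on the ambient space; only its
values at the vertices of the complex matter. The first component of a label is the sign, the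
second one is the color. -/

/-- Adjacent vertices (vertices of a common simplex) carry different colors or the same sign. -/
def IsAdmissible {E : Type*} [AddCommGroup E] [Module ℝ E] {k : ℕ}
    (X : SimplicialComplex ℝ E) (l : E → ZMod k × ℕ) : Prop :=
  ∀ s ∈ X.faces, ∀ v ∈ s, ∀ w ∈ s, (l v).2 ≠ (l w).2 ∨ (l v).1 = (l w).1

/-- `l (g v) = g (l v)`, where `g` acts on labels by shifting the signs. -/
def IsEquivariantLabelling {k m : ℕ} (X : SimplicialComplex ℝ (Space k m))
    (l : Space k m → ZMod k × ℕ) : Prop :=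
  ∀ g : ZMod k, ∀ v ∈ X.vertices, l (rot g v) = (g + (l v).1, (l v).2)

/-! ### Patterns and the chain map to the minimal resolution

The degree `r` part of the standard resolution is the free abelian group on the patterns
`h₀ ⊗ ⋯ ⊗ hᵣ`, and the group ring is `AddMonoidAlgebra ℤ (ZMod k)`. -/

/-- For every index of the form `j = a + 2 i` with `j + 2 ≤ r`, passing from `h j` to `h (j + 1)` and
from `h (j + 1)` to `h (j + 2)` amounts to multiplications with `g ^ α` and `g ^ β`, where
`0 ≤ α, β < k`, such that `α + β ≥ k`. -/
def JumpsFrom {k r : ℕ} (a : ℕ) (h : Fin (r + 1) → ZMod k) : Prop :=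
  ∀ (i : ℕ) (hi : a + 2 * i + 2 ≤ r),
    k ≤ (h ⟨a + 2 * i + 1, by omega⟩ - h ⟨a + 2 * i, by omega⟩).val +
      (h ⟨a + 2 * i + 2, by omega⟩ - h ⟨a + 2 * i + 1, by omega⟩).val

/-- Strongly alternating patterns `h₀ ⊗ ⋯ ⊗ hᵣ`. For odd `r` this means that `h₀ ≠ h₁` and that
`h₁ ⊗ ⋯ ⊗ hᵣ` is strongly alternating. -/
def StronglyAlternating {k r : ℕ} (h : Fin (r + 1) → ZMod k) : Prop :=
  if Even r then JumpsFrom 0 h else h 0 ≠ h 1 ∧ JumpsFrom 1 h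

/-- `σ_a = e + g + ⋯ + g ^ (a - 1)` in the group ring. -/
def sigmaElt (k a : ℕ) : AddMonoidAlgebra ℤ (ZMod k) :=
  ∑ j ∈ Finset.range a, AddMonoidAlgebra.single (j : ZMod k) 1

open Classical in
/-- The value of the chain map to the minimal resolution on a pattern. A pattern that is not
strongly alternating is mapped to `0`; a strongly alternating `h₀ ⊗ ⋯ ⊗ hᵣ` is mapped to `h₀` if
`r` is even, and to `h₀ σ_a` with `h₀⁻¹ h₁ = g ^ a`, `0 ≤ a < k`, if `r` is odd. -/
def patternValue {k r : ℕ} (h : Fin (r + 1) → ZMod k) : AddMonoidAlgebra ℤ (ZMod k) :=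
  if StronglyAlternating h then
    if Even r then AddMonoidAlgebra.single (h 0) 1
    else AddMonoidAlgebra.single (h 0) 1 * sigmaElt k (h 1 - h 0).val
  else 0

/-- The chain map `f` from the standard resolution to the minimal resolution. -/
def toMinimal (k r : ℕ) : ((Fin (r + 1) → ZMod k) →₀ ℤ) →ₗ[ℤ] AddMonoidAlgebra ℤ (ZMod k) :=
  Finsupp.linearCombination ℤ patternValue

/-- The formal sum of the patterns that the labelling `l` assigns to the simplices of the chain `c`,
counted with multiplicity and according to orientation. Each simplex with pairwise different colors
has exactly one ordering of its vertices with increasing colors, and contributes its sequence of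
signs in this ordering, with its coefficient in `c` with respect to this ordering. A simplex on
which a color repeats contributes nothing. -/
def patterns {E : Type*} {k r : ℕ} (l : E → ZMod k × ℕ) (c : (Fin (r + 1) → E) → ℤ) :
    (Fin (r + 1) → ZMod k) →₀ ℤ :=
  ∑ᶠ (v : Fin (r + 1) → E) (_ : StrictMono fun i => (l (v i)).2),
    Finsupp.single (fun i => (l (v i)).1) (c v)

/-- `u (σ · f (h (c)))`, where `h (c)` is the sum of the patterns in `c` and `u` is the evaluation
of elements of the group ring at the neutral element. -/
def alpha {E : Type*} {k r : ℕ} (l : E → ZMod k × ℕ) (c : (Fin (r + 1) → E) → ℤ) : ℤ :=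
  (sigmaElt k k * toMinimal k r (patterns l c)).coeff 0

end ZkTucker

end

noncomputable section

namespace ZkTucker

open Geometry

/-! ### Simplices inside the standard simplex, and signs of determinants -/

section Geometric

set_option linter.unusedSectionVars false

variable {ι : Type*} [Fintype ι]

/-! The congruence is homological. Over the group ring, the minimal resolution has one generator in
each degree, with boundary alternately multiplication by `τ` (odd degrees) and `σ` (even degrees); a
generalized sphere is a family of chains obeying the same relations. An admissible equivariant
labelling gives an equivariant chain map from the chains of `X` to the standard resolution
(`patterns_bdry`, `patterns_translate`), and `toMinimal` continues it equivariantly to the minimal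
resolution (`toMinimal_orderedBdry`, `toMinimal_shiftPattern`). If `yᵢ` denotes the image of `xᵢ` in
the group ring, then `∂ᵢ yᵢ = ∂ᵢ yᵢ₋₁`, where `∂ᵢ` is multiplication by `σ` or `τ`. From `σ yᵢ = σ
yᵢ₋₁` it follows that the coefficient sums agree; from `τ (yᵢ - yᵢ₋₁) = 0` it follows that the
difference has constant coefficients, so the sums agree modulo `k`. The count `alpha` is this
coefficient sum, and it is `1` for the single vertex `x₀`.

Strong alternation arises from a cocycle: `α + β ≥ k` says that a carry occurs when two steps in the
cyclic group are added. The carry is a 2-cocycle, and its cup powers give the chain map to the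
minimal resolution (`jump_cocycle`, `jumps_cocycle`, `sum_sequenceValue_skip`).

The generalized sphere is built in the join by repeated coning: `xᵣ₊₁` is the cone over `τ xᵣ` or `σ
xᵣ` with apex in the next copy of the group. Its boundary relations follow from `σ τ = 0`. The
support of the top cycle is a join of `2k`-cycles, one for each pair of consecutive copies, and of
two points if a copy is left over (`isSphereCoeff_sphereOf`). These chains are carried to `X` by
subdivision, where the coefficient of a small simplex is the sign of the determinant of its
coordinates; `bdry_subdiv` shows that this commutes with the boundary.

For the topology, each `2k`-cycle is placed as a regular polygon in a plane and the two extra points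
at `±1`. The resulting linear map is a bijection from the cone over the subcomplex to `ℝ^(d+2)`, and
radial projection identifies the subcomplex with the sphere. -/

/-- The face of the standard simplex spanned by the vertices in `T`. -/
def stdFace (T : Set ι) : Set (ι → ℝ) := {x | x ∈ stdSimplex ℝ ι ∧ ∀ i ∉ T, x i = 0}

lemma convex_stdFace (T : Set ι) : Convex ℝ (stdFace T) := by
  intro x hx y hy a b ha hb hab
  refine ⟨convex_stdSimplex ℝ ι hx.1 hy.1 ha hb hab, fun i hi => ?_⟩
  simp [hx.2 i hi, hy.2 i hi]

/-- All vertices of the complex lie in the standard simplex. -/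
def VerticesInStd (X : SimplicialComplex ℝ (ι → ℝ)) : Prop :=
  ∀ s ∈ X.faces, ∀ v ∈ s, v ∈ stdSimplex ℝ ι

/-- The tuple `v` runs through the vertices of a simplex of `X`. -/
def IsFaceTuple {E : Type*} [AddCommGroup E] [Module ℝ E] (X : SimplicialComplex ℝ E) {n : ℕ}
    (v : Fin n → E) : Prop :=
  ∃ s ∈ X.faces, (s : Set E) = Set.range v

lemma IsFaceTuple.of_range_subset {E : Type*} [AddCommGroup E] [Module ℝ E]
    {X : SimplicialComplex ℝ E} {n : ℕ} {v : Fin (n + 1) → E} {s : Finset E} (hs : s ∈ X.faces)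
    (h : Set.range v ⊆ s) : IsFaceTuple X v := by
  classical
  refine ⟨Finset.univ.image v, X.down_closed hs ?_ ?_, by simp⟩
  · intro x hx
    obtain ⟨i, -, rfl⟩ := Finset.mem_image.1 hx
    exact h ⟨i, rfl⟩
  · exact ⟨v 0, by simp⟩

lemma IsFaceTuple.mono {E : Type*} [AddCommGroup E] [Module ℝ E]
    {X : SimplicialComplex ℝ E} {n m : ℕ} {v : Fin n → E} {w : Fin (m + 1) → E}
    (hv : IsFaceTuple X v) (h : Set.range w ⊆ Set.range v) : IsFaceTuple X w := by
  obtain ⟨s, hs, e⟩ := hv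
  exact .of_range_subset hs (by rwa [e])

variable {X : SimplicialComplex ℝ (ι → ℝ)}

lemma VerticesInStd.tuple (hX : VerticesInStd X) {n : ℕ} {v : Fin n → ι → ℝ}
    (hv : IsFaceTuple X v) (a : Fin n) : v a ∈ stdSimplex ℝ ι := by
  obtain ⟨s, hs, e⟩ := hv
  exact hX s hs _ (by rw [← Finset.mem_coe, e]; exact ⟨a, rfl⟩)

/-- A face whose vertices lie in the standard simplex is linearly independent. -/
lemma VerticesInStd.linearIndependent (hX : VerticesInStd X) {s : Finset (ι → ℝ)}
    (hs : s ∈ X.faces) : LinearIndependent ℝ ((↑) : s → ι → ℝ) := by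
  rw [Fintype.linearIndependent_iff]
  intro g hg
  -- All vertices have coordinate sum `1`, so a linear relation is an affine one.
  have h0 : ∑ i, g i = 0 := by
    have h1 : ∑ j, (∑ i, g i • (i : ι → ℝ)) j = 0 := by rw [hg]; simp
    simp only [Finset.sum_apply, Pi.smul_apply, smul_eq_mul] at h1
    rw [Finset.sum_comm] at h1
    simpa [← Finset.mul_sum, (hX s hs _ (Subtype.coe_prop _)).2] using h1
  intro i
  exact affineIndependent_iff.1 (X.indep hs) Finset.univ g h0 hg i (Finset.mem_univ i)

lemma VerticesInStd.linearIndependent_tuple (hX : VerticesInStd X) {n : ℕ} {v : Fin n → ι → ℝ}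
    (hv : IsFaceTuple X v) (hi : Function.Injective v) : LinearIndependent ℝ v := by
  obtain ⟨s, hs, e⟩ := hv
  have h := hX.linearIndependent hs
  rw [← linearIndepOn_id_range_iff hi, ← e]
  exact h

/-- If a nonnegative combination of the vertices of a face equals a nonnegative combination of the
vertices of another face, the vertices with nonzero coefficient in the former belong to the
latter. -/
lemma VerticesInStd.mem_of_combination_eq (hX : VerticesInStd X) {n m : ℕ} {x : Fin n → ι → ℝ}
    {y : Fin m → ι → ℝ} (hx : IsFaceTuple X x) (hy : IsFaceTuple X y) {a : Fin n → ℝ}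
    {b : Fin m → ℝ} (ha : ∀ i, 0 ≤ a i) (hb : ∀ i, 0 ≤ b i)
    (h : ∑ i, a i • x i = ∑ i, b i • y i) (i : Fin n) (hi : a i ≠ 0) : x i ∈ Set.range y := by
  have hsum : ∑ i, a i = ∑ i, b i := by
    have h1 := congrArg (fun z => ∑ j, z j) h
    simp only [Finset.sum_apply, Pi.smul_apply, smul_eq_mul] at h1
    have h2 := (Finset.sum_comm.trans h1).trans Finset.sum_comm
    simpa [← Finset.mul_sum, (hX.tuple hx _).2, (hX.tuple hy _).2] using h2
  have hpos : 0 < ∑ i, a i :=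
    Finset.sum_pos' (fun i _ => ha i) ⟨i, Finset.mem_univ i, (ha i).lt_of_ne' hi⟩
  obtain ⟨s, hs, es⟩ := hx
  obtain ⟨t, ht, et⟩ := hy
  -- Both weight sums agree because all vertices have coordinate sum `1`. Normalizing therefore
  -- gives one point lying in both simplices, to which the intersection axiom applies.
  have hP1 : (∑ i, a i)⁻¹ • ∑ i, a i • x i ∈ convexHull ℝ (s : Set (ι → ℝ)) := by
    rw [Finset.smul_sum]
    simp only [smul_smul]
    refine (convex_convexHull ℝ _).sum_mem (fun i _ => mul_nonneg (inv_nonneg.2 hpos.le) (ha i)) ?_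
      fun i _ => subset_convexHull ℝ _ (by rw [es]; exact ⟨i, rfl⟩)
    rw [← Finset.mul_sum, inv_mul_cancel₀ hpos.ne']
  have hP2 : (∑ i, a i)⁻¹ • ∑ i, a i • x i ∈ convexHull ℝ (t : Set (ι → ℝ)) := by
    rw [h, hsum, Finset.smul_sum]
    simp only [smul_smul]
    refine (convex_convexHull ℝ _).sum_mem
      (fun i _ => mul_nonneg (inv_nonneg.2 (hsum ▸ hpos.le)) (hb i)) ?_
      fun i _ => subset_convexHull ℝ _ (by rw [et]; exact ⟨i, rfl⟩)
    rw [← Finset.mul_sum, inv_mul_cancel₀ (hsum ▸ hpos.ne')]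
  by_contra hmem
  rw [← et] at hmem
  have hxs : ∀ j, x j ∈ s := fun j => by rw [← Finset.mem_coe, es]; exact ⟨j, rfl⟩
  have hnot : x i ∉ Submodule.span ℝ ((s : Set (ι → ℝ)) \ {x i}) := by
    have h1 : LinearIndepOn ℝ id (s : Set (ι → ℝ)) := hX.linearIndependent hs
    have := (linearIndepOn_iff_notMem_span.1 h1) (x i) (hxs i)
    simpa using this
  -- A functional that kills every vertex of `s` except `x i`. If `x i` were not in `t`, it would
  -- vanish on the hull of the common vertices and hence at the common point, although its value
  -- there is a positive multiple of `f (x i)`.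
  obtain ⟨f, hf, hker⟩ := Submodule.exists_le_ker_of_notMem hnot
  have hz : ∀ z ∈ s, z ≠ x i → f z = 0 := fun z hz hne =>
    hker (Submodule.subset_span ⟨hz, hne⟩)
  have hP := X.inter_subset_convexHull hs ht ⟨hP1, hP2⟩
  have hf0 : f ((∑ i, a i)⁻¹ • ∑ i, a i • x i) = 0 := by
    have hsub : convexHull ℝ ((s : Set (ι → ℝ)) ∩ t) ⊆ (LinearMap.ker f : Set (ι → ℝ)) := by
      refine convexHull_min ?_ (LinearMap.ker f).convex
      rintro z ⟨hzs, hzt⟩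
      exact hz z hzs (fun e => hmem (e ▸ hzt))
    exact hsub hP
  rw [map_smul, smul_eq_zero, inv_eq_zero, map_sum] at hf0
  -- The tuple `x` may repeat entries, so the weights of all copies of `x i` are collected.
  have hf1 : ∑ j, f (a j • x j) = (∑ j, if x j = x i then a j else 0) * f (x i) := by
    rw [Finset.sum_mul]
    refine Finset.sum_congr rfl fun j _ => ?_
    split_ifs with e
    · simp [e]
    · simp [hz _ (hxs j) e]
  rw [hf1] at hf0
  rcases hf0 with h0 | h0
  · exact hpos.ne' h0
  · have : 0 < ∑ j, if x j = x i then a j else 0 :=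
      Finset.sum_pos' (fun j _ => by split_ifs <;> simp [ha])
        ⟨i, Finset.mem_univ i, by simpa using (ha i).lt_of_ne' hi⟩
    exact (mul_ne_zero this.ne' hf) h0

/-- The face spanned by `T` is a union of finitely many simplices of `X`. -/
def CoversFace (X : SimplicialComplex ℝ (ι → ℝ)) (T : Set ι) : Prop :=
  ∃ F : Set (Finset (ι → ℝ)), F.Finite ∧ F ⊆ X.faces ∧
    stdFace T = ⋃ s ∈ F, convexHull ℝ (s : Set (ι → ℝ))

/-- The matrix of the coordinates of the points `v` with indices in `t`. -/
def coordMatrix {n : ℕ} (v : Fin n → ι → ℝ) (t : Fin n → ι) : Matrix (Fin n) (Fin n) ℝ :=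
  Matrix.of fun a b => v a (t b)

/-- `v` is a tuple of vertices of a simplex of `X` that lies in the face spanned by `t`. -/
def IsTupleIn (X : SimplicialComplex ℝ (ι → ℝ)) {n m : ℕ} (v : Fin n → ι → ℝ) (t : Fin m → ι) :
    Prop :=
  IsFaceTuple X v ∧ ∀ a, ∀ i ∉ Set.range t, v a i = 0

open Classical in
/-- The subdivision of the oriented simplex `⟨t₀, …, tᵣ⟩`. -/
def subdiv (X : SimplicialComplex ℝ (ι → ℝ)) {r : ℕ} (t : Fin (r + 1) → ι) :
    (Fin (r + 1) → ι → ℝ) → ℤ :=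
  fun v => if IsTupleIn X v t then (SignType.sign (coordMatrix v t).det : ℤ) else 0

/-- Laplace expansion along the row of the apex. For a fixed facet `w` the determinant is a linear
functional of the apex; its sign tells on which side of `w` the apex lies. -/
lemma coordMatrix_cons_det {r : ℕ} (t : Fin (r + 2) → ι) (w : Fin (r + 1) → ι → ℝ) (v : ι → ℝ) :
    (coordMatrix (Fin.cons v w : Fin (r + 2) → ι → ℝ) t).det =
      ∑ j, v (t j) * ((-1) ^ (j : ℕ) * (coordMatrix w (t ∘ j.succAbove)).det) := by
  rw [Matrix.det_succ_row_zero]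
  refine Finset.sum_congr rfl fun j _ => ?_
  have : (coordMatrix (Fin.cons v w : Fin (r + 2) → ι → ℝ) t).submatrix Fin.succ j.succAbove =
      coordMatrix w (t ∘ j.succAbove) := by
    ext a b; simp [coordMatrix]
  rw [this]
  simp [coordMatrix]
  ring

end Geometric

/-! ### The simplices on the two sides of a facet -/

section Boundary

set_option linter.unusedSectionVars false

variable {ι : Type*} [Fintype ι] {X : SimplicialComplex ℝ (ι → ℝ)}

lemma IsTupleIn.tail {r n : ℕ} {t : Fin n → ι} {w : Fin (r + 1) → ι → ℝ} {v : ι → ℝ}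
    (h : IsTupleIn X (Fin.cons v w : Fin (r + 2) → ι → ℝ) t) : IsTupleIn X w t :=
  ⟨h.1.mono (by rw [Fin.range_cons]; exact Set.subset_insert _ _), fun a i hi => by
    simpa using h.2 a.succ i hi⟩

lemma eq_of_eq_on_range {n : ℕ} {t : Fin n → ι} {v : ι → ℝ}
    (hv : ∀ i ∉ Set.range t, v i = 0) (v' : ι → ℝ) (hv' : ∀ i ∉ Set.range t, v' i = 0)
    (h : ∀ b, v (t b) = v' (t b)) : v = v' := by
  ext i
  by_cases hi : i ∈ Set.range t
  · obtain ⟨b, rfl⟩ := hi; exact h b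
  · rw [hv i hi, hv' i hi]

/-- Two simplices on the same side of a common facet coincide. -/
lemma vertex_unique (hX : VerticesInStd X) {r : ℕ} {t : Fin (r + 2) → ι}
    {w : Fin (r + 1) → ι → ℝ} {v v' : ι → ℝ}
    (hv : IsTupleIn X (Fin.cons v w : Fin (r + 2) → ι → ℝ) t)
    (hv' : IsTupleIn X (Fin.cons v' w : Fin (r + 2) → ι → ℝ) t)
    (h0 : 0 < (coordMatrix (Fin.cons v w : Fin (r + 2) → ι → ℝ) t).det *
      (coordMatrix (Fin.cons v' w : Fin (r + 2) → ι → ℝ) t).det) : v = v' := by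
  set M := coordMatrix (Fin.cons v w : Fin (r + 2) → ι → ℝ) t with hM
  have hdet : M.det ≠ 0 := left_ne_zero_of_mul h0.ne'
  have hdet' := right_ne_zero_of_mul h0.ne'
  -- The coordinates of `v'` in the basis formed by `v` and `w`. The determinant with apex `v'` is
  -- `c 0` times the one with apex `v`, so lying on the same side means `c 0 > 0`.
  set c : Fin (r + 2) → ℝ := Matrix.vecMul (fun b => v' (t b)) M⁻¹ with hc
  have hcM : Matrix.vecMul c M = fun b => v' (t b) := by
    rw [hc, Matrix.vecMul_vecMul, Matrix.nonsing_inv_mul _ hdet.isUnit, Matrix.vecMul_one]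
  have hexp : ∀ b, v' (t b) = c 0 * v (t b) + ∑ a, c (Fin.succ a) * w a (t b) := by
    intro b
    have := congrFun hcM b
    rw [Matrix.vecMul, dotProduct, Fin.sum_univ_succ] at this
    simpa [hM, coordMatrix] using this.symm
  have hvec : v' = c 0 • v + ∑ a, c (Fin.succ a) • w a := by
    refine eq_of_eq_on_range (fun i hi => by simpa using hv'.2 0 i hi) _ ?_ ?_
    · intro i hi
      have h1 : v i = 0 := by simpa using hv.2 0 i hi
      have h2 : ∀ a, w a i = 0 := fun a => by simpa using hv.2 (Fin.succ a) i hi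
      simp [h1, h2]
    · intro b
      simp [hexp b]
  have hLw : ∀ a, (coordMatrix (Fin.cons (w a) w : Fin (r + 2) → ι → ℝ) t).det = 0 := by
    intro a
    refine Matrix.det_zero_of_row_eq (i := 0) (j := a.succ) (Fin.succ_ne_zero a).symm ?_
    ext b; simp [coordMatrix]
  have hL : (coordMatrix (Fin.cons v' w : Fin (r + 2) → ι → ℝ) t).det = c 0 * M.det := by
    have hlin : ∀ u, (coordMatrix (Fin.cons u w : Fin (r + 2) → ι → ℝ) t).det =
      ∑ j, u (t j) * ((-1) ^ (j : ℕ) * (coordMatrix w (t ∘ j.succAbove)).det) :=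
      coordMatrix_cons_det t w
    rw [hM, hlin, hlin, Finset.mul_sum]
    simp only [hexp, add_mul, Finset.sum_add_distrib, Finset.sum_mul]
    rw [Finset.sum_comm]
    have : ∀ a, ∑ j, c (Fin.succ a) * w a (t j) *
        ((-1) ^ (j : ℕ) * (coordMatrix w (t ∘ j.succAbove)).det) = 0 := by
      intro a
      have := hLw a
      rw [hlin] at this
      simp only [mul_assoc]
      rw [← Finset.mul_sum, this, mul_zero]
    simp only [this]
    simp [mul_assoc]
  have hc0 : 0 < c 0 := by
    rw [hL] at h0
    have h1 : 0 < c 0 * (M.det * M.det) := by linarith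
    exact pos_of_mul_pos_left h1 (mul_self_nonneg _)
  -- move both simplices into a common cone
  obtain ⟨N, hN0, hN⟩ : ∃ N : ℝ, 0 ≤ N ∧ ∀ a : Fin (r + 1), 0 ≤ c a.succ + N := by
    refine ⟨∑ a : Fin (r + 1), |c a.succ|, Finset.sum_nonneg fun _ _ => abs_nonneg _, fun a => ?_⟩
    have := Finset.single_le_sum (f := fun a : Fin (r + 1) => |c a.succ|)
      (fun _ _ => abs_nonneg _) (Finset.mem_univ a)
    linarith [neg_abs_le (c a.succ)]
  have hmem := hX.mem_of_combination_eq hv'.1 hv.1 (a := Fin.cons 1 fun _ => N)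
    (b := Fin.cons (c 0) fun a => c a.succ + N) (fun i => by
      refine Fin.cases ?_ (fun i => ?_) i <;> simp [hN0]) (fun i => by
      refine Fin.cases ?_ (fun i => ?_) i
      · simpa using hc0.le
      · simpa using hN i) (by
      rw [Fin.sum_univ_succ, Fin.sum_univ_succ (n := r + 1)]
      simp only [Fin.cons_zero, Fin.cons_succ, one_smul, add_smul, Finset.sum_add_distrib]
      nth_rw 1 [hvec]
      abel) 0 (by simp)
  simp only [Fin.cons_zero, Fin.range_cons] at hmem
  rcases hmem with h | ⟨a, ha⟩
  · exact h.symm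
  -- If `v'` were a vertex of `w`, its determinant would have two equal rows.
  · exact absurd (hLw a) (by rw [ha]; exact hdet')

lemma exists_enumeration {s : Finset (ι → ℝ)} (hs : s ∈ X.faces) :
    ∃ (n : ℕ) (e : Fin n → ι → ℝ), IsFaceTuple X e ∧ (∀ i, e i ∈ s) ∧
      ∀ z ∈ convexHull ℝ (s : Set (ι → ℝ)), ∃ b : Fin n → ℝ, (∀ i, 0 ≤ b i) ∧
        ∑ i, b i • e i = z := by
  set e := s.equivFin.symm
  refine ⟨s.card, fun i => e i, ⟨s, hs, ?_⟩, fun i => (e i).2, fun z hz => ?_⟩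
  · ext z
    constructor
    · intro hz
      exact ⟨e.symm ⟨z, hz⟩, by simp⟩
    · rintro ⟨i, rfl⟩
      exact (e i).2
  · obtain ⟨b, hb, -, hbz⟩ := Finset.mem_convexHull'.1 hz
    refine ⟨fun i => b (e i), fun i => hb _ (e i).2, ?_⟩
    rw [e.sum_comp (fun z : s => b z • (z : ι → ℝ)), ← hbz, Finset.sum_coe_sort s (fun z => b z • z)]

/-- A face whose barycenter lies in a simplex is a face of this simplex. -/
lemma range_subset_of_center_mem (hX : VerticesInStd X) {r : ℕ} {w : Fin (r + 1) → ι → ℝ}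
    (hw : IsFaceTuple X w) {s : Finset (ι → ℝ)} (hs : s ∈ X.faces)
    (h : ∑ a, ((r : ℝ) + 1)⁻¹ • w a ∈ convexHull ℝ (s : Set (ι → ℝ))) : Set.range w ⊆ s := by
  obtain ⟨n, e, hface, he, hcomb⟩ := exists_enumeration hs
  obtain ⟨b, hb, hbp⟩ := hcomb _ h
  rintro _ ⟨a, rfl⟩
  obtain ⟨i, hi⟩ := hX.mem_of_combination_eq hw hface (a := fun _ => ((r : ℝ) + 1)⁻¹)
    (fun _ => by positivity) hb (by rw [hbp]) a (by positivity)
  rw [← hi]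
  exact he i

/-- If some point of the face spanned by `t` lies strictly on one side of the simplex `w` of
codimension one, then some simplex with facet `w` lies on this side. -/
lemma exists_vertex (hX : VerticesInStd X) {r : ℕ} {t : Fin (r + 2) → ι}
    (hcov : CoversFace X (Set.range t)) {w : Fin (r + 1) → ι → ℝ}
    (hw : IsTupleIn X w t) {y : ι → ℝ} (hy : y ∈ stdFace (Set.range t)) {ε : ℝ}
    (hε : 0 < ε * (coordMatrix (Fin.cons y w : Fin (r + 2) → ι → ℝ) t).det) :
    ∃ v, IsTupleIn X (Fin.cons v w : Fin (r + 2) → ι → ℝ) t ∧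
      0 < ε * (coordMatrix (Fin.cons v w : Fin (r + 2) → ι → ℝ) t).det := by
  obtain ⟨F, hF, hFX, hcov⟩ := hcov
  -- The determinant as a functional of the apex; it vanishes on `w`.
  set Lf : (ι → ℝ) →ₗ[ℝ] ℝ :=
    ∑ j : Fin (r + 2), ((-1) ^ (j : ℕ) * (coordMatrix w (t ∘ j.succAbove)).det) • LinearMap.proj (t j) with hLf
  have hL : ∀ u, (coordMatrix (Fin.cons u w : Fin (r + 2) → ι → ℝ) t).det = Lf u := by
    intro u
    rw [coordMatrix_cons_det, hLf]
    simp [mul_comm]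
  have hLw : ∀ a, Lf (w a) = 0 := by
    intro a
    rw [← hL]
    refine Matrix.det_zero_of_row_eq (i := 0) (j := a.succ) (Fin.succ_ne_zero a).symm ?_
    ext b; simp [coordMatrix]
  simp only [hL] at hε ⊢
  set p : ι → ℝ := ∑ a, ((r : ℝ) + 1)⁻¹ • w a with hp
  have hr : (0 : ℝ) < (r : ℝ) + 1 := by positivity
  have hpm : p ∈ stdFace (Set.range t) := by
    refine (convex_stdFace _).sum_mem (fun _ _ => by positivity) ?_
      fun a _ => ⟨hX.tuple hw.1 a, hw.2 a⟩
    simp [hr.ne']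
  have hLp : Lf p = 0 := by simp [hp, hLw]
  -- Move from the barycenter of `w` a little towards `y`. Every `q δ` lies in one of finitely many
  -- simplices, so a single one of them contains `q δ` for arbitrarily small `δ`. Being closed, it
  -- also contains the barycenter, and thus it has `w` as a face.
  set q : ℝ → ι → ℝ := fun δ => (1 - δ) • p + δ • y with hq
  have hqm : ∀ δ ∈ Set.Ioo (0 : ℝ) 1, q δ ∈ stdFace (Set.range t) := fun δ hδ =>
    convex_stdFace _ hpm hy (by linarith [hδ.2]) hδ.1.le (by ring)
  have hev : ∀ᶠ δ in nhdsWithin (0 : ℝ) (Set.Ioi 0), δ ∈ Set.Ioo (0 : ℝ) 1 :=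
    Ioo_mem_nhdsGT one_pos
  have hfr : ∃ᶠ δ in nhdsWithin (0 : ℝ) (Set.Ioi 0), ∃ s ∈ F,
      q δ ∈ convexHull ℝ (s : Set (ι → ℝ)) := by
    refine Filter.Eventually.frequently ?_
    filter_upwards [hev] with δ hδ
    have := hqm δ hδ
    rw [hcov] at this
    simpa using this
  obtain ⟨s, hsF, hs⟩ := (Filter.frequently_exists_finite hF).1 hfr
  have htend : Filter.Tendsto q (nhdsWithin (0 : ℝ) (Set.Ioi 0)) (nhds p) := by
    have hcont : Continuous q := by fun_prop
    have h0 : q 0 = p := by simp [hq]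
    rw [← h0]
    exact hcont.continuousAt.tendsto.mono_left nhdsWithin_le_nhds
  have hclosed : IsClosed (convexHull ℝ (s : Set (ι → ℝ))) :=
    (s.finite_toSet.isCompact_convexHull ℝ).isClosed
  have hps := hclosed.mem_of_frequently_of_tendsto hs htend
  obtain ⟨δ, hδs, hδ⟩ := (hs.and_eventually hev).exists
  have hsX := hFX hsF
  have hwr : Set.range w ⊆ s := range_subset_of_center_mem hX hw.1 hsX hps
  obtain ⟨n, e, hface, he, hcomb⟩ := exists_enumeration hsX
  obtain ⟨b, hb, hbq⟩ := hcomb (q δ) hδs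
  -- The point `q δ` lies strictly on the required side and is a nonnegative combination of the
  -- vertices of `s`, so some vertex of `s` lies on that side.
  have hsum : 0 < ∑ i, b i * (ε * Lf (e i)) := by
    have : ∑ i, b i * (ε * Lf (e i)) = ε * Lf (q δ) := by
      rw [← hbq, map_sum, Finset.mul_sum]
      refine Finset.sum_congr rfl fun i _ => ?_
      rw [map_smul, smul_eq_mul]; ring
    rw [this, hq]
    simp only [map_add, map_smul, hLp, smul_eq_mul, mul_zero, zero_add]
    have := mul_pos hδ.1 hε
    linarith
  obtain ⟨i, -, hi⟩ := Finset.exists_lt_of_sum_lt (s := Finset.univ) (f := fun _ => (0 : ℝ))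
    (g := fun i => b i * (ε * Lf (e i))) (by simpa using hsum)
  refine ⟨e i, ⟨.of_range_subset hsX ?_, ?_⟩, pos_of_mul_pos_right hi (hb i)⟩
  · rw [Fin.range_cons]
    exact Set.insert_subset (he i) hwr
  · have hst : ∀ z ∈ s, z ∈ stdFace (Set.range t) := by
      intro z hz
      rw [hcov]
      exact Set.mem_biUnion hsF (subset_convexHull ℝ _ hz)
    intro a
    refine Fin.cases ?_ (fun a => ?_) a
    · simpa using (hst _ (he i)).2
    · simpa using hw.2 a

end Boundary

/-! ### Subdivision is a chain map -/

section BoundaryFormula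

set_option linter.unusedSectionVars false

variable {ι : Type*} [Fintype ι] {X : SimplicialComplex ℝ (ι → ℝ)}

lemma isTupleIn_comp_succAbove_iff {r n : ℕ} {t : Fin (r + 1) → ι} (ht : Function.Injective t)
    (j : Fin (r + 1)) {w : Fin n → ι → ℝ} :
    IsTupleIn X w (t ∘ j.succAbove) ↔ IsTupleIn X w t ∧ ∀ a, w a (t j) = 0 := by
  have hr : ∀ i, i ∉ Set.range (t ∘ j.succAbove) ↔ i ∉ Set.range t ∨ i = t j := by
    intro i
    rw [Set.range_comp, Fin.range_succAbove]
    constructor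
    · intro h
      by_cases hi : i ∈ Set.range t
      · obtain ⟨b, rfl⟩ := hi
        right
        by_contra hne
        exact h ⟨b, fun e => hne (by rw [Set.mem_singleton_iff.1 e]), rfl⟩
      · exact Or.inl hi
    · rintro (h | rfl) ⟨b, hb, e⟩
      · exact h ⟨b, e⟩
      · exact hb (ht e)
  constructor
  · rintro ⟨h1, h2⟩
    exact ⟨⟨h1, fun a i hi => h2 a i ((hr i).2 (Or.inl hi))⟩, fun a => h2 a _ ((hr _).2 (Or.inr rfl))⟩
  · rintro ⟨⟨h1, h2⟩, h3⟩
    refine ⟨h1, fun a i hi => ?_⟩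
    rcases (hr i).1 hi with h | rfl
    · exact h2 a i h
    · exact h3 a

/-- The vertices of `w` are independent, also when only the coordinates in `t` are kept. Completing
them to a basis gives an invertible matrix, whose expansion along the new row cannot have only zero
cofactors. -/
lemma exists_cofactor_ne_zero (hX : VerticesInStd X) {r : ℕ} {t : Fin (r + 2) → ι}
    (ht : Function.Injective t) {w : Fin (r + 1) → ι → ℝ} (hw : IsTupleIn X w t)
    (hinj : Function.Injective w) : ∃ j : Fin (r + 2), (coordMatrix w (t ∘ j.succAbove)).det ≠ 0 := by
  have hli := hX.linearIndependent_tuple hw.1 hinj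
  have hli' : LinearIndependent ℝ (fun a b => w a (t b)) := by
    rw [Fintype.linearIndependent_iff] at hli ⊢
    intro g hg
    refine hli g (eq_of_eq_on_range (t := t) (fun i hi => ?_) _ (fun _ _ => rfl) fun b => ?_)
    · simp [hw.2 _ i hi]
    · have := congrFun hg b
      simpa using this
  obtain ⟨u, hu⟩ := exists_linearIndependent_cons_of_lt_finrank hli' (by simp)
  have hdet := (Matrix.linearIndependent_rows_iff_isUnit (A := Matrix.of
    (Fin.cons u (fun a b => w a (t b)) : Fin (r + 2) → Fin (r + 2) → ℝ))).1 hu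
  rw [Matrix.isUnit_iff_isUnit_det] at hdet
  by_contra! h
  have hv : coordMatrix (Fin.cons (Function.extend t u 0) w : Fin (r + 2) → ι → ℝ) t =
      Matrix.of (Fin.cons u (fun a b => w a (t b)) : Fin (r + 2) → Fin (r + 2) → ℝ) := by
    ext a b
    refine Fin.cases ?_ (fun a => ?_) a <;> simp [coordMatrix, ht.extend_apply]
  refine hdet.ne_zero ?_
  rw [← hv, coordMatrix_cons_det]
  simp [h]

lemma mul_pos_of_sign_eq {x y : ℝ} (h : (SignType.sign x : ℤ) = SignType.sign y)
    (h0 : (SignType.sign x : ℤ) ≠ 0) : 0 < x * y := by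
  rcases lt_trichotomy x 0 with hx | rfl | hx
  · rcases lt_trichotomy y 0 with hy | rfl | hy
    · exact mul_pos_of_neg_of_neg hx hy
    · simp [sign_neg hx] at h
    · simp [sign_neg hx, sign_pos hy] at h
  · simp at h0
  · rcases lt_trichotomy y 0 with hy | rfl | hy
    · simp [sign_pos hx, sign_neg hy] at h
    · simp [sign_pos hx] at h
    · exact mul_pos hx hy

/-- Subdivision of simplices commutes with the boundary. -/
theorem bdry_subdiv (hX : VerticesInStd X) {r : ℕ} {t : Fin (r + 2) → ι}
    (ht : Function.Injective t) (hcov : CoversFace X (Set.range t)) :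
    bdry (subdiv X t) = ∑ j : Fin (r + 2), (-1 : ℤ) ^ (j : ℕ) • subdiv X (t ∘ j.succAbove) := by
  classical
  ext w
  simp only [bdry, Finset.sum_apply, Pi.smul_apply, smul_eq_mul]
  -- The signed cofactors: `D j` is the value of the side functional of `w` at the vertex `t j` of
  -- the big simplex.
  set D : Fin (r + 2) → ℝ := fun j => (-1) ^ (j : ℕ) * (coordMatrix w (t ∘ j.succAbove)).det with hD
  set f : (ι → ℝ) → ℤ := fun v => subdiv X t (Fin.cons v w) with hf
  have hdet : ∀ v, (coordMatrix (Fin.cons v w : Fin (r + 2) → ι → ℝ) t).det = ∑ j, v (t j) * D j :=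
    coordMatrix_cons_det t w
  by_cases hw : IsTupleIn X w t
  swap
  · rw [finsum_eq_zero_of_forall_eq_zero (f := f) fun v => if_neg fun h => hw h.tail]
    symm
    refine Finset.sum_eq_zero fun j _ => ?_
    rw [subdiv, if_neg fun h => hw ((isTupleIn_comp_succAbove_iff ht j).1 h).1, mul_zero]
  have hrhs : ∀ j : Fin (r + 2), (-1 : ℤ) ^ (j : ℕ) * subdiv X (t ∘ j.succAbove) w =
      if ∀ a, w a (t j) = 0 then (SignType.sign (D j) : ℤ) else 0 := by
    intro j
    simp only [subdiv, isTupleIn_comp_succAbove_iff ht j, hw, true_and]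
    split_ifs
    · simp only [hD, sign_mul, sign_pow, Left.sign_neg, sign_one]
      push_cast
      rfl
    · simp
  simp only [hrhs]
  have hfval : ∀ v, f v ≠ 0 → IsTupleIn X (Fin.cons v w : Fin (r + 2) → ι → ℝ) t ∧
      f v = (SignType.sign (∑ j, v (t j) * D j) : ℤ) := by
    intro v hv
    have h : IsTupleIn X (Fin.cons v w : Fin (r + 2) → ι → ℝ) t := by
      by_contra h
      exact hv (if_neg h)
    refine ⟨h, ?_⟩
    rw [← hdet]
    exact if_pos h
  by_cases hinj : Function.Injective w
  swap
  · have hD0 : ∀ j, D j = 0 := by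
      intro j
      simp only [Function.Injective, not_forall] at hinj
      obtain ⟨a, a', e, hne⟩ := hinj
      rw [hD]
      simp only [mul_eq_zero]
      right
      exact Matrix.det_zero_of_row_eq hne (by ext b; simp [coordMatrix, e])
    rw [finsum_eq_zero_of_forall_eq_zero (f := f)]
    · simp [hD0]
    · intro v
      by_contra hv
      have := (hfval v hv).2
      simp only [hD0, mul_zero, Finset.sum_const_zero, sign_zero] at this
      exact hv this
  obtain ⟨j₁, hj₁⟩ : ∃ j, D j ≠ 0 := by
    obtain ⟨j, hj⟩ := exists_cofactor_ne_zero hX ht hw hinj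
    exact ⟨j, mul_ne_zero (pow_ne_zero _ (by norm_num)) hj⟩
  -- If `w` lies in the facet opposite to `t j`, every cofactor but `D j` contains the zero column
  -- of `t j`.
  have hzero : ∀ j, (∀ a, w a (t j) = 0) → ∀ j', j' ≠ j → D j' = 0 := by
    intro j hj j' hne
    obtain ⟨b, hb⟩ := Fin.exists_succAbove_eq hne.symm
    rw [hD]
    simp only [mul_eq_zero]
    right
    refine Matrix.det_eq_zero_of_column_eq_zero b fun a => ?_
    simp [coordMatrix, hb, hj a]
  -- The vertex `t j` itself is a point on the side given by the sign of `D j`, so a simplex of `X`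
  -- over `w` exists on that side.
  have hex : ∀ j, D j ≠ 0 → ∃ v, f v = (SignType.sign (D j) : ℤ) := by
    intro j hj
    have hy : (Pi.single (t j) 1 : ι → ℝ) ∈ stdFace (Set.range t) := by
      refine ⟨single_mem_stdSimplex ℝ _, fun i hi => ?_⟩
      rw [Pi.single_eq_of_ne]
      rintro rfl
      exact hi ⟨j, rfl⟩
    have hyd : (coordMatrix (Fin.cons (Pi.single (t j) 1) w : Fin (r + 2) → ι → ℝ) t).det = D j := by
      rw [hdet, Finset.sum_eq_single j]
      · simp
      · intro b _ hb
        rw [Pi.single_eq_of_ne (ht.ne hb), zero_mul]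
      · simp
    obtain ⟨v, hv, hv2⟩ := exists_vertex hX hcov hw hy (ε := D j) (by
      rw [hyd]; exact mul_self_pos.2 hj)
    refine ⟨v, ?_⟩
    have : f v = (SignType.sign (coordMatrix (Fin.cons v w : Fin (r + 2) → ι → ℝ) t).det : ℤ) :=
      if_pos hv
    rw [this]
    rcases lt_or_gt_of_ne hj with h | h
    · rw [sign_neg h, sign_neg (neg_of_mul_pos_right hv2 h.le)]
    · rw [sign_pos h, sign_pos (pos_of_mul_pos_right hv2 h.le)]
  have huniq : ∀ v v', f v ≠ 0 → f v = f v' → v = v' := by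
    intro v v' hv hvv'
    have h1 := hfval v hv
    have h2 := hfval v' (hvv' ▸ hv)
    refine vertex_unique hX h1.1 h2.1 ?_
    rw [hdet, hdet]
    have h3 := h1.2
    rw [hvv', h2.2] at h3
    have h4 : ((SignType.sign (∑ j, v (t j) * D j) : SignType) : ℤ) ≠ 0 := by rw [← h1.2]; exact hv
    exact mul_pos_of_sign_eq h3.symm h4
  -- Coordinates are nonnegative, so the sign of `∑ v (t j) * D j` is the sign of one of its
  -- cofactors. Hence simplices exist over `w` precisely on the sides where some `D j` lies.
  have hsgn : ∀ v, f v ≠ 0 → ∃ j, D j ≠ 0 ∧ f v = (SignType.sign (D j) : ℤ) := by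
    intro v hv
    obtain ⟨h1, h2⟩ := hfval v hv
    have hnn : ∀ i, 0 ≤ v i := by
      have := (hX.tuple h1.1 0).1
      simpa using this
    by_contra! hcon
    rcases lt_trichotomy (∑ j, v (t j) * D j) 0 with h | h | h
    · obtain ⟨j, -, hj⟩ := Finset.exists_lt_of_sum_lt (s := Finset.univ)
        (f := fun j => v (t j) * D j) (g := fun _ => (0 : ℝ)) (by simpa using h)
      have hDj : D j < 0 := neg_of_mul_neg_right hj (hnn _)
      exact hcon j hDj.ne (by rw [h2, sign_neg h, sign_neg hDj])
    · rw [h, sign_zero] at h2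
      exact hv h2
    · obtain ⟨j, -, hj⟩ := Finset.exists_lt_of_sum_lt (s := Finset.univ)
        (g := fun j => v (t j) * D j) (f := fun _ => (0 : ℝ)) (by simpa using h)
      have hDj : 0 < D j := pos_of_mul_pos_right hj (hnn _)
      exact hcon j hDj.ne' (by rw [h2, sign_pos h, sign_pos hDj])
  by_cases hj : ∃ j, ∀ a, w a (t j) = 0
  · obtain ⟨j, hj⟩ := hj
    have hDj : D j ≠ 0 := by
      by_contra h
      by_cases e : j₁ = j
      · exact hj₁ (e ▸ h)
      · exact hj₁ (hzero j hj j₁ e)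
    obtain ⟨v, hv⟩ := hex j hDj
    rw [Finset.sum_eq_single j, if_pos hj]
    · change ∑ᶠ v, f v = _
      rw [finsum_eq_single f v, hv]
      intro v' hv'
      by_contra hne
      obtain ⟨j', hj', e⟩ := hsgn v' hne
      have : j' = j := by
        by_contra hne'
        exact hj' (hzero j hj j' hne')
      rw [this, ← hv] at e
      exact hv' (huniq v' v hne e)
    · intro j' _ hne
      rw [hzero j hj j' hne]
      simp
    · simp
  · push Not at hj
    -- Here `w` lies in no facet of the big simplex, so the sum of its vertices has positive
    -- coordinates on `t`. The side functional vanishes at this sum, which forces cofactors of both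
    -- signs. There are thus exactly two simplices over `w`, and their contributions cancel.
    have hsum : ∑ j, (∑ a, w a (t j)) * D j = 0 := by
      simp only [Finset.sum_mul]
      rw [Finset.sum_comm]
      refine Finset.sum_eq_zero fun a _ => ?_
      rw [← hdet]
      refine Matrix.det_zero_of_row_eq (i := 0) (j := a.succ) (Fin.succ_ne_zero a).symm ?_
      ext b; simp [coordMatrix]
    have hpos : ∀ j, 0 < ∑ a, w a (t j) := by
      intro j
      obtain ⟨a, ha⟩ := hj j
      have hnn : ∀ a, 0 ≤ w a (t j) := fun a => (hX.tuple hw.1 a).1 _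
      exact Finset.sum_pos' (fun a _ => hnn a) ⟨a, Finset.mem_univ a, (hnn a).lt_of_ne' ha⟩
    obtain ⟨jp, hjp⟩ : ∃ j, 0 < D j := by
      by_contra! h
      have := (Finset.sum_eq_zero_iff_of_nonpos fun j _ =>
        mul_nonpos_of_nonneg_of_nonpos (hpos j).le (h j)).1 hsum j₁ (Finset.mem_univ _)
      exact mul_ne_zero (hpos _).ne' hj₁ this
    obtain ⟨jn, hjn⟩ : ∃ j, D j < 0 := by
      by_contra! h
      have := (Finset.sum_eq_zero_iff_of_nonneg fun j _ =>
        mul_nonneg (hpos j).le (h j)).1 hsum j₁ (Finset.mem_univ _)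
      exact mul_ne_zero (hpos _).ne' hj₁ this
    obtain ⟨vp, hvp⟩ := hex jp hjp.ne'
    obtain ⟨vn, hvn⟩ := hex jn hjn.ne
    rw [sign_pos hjp] at hvp
    rw [sign_neg hjn] at hvn
    have hne : vp ≠ vn := by
      rintro rfl
      rw [hvp] at hvn
      exact absurd hvn (by decide)
    change ∑ᶠ v, f v = _
    rw [finsum_eq_finsetSum_of_support_subset (s := {vp, vn}), Finset.sum_pair hne, hvp, hvn]
    · rw [Finset.sum_eq_zero fun j _ => if_neg fun h => (hj j).elim fun a ha => ha (h a)]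
      simp
    · intro v hv
      obtain ⟨j, hj0, e⟩ := hsgn v hv
      simp only [Finset.coe_insert, Finset.coe_singleton, Set.mem_insert_iff,
        Set.mem_singleton_iff]
      rcases lt_or_gt_of_ne hj0 with h | h
      · right
        exact huniq _ _ hv (by rw [e, hvn, sign_neg h])
      · left
        exact huniq _ _ hv (by rw [e, hvp, sign_pos h])

end BoundaryFormula

/-! ### Linear extension to chains -/

section Chains

set_option linter.unusedSectionVars false

lemma IsChain.zero {E : Type*} [AddCommGroup E] [Module ℝ E] (X : SimplicialComplex ℝ E) (r : ℕ) :
    IsChain X r (0 : (Fin (r + 1) → E) → ℤ) :=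
  ⟨by simp, by simp, by simp⟩

lemma IsChain.add {E : Type*} [AddCommGroup E] [Module ℝ E] {X : SimplicialComplex ℝ E} {r : ℕ}
    {c d : (Fin (r + 1) → E) → ℤ} (hc : IsChain X r c) (hd : IsChain X r d) :
    IsChain X r (c + d) where
  alternating π v := by simp [hc.alternating, hd.alternating, mul_add]
  supported v hv := by
    by_cases h : c v = 0
    · exact hd.supported v (by simpa [h] using hv)
    · exact hc.supported v h
  finite := (hc.finite.union hd.finite).subset (Function.support_add _ _)

lemma IsChain.smul {E : Type*} [AddCommGroup E] [Module ℝ E] {X : SimplicialComplex ℝ E} {r : ℕ}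
    {c : (Fin (r + 1) → E) → ℤ} (n : ℤ) (hc : IsChain X r c) : IsChain X r (n • c) where
  alternating π v := by simp [hc.alternating]; ring
  supported v hv := hc.supported v (fun h => hv (by simp [h]))
  finite := hc.finite.subset (Function.support_const_smul_subset _ _)

lemma IsChain.sum {E : Type*} [AddCommGroup E] [Module ℝ E] {X : SimplicialComplex ℝ E} {r : ℕ}
    {α : Type*} (s : Finset α) {c : α → (Fin (r + 1) → E) → ℤ} (hc : ∀ i ∈ s, IsChain X r (c i)) :
    IsChain X r (∑ i ∈ s, c i) :=
  Finset.sum_induction _ (IsChain X r) (fun _ _ => IsChain.add) (IsChain.zero X r) hc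

lemma IsChain.finite_cons {E : Type*} [AddCommGroup E] [Module ℝ E] {X : SimplicialComplex ℝ E}
    {r : ℕ} {c : (Fin (r + 2) → E) → ℤ} (hc : IsChain X (r + 1) c) (w : Fin (r + 1) → E) :
    (Function.support fun v => c (Fin.cons v w)).Finite :=
  hc.finite.preimage (f := fun v => (Fin.cons v w : Fin (r + 2) → E))
    (fun v _ v' _ h => by simpa using congrFun h 0)

lemma bdry_add {E : Type*} [AddCommGroup E] [Module ℝ E] {X : SimplicialComplex ℝ E} {r : ℕ}
    {c d : (Fin (r + 2) → E) → ℤ} (hc : IsChain X (r + 1) c) (hd : IsChain X (r + 1) d) :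
    bdry (c + d) = bdry c + bdry d := by
  ext w
  exact finsum_add_distrib (hc.finite_cons w) (hd.finite_cons w)

lemma bdry_smul {E : Type*} {r : ℕ} (n : ℤ) (c : (Fin (r + 2) → E) → ℤ) :
    bdry (n • c) = n • bdry c := by
  ext w
  simp only [bdry, Pi.smul_apply, smul_eq_mul]
  rw [mul_finsum]

lemma bdry_zero {E : Type*} {r : ℕ} : bdry (0 : (Fin (r + 2) → E) → ℤ) = 0 := by
  ext w
  simp [bdry]

lemma bdry_sum {E : Type*} [AddCommGroup E] [Module ℝ E] {X : SimplicialComplex ℝ E} {r : ℕ}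
    {α : Type*} (s : Finset α) {c : α → (Fin (r + 2) → E) → ℤ}
    (hc : ∀ i ∈ s, IsChain X (r + 1) (c i)) : bdry (∑ i ∈ s, c i) = ∑ i ∈ s, bdry (c i) := by
  classical
  induction s using Finset.induction_on with
  | empty => simp [bdry_zero]
  | insert a s ha ih =>
    rw [Finset.sum_insert ha, Finset.sum_insert ha, bdry_add (X := X)
      (hc a (Finset.mem_insert_self _ _)) (IsChain.sum s fun i hi => hc i (Finset.mem_insert_of_mem hi)),
      ih fun i hi => hc i (Finset.mem_insert_of_mem hi)]

variable {ι : Type*} [Fintype ι] {X : SimplicialComplex ℝ (ι → ℝ)}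

lemma isTupleIn_comp_perm {n m : ℕ} {t : Fin m → ι} {v : Fin n → ι → ℝ} (π : Equiv.Perm (Fin n)) :
    IsTupleIn X (v ∘ π) t ↔ IsTupleIn X v t := by
  simp only [IsTupleIn, IsFaceTuple, π.surjective.range_comp]
  refine and_congr_right fun _ => ⟨fun h a => ?_, fun h a => h (π a)⟩
  simpa using h (π.symm a)

lemma isChain_subdiv (hfin : X.faces.Finite) {r : ℕ} (t : Fin (r + 1) → ι) :
    IsChain X r (subdiv X t) where
  alternating π v := by
    by_cases h : IsTupleIn X v t
    · rw [subdiv, subdiv, if_pos h, if_pos ((isTupleIn_comp_perm π).2 h)]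
      have : coordMatrix (v ∘ π) t = (coordMatrix v t).submatrix π id := rfl
      rw [this, Matrix.det_permute]
      rcases Int.units_eq_one_or (Equiv.Perm.sign π) with h | h <;>
      simp [h, Left.sign_neg]
    · rw [subdiv, subdiv, if_neg h, if_neg (mt (isTupleIn_comp_perm π).1 h), mul_zero]
  supported v hv := by
    have h : IsTupleIn X v t := by
      by_contra h
      exact hv (if_neg h)
    refine ⟨fun a a' e => ?_, h.1⟩
    by_contra hne
    refine hv ?_
    rw [subdiv, if_pos h, Matrix.det_zero_of_row_eq hne (by ext b; simp [coordMatrix, e])]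
    simp
  finite := by
    have hV : (⋃ s ∈ X.faces, (s : Set (ι → ℝ))).Finite :=
      hfin.biUnion fun s _ => s.finite_toSet
    refine (Set.Finite.pi fun _ : Fin (r + 1) => hV).subset fun v hv a _ => ?_
    have h : IsTupleIn X v t := by
      by_contra h
      exact hv (if_neg h)
    obtain ⟨s, hs, e⟩ := h.1
    exact Set.mem_biUnion hs (e ▸ ⟨a, rfl⟩)

/-- The subdivision operator, from chains of a simplicial complex on the vertex set `ι` to chains
of its subdivision `X`. -/
def subdivHom (X : SimplicialComplex ℝ (ι → ℝ)) (r : ℕ) :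
    ((Fin (r + 1) → ι) →₀ ℤ) →ₗ[ℤ] ((Fin (r + 1) → ι → ℝ) → ℤ) :=
  Finsupp.linearCombination ℤ (subdiv X)

lemma subdivHom_apply {r : ℕ} (c : (Fin (r + 1) → ι) →₀ ℤ) :
    subdivHom X r c = ∑ t ∈ c.support, c t • subdiv X t :=
  Finsupp.linearCombination_apply ..

lemma isChain_subdivHom (hfin : X.faces.Finite) {r : ℕ} (c : (Fin (r + 1) → ι) →₀ ℤ) :
    IsChain X r (subdivHom X r c) := by
  rw [subdivHom_apply]
  exact IsChain.sum _ fun t _ => (isChain_subdiv hfin t).smul _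

/-- The boundary operator on ordered simplices. -/
def orderedBdry (ι : Type*) (r : ℕ) :
    ((Fin (r + 2) → ι) →₀ ℤ) →ₗ[ℤ] ((Fin (r + 1) → ι) →₀ ℤ) :=
  Finsupp.linearCombination ℤ fun t =>
    ∑ j : Fin (r + 2), (-1 : ℤ) ^ (j : ℕ) • Finsupp.single (t ∘ j.succAbove) 1

theorem bdry_subdivHom (hX : VerticesInStd X) (hfin : X.faces.Finite) {r : ℕ}
    (c : (Fin (r + 2) → ι) →₀ ℤ)
    (hc : ∀ t ∈ c.support, Function.Injective t ∧ CoversFace X (Set.range t)) :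
    bdry (subdivHom X (r + 1) c) = subdivHom X r (orderedBdry ι r c) := by
  rw [subdivHom_apply, bdry_sum (X := X) _ fun t _ => (isChain_subdiv hfin t).smul _, orderedBdry,
    Finsupp.linearCombination_apply, Finsupp.sum, map_sum]
  refine Finset.sum_congr rfl fun t ht => ?_
  rw [bdry_smul, bdry_subdiv hX (hc t ht).1 (hc t ht).2, map_smul, map_sum]
  congr 1
  refine Finset.sum_congr rfl fun j _ => ?_
  rw [map_smul]
  congr 1
  simp [subdivHom]

end Chains

/-! ### Subdivisions of the join and equivariance -/

section Join

set_option linter.unusedSectionVars false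

lemma convexHull_single_image {ι : Type*} [Fintype ι] [DecidableEq ι] [DecidableEq (ι → ℝ)]
    (T : Finset ι) :
    convexHull ℝ ((T.image fun i => (Pi.single i (1 : ℝ) : ι → ℝ) : Finset (ι → ℝ)) : Set (ι → ℝ)) =
      stdFace (T : Set ι) := by
  apply Set.Subset.antisymm
  · refine convexHull_min ?_ (convex_stdFace _)
    intro x hx
    obtain ⟨i, hi, rfl⟩ := Finset.mem_image.1 (Finset.mem_coe.1 hx)
    refine ⟨single_mem_stdSimplex ℝ i, fun j hj => ?_⟩
    rw [Pi.single_eq_of_ne]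
    rintro rfl
    exact hj hi
  · rintro x ⟨⟨h0, h1⟩, h2⟩
    have hx : ∑ i ∈ T, x i • (Pi.single i (1 : ℝ) : ι → ℝ) = x := by
      ext j
      simp only [Finset.sum_apply, Pi.smul_apply, smul_eq_mul, Pi.single_apply, mul_ite, mul_one,
        mul_zero, Finset.sum_ite_eq]
      split_ifs with h
      · rfl
      · exact (h2 j h).symm
    rw [← hx]
    refine (convex_convexHull ℝ _).sum_mem (fun i _ => h0 i) ?_ fun i hi =>
      subset_convexHull ℝ _ (by
        rw [Finset.mem_coe]
        exact Finset.mem_image_of_mem (fun i => (Pi.single i (1 : ℝ) : ι → ℝ)) hi)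
    rw [← h1]
    exact Finset.sum_subset (Finset.subset_univ T) fun i _ hi => h2 i hi

variable {k m : ℕ}

lemma mem_joinComplex_faces [NeZero k] {s : Finset (Space k m)} [DecidableEq (Space k m)] :
    s ∈ (joinComplex k m).faces ↔ ∃ T : Finset (ZMod k × Fin m), T.Nonempty ∧
      Set.InjOn Prod.snd (T : Set (ZMod k × Fin m)) ∧
      T.image (fun i => (Pi.single i (1 : ℝ) : Space k m)) = s := by
  constructor
  · rintro ⟨T, ⟨h1, h2⟩, rfl⟩
    refine ⟨T, h1, h2, ?_⟩
    ext x
    simp only [Finset.mem_image]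
  · rintro ⟨T, h1, h2, rfl⟩
    refine ⟨T, ⟨h1, h2⟩, ?_⟩
    ext x
    simp only [Finset.mem_image]

variable [NeZero k] {X : SimplicialComplex ℝ (Space k m)}

lemma IsSubdivision.coversFace (h : IsSubdivision X (joinComplex k m)) {T : Finset (ZMod k × Fin m)}
    (hT : T.Nonempty) (hi : Set.InjOn Prod.snd (T : Set (ZMod k × Fin m))) :
    CoversFace X (T : Set (ZMod k × Fin m)) := by
  classical
  obtain ⟨F, hF, hFX, e⟩ := h.2 _ (mem_joinComplex_faces.2 ⟨T, hT, hi, rfl⟩)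
  rw [convexHull_single_image] at e
  exact ⟨F, hF, hFX, e⟩

lemma IsSubdivision.exists_stdFace (h : IsSubdivision X (joinComplex k m)) {s : Finset (Space k m)}
    (hs : s ∈ X.faces) : ∃ T : Finset (ZMod k × Fin m), T.Nonempty ∧
      Set.InjOn Prod.snd (T : Set (ZMod k × Fin m)) ∧
      convexHull ℝ (s : Set (Space k m)) ⊆ stdFace (T : Set (ZMod k × Fin m)) := by
  classical
  obtain ⟨t, ht, hst⟩ := h.1 s hs
  obtain ⟨T, hT, hi, rfl⟩ := mem_joinComplex_faces.1 ht
  rw [convexHull_single_image] at hst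
  exact ⟨T, hT, hi, hst⟩

lemma IsSubdivision.verticesInStd (h : IsSubdivision X (joinComplex k m)) : VerticesInStd X := by
  intro s hs v hv
  obtain ⟨T, -, -, hT⟩ := h.exists_stdFace hs
  exact (hT (subset_convexHull ℝ _ hv)).1

/-- Each of the finitely many simplices of the join is covered by finitely many simplices of `X`.
The barycenter of an arbitrary simplex of `X` lies in one of these, which therefore has the simplex
as a face. -/
lemma IsSubdivision.finite_faces (h : IsSubdivision X (joinComplex k m)) : X.faces.Finite := by
  classical
  have hcov : ∀ T : Finset (ZMod k × Fin m), ∃ F : Set (Finset (Space k m)), F.Finite ∧ F ⊆ X.faces ∧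
      (T.Nonempty → Set.InjOn Prod.snd (T : Set (ZMod k × Fin m)) →
        stdFace (T : Set (ZMod k × Fin m)) = ⋃ s ∈ F, convexHull ℝ (s : Set (Space k m))) := by
    intro T
    by_cases hT : T.Nonempty ∧ Set.InjOn Prod.snd (T : Set (ZMod k × Fin m))
    · obtain ⟨F, h1, h2, h3⟩ := h.coversFace hT.1 hT.2
      exact ⟨F, h1, h2, fun _ _ => h3⟩
    · exact ⟨∅, Set.finite_empty, Set.empty_subset _, fun h1 h2 => (hT ⟨h1, h2⟩).elim⟩
  choose F hF hFX hFc using hcov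
  have hfin : (⋃ T, ⋃ s ∈ F T, ((s.powerset : Finset (Finset (Space k m))) :
      Set (Finset (Space k m)))).Finite :=
    Set.finite_iUnion fun T => (hF T).biUnion fun s _ => s.powerset.finite_toSet
  refine hfin.subset fun s hs => ?_
  obtain ⟨T, hT, hi, hsT⟩ := h.exists_stdFace hs
  obtain ⟨r, hr⟩ : ∃ r, s.card = r + 1 :=
    ⟨s.card - 1, by have := (X.nonempty_of_mem_faces hs).card_pos; omega⟩
  set e := s.equivFinOfCardEq hr
  have hrange : Set.range (fun i => (e.symm i : Space k m)) = s := by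
    ext z
    constructor
    · rintro ⟨i, rfl⟩
      exact (e.symm i).2
    · intro hz
      exact ⟨e ⟨z, hz⟩, by simp⟩
  have hmem : ∑ a, ((r : ℝ) + 1)⁻¹ • (e.symm a : Space k m) ∈ convexHull ℝ (s : Set (Space k m)) := by
    refine (convex_convexHull ℝ _).sum_mem (fun _ _ => by positivity) ?_ fun a _ =>
      subset_convexHull ℝ _ (e.symm a).2
    have : (r : ℝ) + 1 ≠ 0 := by positivity
    simp [this]
  have := hsT hmem
  rw [hFc T hT hi] at this
  obtain ⟨s', hs', hc⟩ := Set.mem_iUnion₂.1 this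
  refine Set.mem_iUnion.2 ⟨T, Set.mem_biUnion hs' ?_⟩
  rw [Finset.mem_coe, Finset.mem_powerset, ← Finset.coe_subset, ← hrange]
  exact range_subset_of_center_mem h.verticesInStd ⟨s, hs, hrange.symm⟩ (hFX _ hs') hc

lemma IsSubdivision.coversFace_range (h : IsSubdivision X (joinComplex k m)) {n : ℕ}
    {t : Fin (n + 1) → ZMod k × Fin m} (ht : Function.Injective fun i => (t i).2) :
    CoversFace X (Set.range t) := by
  classical
  have := h.coversFace (T := Finset.univ.image t) ⟨t 0, by simp⟩ (by
    rintro _ hx _ hy e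
    obtain ⟨i, -, rfl⟩ := Finset.mem_image.1 (Finset.mem_coe.1 hx)
    obtain ⟨j, -, rfl⟩ := Finset.mem_image.1 (Finset.mem_coe.1 hy)
    rw [ht e])
  simpa using this

lemma rot_apply (g : ZMod k) (x : Space k m) (i : ZMod k × Fin m) :
    rot g x i = x (-g + i.1, i.2) := rfl

lemma rot_zero (x : Space k m) : rot 0 x = x := by
  ext i; simp [rot_apply]

lemma rot_add (g h : ZMod k) (x : Space k m) : rot (g + h) x = rot g (rot h x) := by
  ext i
  simp only [rot_apply]
  congr 2
  abel

lemma IsInvariant.isFaceTuple_rot (hinv : IsInvariant X) {n : ℕ} (g : ZMod k) {v : Fin n → Space k m}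
    (hv : IsFaceTuple X v) : IsFaceTuple X fun i => rot g (v i) := by
  obtain ⟨s, hs, e⟩ := hv
  refine ⟨_, hinv g s hs, ?_⟩
  rw [Finset.coe_map, e, ← Set.range_comp]
  rfl

lemma IsInvariant.isFaceTuple_rot_iff (hinv : IsInvariant X) {n : ℕ} (g : ZMod k)
    {v : Fin n → Space k m} : IsFaceTuple X (fun i => rot g (v i)) ↔ IsFaceTuple X v := by
  refine ⟨fun h => ?_, hinv.isFaceTuple_rot g⟩
  have := hinv.isFaceTuple_rot (-g) h
  simpa [← rot_add, rot_zero] using this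

/-- The action of `ZMod k` on tuples of vertices of the join. -/
def shiftTuple {n : ℕ} (g : ZMod k) (t : Fin n → ZMod k × Fin m) : Fin n → ZMod k × Fin m :=
  fun i => (g + (t i).1, (t i).2)

/-- The action of `ZMod k` on the chains of the join. -/
def shiftChain {n : ℕ} (g : ZMod k) :
    ((Fin n → ZMod k × Fin m) →₀ ℤ) →ₗ[ℤ] ((Fin n → ZMod k × Fin m) →₀ ℤ) :=
  Finsupp.lmapDomain ℤ ℤ (shiftTuple g)

/-- The action permutes coordinates, so moving the points back by `g` or the vertices of the join
forward by `g` gives the same coordinate matrix. -/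
lemma translate_subdiv (hinv : IsInvariant X) {r : ℕ} (g : ZMod k)
    (t : Fin (r + 1) → ZMod k × Fin m) :
    translate g (subdiv X t) = subdiv X (shiftTuple g t) := by
  ext v
  have h : IsTupleIn X (fun i => rot (-g) (v i)) t ↔ IsTupleIn X v (shiftTuple g t) := by
    simp only [IsTupleIn, hinv.isFaceTuple_rot_iff]
    refine and_congr_right fun _ => forall_congr' fun a => ?_
    simp only [rot_apply, neg_neg]
    constructor
    · intro h i hi
      have := h (-g + i.1, i.2) (by
        rintro ⟨b, hb⟩
        refine hi ⟨b, ?_⟩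
        simp [shiftTuple, hb])
      simpa using this
    · intro h i hi
      refine h _ ?_
      rintro ⟨b, hb⟩
      refine hi ⟨b, ?_⟩
      simp only [shiftTuple, Prod.mk.injEq, add_right_inj] at hb
      exact Prod.ext hb.1 hb.2
  have hdet : coordMatrix (fun i => rot (-g) (v i)) t = coordMatrix v (shiftTuple g t) := by
    ext a b
    simp [coordMatrix, rot_apply, shiftTuple]
  simp only [translate, subdiv, hdet]
  by_cases hv : IsTupleIn X v (shiftTuple g t)
  · rw [if_pos hv, if_pos (h.2 hv)]
  · rw [if_neg hv, if_neg (mt h.1 hv)]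

lemma translate_subdivHom (hinv : IsInvariant X) {r : ℕ} (g : ZMod k)
    (c : (Fin (r + 1) → ZMod k × Fin m) →₀ ℤ) :
    translate g (subdivHom X r c) = subdivHom X r (shiftChain g c) := by
  induction c using Finsupp.induction_linear with
  | zero => ext v; simp [translate]
  | add c d hc hd =>
    rw [map_add, map_add, map_add, ← hc, ← hd]
    rfl
  | single t n =>
    simp only [subdivHom, shiftChain, Finsupp.lmapDomain_apply, Finsupp.mapDomain_single,
      Finsupp.linearCombination_single]
    rw [← translate_subdiv hinv]
    rfl

/-- The action of `σ` on the chains of the join. -/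
def sigmaChain {n : ℕ} :
    ((Fin n → ZMod k × Fin m) →₀ ℤ) →ₗ[ℤ] ((Fin n → ZMod k × Fin m) →₀ ℤ) :=
  ∑ j ∈ Finset.range k, shiftChain (j : ZMod k)

/-- The action of `τ` on the chains of the join. -/
def tauChain {n : ℕ} :
    ((Fin n → ZMod k × Fin m) →₀ ℤ) →ₗ[ℤ] ((Fin n → ZMod k × Fin m) →₀ ℤ) :=
  shiftChain 1 - LinearMap.id

lemma sigmaMul_subdivHom (hinv : IsInvariant X) {r : ℕ}
    (c : (Fin (r + 1) → ZMod k × Fin m) →₀ ℤ) :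
    sigmaMul (subdivHom X r c) = subdivHom X r (sigmaChain c) := by
  rw [sigmaMul, sigmaChain, LinearMap.sum_apply, map_sum]
  exact Finset.sum_congr rfl fun j _ => translate_subdivHom hinv _ c

lemma tauMul_subdivHom (hinv : IsInvariant X) {r : ℕ}
    (c : (Fin (r + 1) → ZMod k × Fin m) →₀ ℤ) :
    tauMul (subdivHom X r c) = subdivHom X r (tauChain c) := by
  rw [tauMul, tauChain, LinearMap.sub_apply, map_sub, translate_subdivHom hinv, LinearMap.id_apply]

end Join

/-! ### The generalized sphere in the join -/

section JoinChains

set_option linter.unusedSectionVars false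

lemma sum_range_natCast {k : ℕ} [NeZero k] {M : Type*} [AddCommMonoid M] (f : ZMod k → M) :
    ∑ j ∈ Finset.range k, f (j : ZMod k) = ∑ g, f g := by
  refine Finset.sum_nbij' (fun j => (j : ZMod k)) ZMod.val ?_ ?_ ?_ ?_ ?_
  · simp
  · intro g _
    exact Finset.mem_range.2 (ZMod.val_lt g)
  · intro j hj
    exact ZMod.val_natCast_of_lt (Finset.mem_range.1 hj)
  · intro g _
    exact ZMod.natCast_zmod_val g
  · simp

variable {k m : ℕ}

lemma shiftTuple_zero {n : ℕ} (t : Fin n → ZMod k × Fin m) : shiftTuple 0 t = t := by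
  ext i <;> simp [shiftTuple]

lemma shiftTuple_add {n : ℕ} (g h : ZMod k) (t : Fin n → ZMod k × Fin m) :
    shiftTuple g (shiftTuple h t) = shiftTuple (g + h) t := by
  ext i <;> simp [shiftTuple, add_assoc]

lemma shiftTuple_injective {n : ℕ} (g : ZMod k) :
    Function.Injective (shiftTuple (n := n) (m := m) g) := by
  intro t t' h
  have := congrArg (shiftTuple (-g)) h
  simpa [shiftTuple_add, shiftTuple_zero] using this

lemma shiftChain_apply {n : ℕ} (g : ZMod k) (c : (Fin n → ZMod k × Fin m) →₀ ℤ)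
    (t : Fin n → ZMod k × Fin m) : shiftChain g c t = c (shiftTuple (-g) t) := by
  have h : t = shiftTuple g (shiftTuple (-g) t) := by simp [shiftTuple_add, shiftTuple_zero]
  rw [shiftChain, Finsupp.lmapDomain_apply]
  conv_lhs => rw [h]
  exact Finsupp.mapDomain_apply (shiftTuple_injective g) _ _

lemma shiftChain_add {n : ℕ} (g h : ZMod k) (c : (Fin n → ZMod k × Fin m) →₀ ℤ) :
    shiftChain g (shiftChain h c) = shiftChain (g + h) c := by
  ext t
  simp only [shiftChain_apply, shiftTuple_add]
  congr 2
  abel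

lemma sigmaChain_eq_sum [NeZero k] {n : ℕ} (c : (Fin n → ZMod k × Fin m) →₀ ℤ) :
    sigmaChain c = ∑ g, shiftChain g c := by
  rw [sigmaChain, LinearMap.sum_apply, sum_range_natCast fun g => shiftChain g c]

lemma shiftChain_sigmaChain [NeZero k] {n : ℕ} (g : ZMod k) (c : (Fin n → ZMod k × Fin m) →₀ ℤ) :
    shiftChain g (sigmaChain c) = sigmaChain c := by
  simp only [sigmaChain_eq_sum, map_sum, shiftChain_add]
  exact Fintype.sum_equiv (Equiv.addLeft g) _ _ fun _ => rfl

lemma sigmaChain_shiftChain [NeZero k] {n : ℕ} (g : ZMod k) (c : (Fin n → ZMod k × Fin m) →₀ ℤ) :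
    sigmaChain (shiftChain g c) = sigmaChain c := by
  simp only [sigmaChain_eq_sum, shiftChain_add]
  exact Fintype.sum_equiv (Equiv.addRight g) _ _ fun _ => rfl

lemma tauChain_sigmaChain [NeZero k] {n : ℕ} (c : (Fin n → ZMod k × Fin m) →₀ ℤ) :
    tauChain (sigmaChain c) = 0 := by
  simp [tauChain, shiftChain_sigmaChain]

lemma sigmaChain_tauChain [NeZero k] {n : ℕ} (c : (Fin n → ZMod k × Fin m) →₀ ℤ) :
    sigmaChain (tauChain c) = 0 := by
  simp [tauChain, sigmaChain_shiftChain]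

/-- The cone over a chain with apex `a`. -/
def coneChain {ι : Type*} {n : ℕ} (a : ι) : ((Fin n → ι) →₀ ℤ) →ₗ[ℤ] ((Fin (n + 1) → ι) →₀ ℤ) :=
  Finsupp.lmapDomain ℤ ℤ fun t => (Fin.cons a t : Fin (n + 1) → ι)

open Classical in
lemma coneChain_apply {ι : Type*} {n : ℕ} (a : ι) (c : (Fin n → ι) →₀ ℤ) (t : Fin (n + 1) → ι) :
    coneChain a c t = if t 0 = a then c (Fin.tail t) else 0 := by
  rw [coneChain, Finsupp.lmapDomain_apply]
  split_ifs with h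
  · have e : t = (fun t => (Fin.cons a t : Fin (n + 1) → ι)) (Fin.tail t) := by
      simp [← h]
    conv_lhs => rw [e]
    exact Finsupp.mapDomain_apply (Fin.cons_right_injective (α := fun _ => ι) a) _ _
  · refine Finsupp.mapDomain_of_notMem_range _ _ ?_
    rintro ⟨t', rfl⟩
    exact h (by simp)

/-- Deleting the apex returns the base; every other face is a cone over a face of the base, with
opposite sign because of the shift of indices. -/
lemma orderedBdry_coneChain {ι : Type*} {r : ℕ} (a : ι) (c : (Fin (r + 2) → ι) →₀ ℤ) :
    orderedBdry ι (r + 1) (coneChain a c) = c - coneChain a (orderedBdry ι r c) := by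
  induction c using Finsupp.induction_linear with
  | zero => simp
  | add c d hc hd => simp only [map_add, hc, hd]; abel
  | single t n =>
    simp only [coneChain, orderedBdry, Finsupp.lmapDomain_apply, Finsupp.mapDomain_single,
      Finsupp.linearCombination_single, Finsupp.mapDomain_smul]
    rw [Fin.sum_univ_succ, smul_add, ← Finsupp.lmapDomain_apply ℤ ℤ, map_sum, sub_eq_add_neg,
      ← smul_neg, ← Finset.sum_neg_distrib]
    congr 1
    · simp [Function.comp_def]
    · congr 1
      refine Finset.sum_congr rfl fun j _ => ?_
      have : (Fin.cons a t : Fin (r + 3) → ι) ∘ j.succ.succAbove =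
          Fin.cons a (t ∘ j.succAbove) := by
        ext i
        refine Fin.cases ?_ (fun i => ?_) i <;> simp
      rw [map_smul, Finsupp.lmapDomain_apply, Finsupp.mapDomain_single, this, Fin.val_succ, pow_succ]
      simp

lemma orderedBdry_shiftChain {r : ℕ} (g : ZMod k) (c : (Fin (r + 2) → ZMod k × Fin m) →₀ ℤ) :
    orderedBdry _ r (shiftChain g c) = shiftChain g (orderedBdry _ r c) := by
  induction c using Finsupp.induction_linear with
  | zero => simp
  | add c d hc hd => simp only [map_add, hc, hd]
  | single t n =>
    simp only [shiftChain, orderedBdry, Finsupp.lmapDomain_apply, Finsupp.mapDomain_single,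
      Finsupp.linearCombination_single, Finsupp.mapDomain_smul]
    rw [← Finsupp.lmapDomain_apply ℤ ℤ, map_sum]
    congr 1
    refine Finset.sum_congr rfl fun j _ => ?_
    rw [map_smul, Finsupp.lmapDomain_apply, Finsupp.mapDomain_single]
    rfl

lemma orderedBdry_sigmaChain {r : ℕ} (c : (Fin (r + 2) → ZMod k × Fin m) →₀ ℤ) :
    orderedBdry _ r (sigmaChain c) = sigmaChain (orderedBdry _ r c) := by
  simp [sigmaChain, orderedBdry_shiftChain]

lemma orderedBdry_tauChain {r : ℕ} (c : (Fin (r + 2) → ZMod k × Fin m) →₀ ℤ) :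
    orderedBdry _ r (tauChain c) = tauChain (orderedBdry _ r c) := by
  simp [tauChain, orderedBdry_shiftChain]

/-- `τ c` in even dimensions and `σ c` in odd dimensions. -/
def sphereOf (r : ℕ) {n : ℕ} (c : (Fin n → ZMod k × Fin m) →₀ ℤ) :
    (Fin n → ZMod k × Fin m) →₀ ℤ :=
  if Even r then tauChain c else sigmaChain c

/-- The standard generalized sphere in the join of `m` copies of `ZMod k`. -/
def joinChain (k m : ℕ) [NeZero m] : (r : ℕ) → (Fin (r + 1) → ZMod k × Fin m) →₀ ℤ
  | 0 => Finsupp.single (fun _ => (0, Fin.ofNat m 0)) 1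
  | r + 1 => coneChain (0, Fin.ofNat m (r + 1)) (sphereOf r (joinChain k m r))

variable [NeZero k] [NeZero m]

/-- The boundary is equivariant, so `∂ σ c = σ τ b = 0` or `∂ τ c = τ σ b = 0`. This makes the base
of the next cone a cycle. -/
lemma orderedBdry_sphereOf {r : ℕ} {c : (Fin (r + 2) → ZMod k × Fin m) →₀ ℤ}
    {b : (Fin (r + 1) → ZMod k × Fin m) →₀ ℤ} (h : orderedBdry _ r c = sphereOf r b) :
    orderedBdry _ r (sphereOf (r + 1) c) = 0 := by
  by_cases hr : Even r
  · have h' : ¬ Even (r + 1) := by rwa [Nat.even_add_one, not_not]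
    rw [sphereOf, if_neg h', orderedBdry_sigmaChain, h, sphereOf, if_pos hr, sigmaChain_tauChain]
  · have h' : Even (r + 1) := by rwa [Nat.even_add_one]
    rw [sphereOf, if_pos h', orderedBdry_tauChain, h, sphereOf, if_neg hr, tauChain_sigmaChain]

lemma orderedBdry_joinChain (r : ℕ) :
    orderedBdry _ r (joinChain k m (r + 1)) = sphereOf r (joinChain k m r) := by
  induction r with
  | zero =>
    simp only [joinChain, sphereOf, Even.zero, if_true, tauChain, shiftChain, coneChain,
      LinearMap.sub_apply, LinearMap.id_apply, map_sub, Finsupp.lmapDomain_apply,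
      Finsupp.mapDomain_single, orderedBdry, Finsupp.linearCombination_single]
    have h0 : ∀ (a b : ZMod k × Fin m), (Fin.cons a (fun _ => b) : Fin 2 → ZMod k × Fin m) ∘
        Fin.succAbove 0 = fun _ => b := by
      intro a b; ext i <;> simp
    have h1 : ∀ (a b : ZMod k × Fin m), (Fin.cons a (fun _ => b) : Fin 2 → ZMod k × Fin m) ∘
        Fin.succAbove 1 = fun _ => a := by
      intro a b
      ext i <;> (have : i = 0 := Subsingleton.elim _ _) <;> subst this <;> rfl
    have h2 : shiftTuple (1 : ZMod k) (fun _ : Fin 1 => ((0 : ZMod k), Fin.ofNat m 0)) =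
      fun _ => (1, Fin.ofNat m 0) := by ext i <;> simp [shiftTuple]
    have h3 : ∀ (a b : ZMod k × Fin m), ∑ j : Fin (0 + 2), (-1 : ℤ) ^ (j : ℕ) •
        Finsupp.single ((Fin.cons a (fun _ => b) : Fin (0 + 2) → ZMod k × Fin m) ∘ j.succAbove)
          (1 : ℤ) = Finsupp.single (fun _ => b) 1 - Finsupp.single (fun _ => a) 1 := by
      intro a b
      refine (Fin.sum_univ_two _).trans ?_
      rw [h0, h1]
      simp [sub_eq_add_neg]
    rw [h2, h3, h3]
    simp
  | succ r ih =>
    rw [joinChain, orderedBdry_coneChain, orderedBdry_sphereOf ih, map_zero, sub_zero]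

lemma orderedBdry_sphereOf_joinChain (r : ℕ) :
    orderedBdry _ r (sphereOf (r + 1) (joinChain k m (r + 1))) = 0 :=
  orderedBdry_sphereOf (orderedBdry_joinChain r)

/-- The sign sequences that describe the maximal simplices of a sphere in the join: a cycle of
length `2 k` in each pair of consecutive copies of `ZMod k`, and two points in the last copy if
their number `n` is odd. -/
def GoodSigns {k : ℕ} (n : ℕ) (s : ℕ → ZMod k) : Prop :=
  (∀ c, Even c → c + 1 < n → s c = s (c + 1) ∨ s c = s (c + 1) + 1) ∧
  ∀ c, Even c → c + 1 = n → s c = 0 ∨ s c = 1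

/-- The simplex with signs `s` in the first `n` copies, ordered by decreasing copies. -/
def levelTuple (m : ℕ) [NeZero m] {k : ℕ} (n : ℕ) (s : ℕ → ZMod k) : Fin n → ZMod k × Fin m :=
  fun j => (s (n - 1 - j), Fin.ofNat m (n - 1 - j))

lemma levelTuple_succ (n : ℕ) (s : ℕ → ZMod k) :
    levelTuple m (n + 1) s = Fin.cons (s n, Fin.ofNat m n) (levelTuple m n s) := by
  funext i
  refine Fin.cases ?_ (fun i => ?_) i
  · simp [levelTuple]
  · have : n - (i.val + 1) = n - 1 - i := by omega
    simp [levelTuple, this]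

lemma levelTuple_congr {n : ℕ} {s s' : ℕ → ZMod k} (h : ∀ i < n, s i = s' i) :
    levelTuple m n s = levelTuple m n s' := by
  funext j
  simp only [levelTuple]
  rw [h _ (by omega)]

/-- The coefficients of a chain on the sphere described by `GoodSigns` are `±1`, and its other
coefficients are `0`. -/
def IsSphereCoeff {k m : ℕ} [NeZero m] (n : ℕ) (c : (Fin n → ZMod k × Fin m) → ℤ) : Prop :=
  (∀ t, c t ≠ 0 → ∃ s, GoodSigns n s ∧ t = levelTuple m n s) ∧
  ∀ s, GoodSigns n s → c (levelTuple m n s) = 1 ∨ c (levelTuple m n s) = -1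

-- Passage to an odd number of copies: the last copy contributes the two signs `0` and `1`, and each
-- is joined with all simplices of the sphere in the previous copies.
open Classical in
lemma IsSphereCoeff.suspension (hk : 2 ≤ k) {n : ℕ} (hn : Even n)
    {c : (Fin n → ZMod k × Fin m) → ℤ}
    (hc : IsSphereCoeff n c) {c' : (Fin (n + 1) → ZMod k × Fin m) → ℤ}
    (hc' : ∀ t, c' t = ((if t 0 = (1, Fin.ofNat m n) then 1 else 0) -
      (if t 0 = (0, Fin.ofNat m n) then 1 else 0)) * c (Fin.tail t)) : IsSphereCoeff (n + 1) c' := by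
  have : Fact (1 < k) := ⟨hk⟩
  constructor
  · intro t ht
    rw [hc'] at ht
    obtain ⟨s, hs, e⟩ := hc.1 _ (right_ne_zero_of_mul ht)
    have h0 : t 0 = (1, Fin.ofNat m n) ∨ t 0 = (0, Fin.ofNat m n) := by
      by_contra! h
      rw [if_neg h.1, if_neg h.2] at ht
      simp at ht
    refine ⟨Function.update s n (t 0).1, ⟨fun i hi hin => ?_, fun i _ hin => ?_⟩, ?_⟩
    · have h1 : i + 1 ≠ n := by
        rintro rfl
        exact (Nat.even_add_one.1 hn) hi
      rw [Function.update_of_ne (by omega), Function.update_of_ne h1]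
      exact hs.1 i hi (by omega)
    · obtain rfl : i = n := by omega
      rw [Function.update_self]
      rcases h0 with h | h <;> simp [h]
    · rw [levelTuple_succ, levelTuple_congr (s' := s) fun i hi => Function.update_of_ne hi.ne _ _, ← e,
        Function.update_self]
      have : ((t 0).1, Fin.ofNat m n) = t 0 := by
        rcases h0 with h | h <;> rw [h]
      rw [this, Fin.cons_self_tail]
  · intro s hs
    rw [hc', levelTuple_succ]
    have h1 := hc.2 s ⟨fun i hi hin => hs.1 i hi (by omega), fun i hi hin => by
      subst hin
      exact absurd hi (Nat.even_add_one.1 hn)⟩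
    have h2 := hs.2 n hn rfl
    simp only [Fin.cons_zero, Fin.tail_cons, Prod.mk.injEq, and_true]
    rcases h2 with h | h <;> simpa [h, or_comm, neg_eq_iff_eq_neg] using h1

-- Passage from `n` to `n + 2` copies: the new copies contribute the edges of a `2k`-cycle, in which
-- the sign `a` of the upper copy is adjacent to the signs `a` and `a + 1` of the lower one.
open Classical in
lemma IsSphereCoeff.join_cycle (hk : 2 ≤ k) {n : ℕ} (hn : Even n)
    {c : (Fin n → ZMod k × Fin m) → ℤ}
    (hc : IsSphereCoeff n c) {c' : (Fin (n + 2) → ZMod k × Fin m) → ℤ}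
    (hc' : ∀ t, c' t = if (t 0).2 = Fin.ofNat m (n + 1) then
      ((if t 1 = ((t 0).1 + 1, Fin.ofNat m n) then 1 else 0) -
      (if t 1 = ((t 0).1, Fin.ofNat m n) then 1 else 0)) * c (Fin.tail (Fin.tail t)) else 0) :
    IsSphereCoeff (n + 2) c' := by
  have : Fact (1 < k) := ⟨hk⟩
  constructor
  · intro t ht
    rw [hc'] at ht
    by_cases ht0 : (t 0).2 = Fin.ofNat m (n + 1)
    swap
    · exact absurd (if_neg ht0) ht
    rw [if_pos ht0] at ht
    obtain ⟨s, hs, e⟩ := hc.1 _ (right_ne_zero_of_mul ht)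
    have h0 : t 1 = ((t 0).1 + 1, Fin.ofNat m n) ∨ t 1 = ((t 0).1, Fin.ofNat m n) := by
      by_contra! h
      rw [if_neg h.1, if_neg h.2] at ht
      simp at ht
    set s' := Function.update (Function.update s n (t 1).1) (n + 1) (t 0).1 with hs'
    have e1 : s' (n + 1) = (t 0).1 := Function.update_self ..
    have e2 : s' n = (t 1).1 := by
      rw [hs', Function.update_of_ne (by omega), Function.update_self]
    have e3 : ∀ i < n, s' i = s i := fun i hi => by
      rw [hs', Function.update_of_ne (by omega), Function.update_of_ne (by omega)]
    refine ⟨s', ⟨fun i hi hin => ?_, fun i hi hin => ?_⟩, ?_⟩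
    · by_cases hin' : i = n
      · subst hin'
        rw [e1, e2]
        rcases h0 with h | h <;> simp [h]
      · have h1 : i + 1 ≠ n := by
          rintro rfl
          exact (Nat.even_add_one.1 hn) hi
        rw [e3 _ (by omega), e3 _ (by omega)]
        exact hs.1 i hi (by omega)
    · obtain rfl : i = n + 1 := by omega
      exact absurd hi (by rwa [Nat.even_add_one, not_not])
    · rw [levelTuple_succ, levelTuple_succ, levelTuple_congr e3, ← e, e1, e2]
      have h1 : ((t 1).1, Fin.ofNat m n) = Fin.tail t 0 := by
        rcases h0 with h | h <;> simp [Fin.tail, h]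
      have h2 : ((t 0).1, Fin.ofNat m (n + 1)) = t 0 := by rw [← ht0]
      rw [h1, h2, Fin.cons_self_tail, Fin.cons_self_tail]
  · intro s hs
    rw [hc', levelTuple_succ, levelTuple_succ]
    have h1 := hc.2 s ⟨fun i hi hin => hs.1 i hi (by omega), fun i hi hin => by
      subst hin
      exact absurd hi (Nat.even_add_one.1 hn)⟩
    have h2 := hs.1 n hn (by omega)
    have h3 : (Fin.cons (s (n + 1), Fin.ofNat m (n + 1)) (Fin.cons (s n, Fin.ofNat m n)
      (levelTuple m n s) : Fin (n + 1) → ZMod k × Fin m) : Fin (n + 2) → ZMod k × Fin m) 1 =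
      (s n, Fin.ofNat m n) := rfl
    simp only [Fin.cons_zero, Fin.tail_cons, Prod.mk.injEq, and_true, h3, if_true]
    rcases h2 with h | h <;> simpa [h, or_comm, neg_eq_iff_eq_neg] using h1

lemma isSphereCoeff_one : IsSphereCoeff (k := k) (m := m) 0 (fun _ => 1) :=
  ⟨fun t _ => ⟨fun _ => 0, ⟨fun c _ h => by omega, fun c _ h => by omega⟩, Subsingleton.elim _ _⟩,
    fun _ _ => Or.inl rfl⟩

-- The cone has the apex sign `0`, so exactly one translate in the sum `σ` can contain `t`: the one
-- by the sign of `t 0`.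
open Classical in
lemma sphereOf_even_apply {r : ℕ} (hr : Even r) (t : Fin (r + 2) → ZMod k × Fin m) :
    sphereOf (r + 1) (joinChain k m (r + 1)) t = if (t 0).2 = Fin.ofNat m (r + 1) then
      sphereOf r (joinChain k m r) (shiftTuple (-(t 0).1) (Fin.tail t)) else 0 := by
  have h : ¬ Even (r + 1) := by rwa [Nat.even_add_one, not_not]
  rw [sphereOf, if_neg h, sigmaChain_eq_sum, Finsupp.finsetSum_apply]
  simp only [shiftChain_apply, joinChain, coneChain_apply]
  rw [Finset.sum_eq_single (t 0).1]
  · simp only [shiftTuple, Prod.mk.injEq, neg_add_cancel, true_and]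
    rfl
  · intro g _ hg
    rw [if_neg]
    simp only [shiftTuple, Prod.mk.injEq, not_and]
    intro h
    exact absurd (neg_add_eq_zero.1 h) hg
  · simp

-- The base of the cone is a `σ`-multiple and hence invariant, so `τ` acts only on the apex.
open Classical in
lemma sphereOf_odd_apply {r : ℕ} (hr : ¬ Even r) (t : Fin (r + 2) → ZMod k × Fin m) :
    sphereOf (r + 1) (joinChain k m (r + 1)) t =
      ((if t 0 = (1, Fin.ofNat m (r + 1)) then 1 else 0) -
      (if t 0 = (0, Fin.ofNat m (r + 1)) then 1 else 0)) *
      sphereOf r (joinChain k m r) (Fin.tail t) := by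
  have h : Even (r + 1) := by rwa [Nat.even_add_one]
  have hinv : ∀ g : ZMod k, ∀ t, sphereOf r (joinChain k m r) (shiftTuple (-g) t) =
      sphereOf r (joinChain k m r) t := by
    intro g t
    rw [← shiftChain_apply, sphereOf, if_neg hr, shiftChain_sigmaChain]
  rw [sphereOf, if_pos h, tauChain]
  simp only [LinearMap.sub_apply, LinearMap.id_apply, Finsupp.sub_apply, shiftChain_apply, joinChain,
    coneChain_apply]
  have e1 : (shiftTuple (-1) t 0 = (0, Fin.ofNat m (r + 1))) ↔ t 0 = (1, Fin.ofNat m (r + 1)) := by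
    simp only [shiftTuple, neg_add_eq_zero, Prod.ext_iff, eq_comm (a := (1 : ZMod k))]
  have e2 : Fin.tail (shiftTuple (-1) t) = shiftTuple (-1) (Fin.tail t) := rfl
  rw [e2, hinv]
  simp only [e1]
  split_ifs <;> simp

lemma isSphereCoeff_sphereOf (hk : 2 ≤ k) (r : ℕ) :
    IsSphereCoeff (r + 1) (sphereOf r (joinChain k m r)) := by
  have h0 : ∀ t : Fin 1 → ZMod k × Fin m, sphereOf 0 (joinChain k m 0) t =
      (if t 0 = (1, Fin.ofNat m 0) then 1 else 0) - (if t 0 = (0, Fin.ofNat m 0) then 1 else 0) := by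
    intro t
    have e : ∀ a : ZMod k × Fin m, ((fun _ : Fin 1 => a) = t) ↔ t 0 = a := by
      intro a
      constructor
      · rintro rfl; rfl
      · intro h
        funext i
        rw [Subsingleton.elim i 0, h]
    have h2 : shiftTuple (1 : ZMod k) (fun _ : Fin 1 => ((0 : ZMod k), Fin.ofNat m 0)) =
      fun _ => (1, Fin.ofNat m 0) := by ext i <;> simp [shiftTuple]
    simp only [sphereOf, Even.zero, if_true, tauChain, joinChain, LinearMap.sub_apply,
      LinearMap.id_apply, shiftChain, Finsupp.lmapDomain_apply, Finsupp.mapDomain_single, h2,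
      Finsupp.sub_apply, Finsupp.single_apply, e]
  -- Odd dimensions are handled two copies at a time, starting from the empty sphere; even
  -- dimensions follow by one suspension.
  have hodd : ∀ p, IsSphereCoeff (2 * p + 2) (sphereOf (2 * p + 1) (joinChain k m (2 * p + 1))) := by
    intro p
    induction p with
    | zero =>
      refine isSphereCoeff_one.join_cycle hk Even.zero fun t => ?_
      refine (sphereOf_even_apply Even.zero t).trans (if_congr Iff.rfl ?_ rfl)
      have h1 : ∀ a b g : ZMod k, (-g + a = b) ↔ a = g + b := fun a b g => neg_add_eq_iff_eq_add
      rw [h0, mul_one]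
      simp only [shiftTuple, h1, Fin.tail, Prod.ext_iff, add_zero]
      rfl
    | succ p ih =>
      refine ih.join_cycle hk ⟨p + 1, by ring⟩ fun t => ?_
      have he : Even (2 * p + 1 + 1) := ⟨p + 1, by ring⟩
      have ho : ¬ Even (2 * p + 1) := by simp
      have := sphereOf_even_apply he t
      refine this.trans (if_congr Iff.rfl ?_ rfl)
      rw [sphereOf_odd_apply ho]
      have h1 : ∀ a b g : ZMod k, (-g + a = b) ↔ a = g + b := fun a b g => neg_add_eq_iff_eq_add
      have h3 : ∀ (g : ZMod k) t, sphereOf (2 * p + 1) (joinChain k m (2 * p + 1))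
          (shiftTuple (-g) t) = sphereOf (2 * p + 1) (joinChain k m (2 * p + 1)) t := by
        intro g t
        rw [← shiftChain_apply, sphereOf, if_neg ho, shiftChain_sigmaChain]
      have e2 : Fin.tail (shiftTuple (-(t 0).1) (Fin.tail t)) =
        shiftTuple (-(t 0).1) (Fin.tail (Fin.tail t)) := rfl
      rw [e2, h3]
      simp only [shiftTuple, h1, Fin.tail, Prod.ext_iff, add_zero]
      rfl
  rcases Nat.even_or_odd' r with ⟨p, rfl | rfl⟩
  · cases p with
    | zero =>
      exact isSphereCoeff_one.suspension hk Even.zero fun t => by rw [mul_one]; exact h0 t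
    | succ p =>
      exact (hodd p).suspension hk ⟨p + 1, by ring⟩ fun t => sphereOf_odd_apply (by simp) t
  · exact hodd p

end JoinChains

/-! ### The subcomplex and its orientation chain -/

section Sphere

set_option linter.unusedSectionVars false

/-- Distinct vertices of a simplex are linearly independent, and their coordinates outside `t`
vanish, so the square matrix loses nothing. -/
lemma coordMatrix_det_ne_zero {ι : Type*} [Fintype ι] {X : SimplicialComplex ℝ (ι → ℝ)}
    (hX : VerticesInStd X) {n : ℕ} {t : Fin n → ι} {v : Fin n → ι → ℝ} (hv : IsTupleIn X v t)
    (hinj : Function.Injective v) : (coordMatrix v t).det ≠ 0 := by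
  have hli := hX.linearIndependent_tuple hv.1 hinj
  have hli' : LinearIndependent ℝ (coordMatrix v t).row := by
    rw [Fintype.linearIndependent_iff] at hli ⊢
    intro g hg
    refine hli g (eq_of_eq_on_range (t := t) (fun i hi => ?_) _ (fun _ _ => rfl) fun b => ?_)
    · simp [hv.2 _ i hi]
    · have := congrFun hg b
      simpa [Matrix.row, coordMatrix] using this
  rw [Matrix.linearIndependent_rows_iff_isUnit, Matrix.isUnit_iff_isUnit_det] at hli'
  exact hli'.ne_zero

lemma isTupleIn_of_subdiv_ne_zero {ι : Type*} [Fintype ι] {X : SimplicialComplex ℝ (ι → ℝ)} {r : ℕ}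
    {t : Fin (r + 1) → ι} {v : Fin (r + 1) → ι → ℝ} (h : subdiv X t v ≠ 0) :
    IsTupleIn X v t ∧ (coordMatrix v t).det ≠ 0 := by
  have h1 : IsTupleIn X v t := by
    by_contra h1
    exact h (if_neg h1)
  refine ⟨h1, fun h2 => h ?_⟩
  rw [subdiv, if_pos h1, h2]
  simp

variable {k m : ℕ} [NeZero k] [NeZero m] {X : SimplicialComplex ℝ (Space k m)}

/-- Copy indices are reduced modulo `m`. The bound `n ≤ m` keeps them from wrapping around, so that
the tuples are genuine simplices of the join. -/
lemma levelTuple_snd_injective {n : ℕ} (hn : n ≤ m) (s : ℕ → ZMod k) :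
    Function.Injective fun j => (levelTuple m n s j).2 := by
  intro i j h
  have h1 : ((Fin.ofNat m (n - 1 - i) : Fin m) : ℕ) = (Fin.ofNat m (n - 1 - j) : Fin m) :=
    congrArg Fin.val h
  have hi := i.2
  have hj := j.2
  simp only [Fin.ofNat] at h1
  rw [Nat.mod_eq_of_lt (by omega), Nat.mod_eq_of_lt (by omega)] at h1
  ext
  omega

/-- A full dimensional simplex of the subdivision lies in only one simplex of the join. -/
lemma levelTuple_unique {n : ℕ} (hn : n ≤ m) {s s' : ℕ → ZMod k} {v : Fin n → Space k m}
    (hdet : (coordMatrix v (levelTuple m n s)).det ≠ 0) (h' : IsTupleIn X v (levelTuple m n s')) :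
    levelTuple m n s = levelTuple m n s' := by
  funext b
  -- No column of an invertible matrix is zero. Each vertex of the first simplex thus occurs in the
  -- support of some `v a`, hence in the second simplex, at the position fixed by its copy.
  obtain ⟨a, ha⟩ : ∃ a, v a (levelTuple m n s b) ≠ 0 := by
    by_contra! h
    exact hdet (Matrix.det_eq_zero_of_column_eq_zero b h)
  obtain ⟨b', hb'⟩ : levelTuple m n s b ∈ Set.range (levelTuple m n s') := by
    by_contra h
    exact ha (h'.2 a _ h)
  have h2 : (levelTuple m n s' b').2 = (levelTuple m n s' b).2 :=
    (congrArg (Prod.snd : ZMod k × Fin m → Fin m) hb').trans rfl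
  have : b' = b := levelTuple_snd_injective hn s' h2
  rw [← hb', this]

/-- The apex of the last cone has sign `0`. This normalization of the top sign distinguishes the
translates of the chain. -/
lemma exists_levelTuple_of_joinChain_ne_zero (hk : 2 ≤ k) {r : ℕ}
    {t : Fin (r + 1) → ZMod k × Fin m}
    (h : joinChain k m r t ≠ 0) : ∃ s, s r = 0 ∧ t = levelTuple m (r + 1) s := by
  classical
  cases r with
  | zero =>
    refine ⟨fun _ => 0, rfl, ?_⟩
    rw [joinChain, Finsupp.single_apply] at h
    by_contra hne
    refine h (if_neg fun e => hne ?_)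
    rw [← e]
    funext i
    simp [levelTuple]
  | succ r =>
    rw [joinChain, coneChain_apply] at h
    have h0 : t 0 = (0, Fin.ofNat m (r + 1)) := by
      by_contra h0
      exact h (if_neg h0)
    rw [if_pos h0] at h
    obtain ⟨s, -, hs⟩ := (isSphereCoeff_sphereOf hk r).1 _ h
    refine ⟨Function.update s (r + 1) 0, by simp, ?_⟩
    rw [levelTuple_succ, levelTuple_congr (s' := s) fun i hi => Function.update_of_ne hi.ne _ _, ← hs,
      Function.update_self, ← h0, Fin.cons_self_tail]

lemma exists_levelTuple_of_sphereOf_ne_zero (hk : 2 ≤ k) {r : ℕ}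
    {t : Fin (r + 1) → ZMod k × Fin m} (h : sphereOf r (joinChain k m r) t ≠ 0) :
    ∃ s, GoodSigns (r + 1) s ∧ t = levelTuple m (r + 1) s :=
  (isSphereCoeff_sphereOf hk r).1 t h

lemma exists_of_subdivHom_ne_zero {ι : Type*} [Fintype ι] {X : SimplicialComplex ℝ (ι → ℝ)} {r : ℕ}
    {c : (Fin (r + 1) → ι) →₀ ℤ} {v : Fin (r + 1) → ι → ℝ} (h : subdivHom X r c v ≠ 0) :
    ∃ t, c t ≠ 0 ∧ subdiv X t v ≠ 0 := by
  rw [subdivHom_apply, Finset.sum_apply] at h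
  obtain ⟨t, ht, hne⟩ := Finset.exists_ne_zero_of_sum_ne_zero h
  exact ⟨t, Finsupp.mem_support_iff.1 ht, right_ne_zero_of_mul hne⟩

/-- The standard generalized sphere in the chain complex of a subdivision of the join. -/
def subdivChain (X : SimplicialComplex ℝ (Space k m)) (r : ℕ) : (Fin (r + 1) → Space k m) → ℤ :=
  subdivHom X r (joinChain k m r)

lemma sphereOf_subdivChain (hinv : IsInvariant X) (r : ℕ) :
    (if Even r then tauMul (subdivChain X r) else sigmaMul (subdivChain X r)) =
      subdivHom X r (sphereOf r (joinChain k m r)) := by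
  rw [subdivChain, sphereOf, tauMul_subdivHom hinv, sigmaMul_subdivHom hinv]
  split_ifs <;> rfl

lemma isGeneralizedSphere_subdivChain (hk : 2 ≤ k) (hsub : IsSubdivision X (joinComplex k m))
    (hinv : IsInvariant X) {n : ℕ} (hn : n < m) : IsGeneralizedSphere X n (subdivChain X) := by
  refine ⟨fun i _ => isChain_subdivHom hsub.finite_faces _, fun i hi => ?_⟩
  have h1 : (if Even (i + 1) then sigmaMul (subdivChain X i) else tauMul (subdivChain X i)) =
      if Even i then tauMul (subdivChain X i) else sigmaMul (subdivChain X i) := by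
    by_cases h : Even i <;> simp [h, Nat.even_add_one]
  rw [h1, sphereOf_subdivChain hinv, subdivChain,
    bdry_subdivHom hsub.verticesInStd hsub.finite_faces, orderedBdry_joinChain]
  intro t ht
  obtain ⟨s, -, rfl⟩ := exists_levelTuple_of_joinChain_ne_zero hk (Finsupp.mem_support_iff.1 ht)
  have hinj := levelTuple_snd_injective (m := m) (n := i + 1 + 1) (by omega) s
  exact ⟨fun a b h => hinj (congrArg Prod.snd h), hsub.coversFace_range hinj⟩

/-- A common simplex would lie in join simplices with top signs `0` and `g`; being full dimensional,
it lies in only one. -/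
lemma translate_subdivChain_disjoint (hk : 2 ≤ k) (hinv : IsInvariant X) {n : ℕ} (hn : n < m)
    {v : Fin (n + 1) → Space k m} (hv : subdivChain X n v ≠ 0) {g : ZMod k} (hg : g ≠ 0) :
    translate g (subdivChain X n) v = 0 := by
  by_contra h
  rw [subdivChain, translate_subdivHom hinv] at h
  obtain ⟨t, ht, htv⟩ := exists_of_subdivHom_ne_zero hv
  obtain ⟨t', ht', htv'⟩ := exists_of_subdivHom_ne_zero h
  rw [shiftChain_apply] at ht'
  obtain ⟨s, hs, rfl⟩ := exists_levelTuple_of_joinChain_ne_zero hk ht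
  obtain ⟨s', hs', e⟩ := exists_levelTuple_of_joinChain_ne_zero hk ht'
  have e' : t' = levelTuple m (n + 1) fun i => g + s' i := by
    have := congrArg (shiftTuple g) e
    rw [shiftTuple_add, add_neg_cancel, shiftTuple_zero] at this
    rw [this]
    rfl
  rw [e'] at htv'
  have := levelTuple_unique hn (isTupleIn_of_subdiv_ne_zero htv).2
    (isTupleIn_of_subdiv_ne_zero htv').1
  have h0 := congrArg Prod.fst (congrFun this 0)
  change s n = g + s' n at h0
  rw [hs, hs', add_zero] at h0
  exact hg h0.symm

/-- The subcomplex of `X` that subdivides the sphere in the join described by `GoodSigns`. -/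
def sphereComplex (X : SimplicialComplex ℝ (Space k m)) : SimplicialComplex ℝ (Space k m) where
  faces := {s | s ∈ X.faces ∧ ∃ σ : ℕ → ZMod k, GoodSigns m σ ∧
    ∀ v ∈ s, v ∈ stdFace (Set.range (levelTuple m m σ))}
  isRelLowerSet_faces := fun _ hs => ⟨X.nonempty_of_mem_faces hs.1, fun _ hts ht =>
    ⟨X.down_closed hs.1 hts ht, hs.2.imp fun _ h => ⟨h.1, fun v hv => h.2 v (hts hv)⟩⟩⟩
  indep := fun hs => X.indep hs.1
  inter_subset_convexHull := fun hs ht => X.inter_subset_convexHull hs.1 ht.1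

lemma sphereComplex_le : sphereComplex X ≤ X := fun _ hs => hs.1

/-- The simplices of `X` that cover a simplex of the sphere lie inside it, so they belong to the
subcomplex. -/
lemma sphereComplex_space (hsub : IsSubdivision X (joinComplex k m)) :
    (sphereComplex X).space = {x | ∃ σ : ℕ → ZMod k, GoodSigns m σ ∧
      x ∈ stdFace (Set.range (levelTuple m m σ))} := by
  ext x
  rw [SimplicialComplex.mem_space_iff]
  constructor
  · rintro ⟨s, ⟨hs, σ, hσ, hsσ⟩, hx⟩
    exact ⟨σ, hσ, convexHull_min hsσ (convex_stdFace _) hx⟩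
  · rintro ⟨σ, hσ, hx⟩
    obtain ⟨n, rfl⟩ : ∃ n, m = n + 1 := ⟨m - 1, by have := NeZero.pos m; omega⟩
    obtain ⟨F, -, hFX, hF⟩ := hsub.coversFace_range (levelTuple_snd_injective le_rfl σ)
    have hx' := hx
    rw [hF] at hx'
    obtain ⟨s, hs, hxs⟩ := Set.mem_iUnion₂.1 hx'
    refine ⟨s, ⟨hFX hs, σ, hσ, fun v hv => ?_⟩, hxs⟩
    rw [hF]
    exact Set.mem_biUnion hs (subset_convexHull ℝ _ hv)

/-- A top simplex of the subcomplex lies in a unique simplex of the join, so its coefficient is a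
single product: the coefficient `±1` of that simplex times the sign of a nonzero determinant. -/
lemma isOrientationChain_sphereOf {d : ℕ} {X : SimplicialComplex ℝ (Space k (d + 2))} (hk : 2 ≤ k)
    (hsub : IsSubdivision X (joinComplex k (d + 2))) :
    IsOrientationChain (sphereComplex X) d
      (subdivHom X (d + 1) (sphereOf (d + 1) (joinChain k (d + 2) (d + 1)))) := by
  have hch := isChain_subdivHom hsub.finite_faces (sphereOf (d + 1) (joinChain k (d + 2) (d + 1)))
  have hX := hsub.verticesInStd
  refine ⟨⟨hch.alternating, fun v hv => ?_, hch.finite⟩, fun v hinj hv => ?_, ?_⟩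
  · obtain ⟨hinj, s, hs, hsv⟩ := hch.supported v hv
    refine ⟨hinj, s, ⟨hs, ?_⟩, hsv⟩
    obtain ⟨t, ht, htv⟩ := exists_of_subdivHom_ne_zero hv
    obtain ⟨σ, hσ, rfl⟩ := exists_levelTuple_of_sphereOf_ne_zero hk ht
    refine ⟨σ, hσ, fun u hu => ⟨hX s hs u hu, ?_⟩⟩
    rw [← Finset.mem_coe, hsv] at hu
    obtain ⟨a, rfl⟩ := hu
    exact (isTupleIn_of_subdiv_ne_zero htv).1.2 a
  · obtain ⟨s, ⟨hs, σ, hσ, hsσ⟩, hsv⟩ := hv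
    have hin : IsTupleIn X v (levelTuple (d + 2) (d + 2) σ) := ⟨⟨s, hs, hsv⟩, fun a =>
      (hsσ (v a) (by rw [← Finset.mem_coe, hsv]; exact ⟨a, rfl⟩)).2⟩
    have hdet := coordMatrix_det_ne_zero hX hin hinj
    have hone : ∀ t, subdiv X t v ≠ 0 → sphereOf (d + 1) (joinChain k (d + 2) (d + 1)) t ≠ 0 →
        t = levelTuple (d + 2) (d + 2) σ := by
      intro t ht hc
      obtain ⟨σ', -, rfl⟩ := exists_levelTuple_of_sphereOf_ne_zero hk hc
      exact (levelTuple_unique le_rfl hdet (isTupleIn_of_subdiv_ne_zero ht).1).symm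
    have hc := (isSphereCoeff_sphereOf (m := d + 2) hk (d + 1)).2 σ hσ
    have hsd : subdiv X (levelTuple (d + 2) (d + 2) σ) v = 1 ∨
        subdiv X (levelTuple (d + 2) (d + 2) σ) v = -1 := by
      rw [subdiv, if_pos hin]
      rcases lt_or_gt_of_ne hdet with h | h
      · right; simp [sign_neg h]
      · left; simp [sign_pos h]
    have hval : subdivHom X (d + 1) (sphereOf (d + 1) (joinChain k (d + 2) (d + 1))) v =
        sphereOf (d + 1) (joinChain k (d + 2) (d + 1)) (levelTuple (d + 2) (d + 2) σ) *
          subdiv X (levelTuple (d + 2) (d + 2) σ) v := by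
      rw [subdivHom_apply, Finset.sum_apply]
      refine Finset.sum_eq_single _ (fun t ht hne => ?_) fun h => ?_
      · by_contra h
        exact hne (hone t (right_ne_zero_of_mul h) (Finsupp.mem_support_iff.1 ht))
      · rw [Finsupp.notMem_support_iff.1 h]
        simp
    rw [hval]
    rcases hc with h | h <;> rcases hsd with h' | h' <;> rw [h, h'] <;> simp
  · rw [bdry_subdivHom hX hsub.finite_faces, orderedBdry_sphereOf_joinChain, map_zero]
    intro t ht
    obtain ⟨σ, -, rfl⟩ := exists_levelTuple_of_sphereOf_ne_zero hk (Finsupp.mem_support_iff.1 ht)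
    have hinj := levelTuple_snd_injective (m := d + 2) le_rfl σ
    exact ⟨fun a b h => hinj (congrArg Prod.snd h), hsub.coversFace_range hinj⟩

end Sphere

/-! ### The carry cocycle and the chain map to the minimal resolution -/

section Resolution

set_option linter.unusedSectionVars false

variable {k : ℕ} [NeZero k]

/-- The two-cocycle that detects `α + β ≥ k`. -/
def jump (a b c : ZMod k) : ℤ := if k ≤ (b - a).val + (c - b).val then 1 else 0

/-- `jump` is the carry in the addition of the two steps, as representatives in `[0, k)`. -/
lemma val_add_val_eq (a b c : ZMod k) :
    (((b - a).val + (c - b).val : ℕ) : ℤ) = (c - a).val + k * jump a b c := by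
  have h : c - a = (b - a) + (c - b) := by abel
  unfold jump
  split_ifs with hk
  · rw [h, ZMod.val_add_val_of_le hk]
    push_cast; ring
  · rw [h, ZMod.val_add_of_lt (not_le.1 hk)]
    push_cast; ring

/-- By `val_add_val_eq`, `k` times `jump` is the coboundary of the integer cochain `(b - a).val`.
Hence `k` times the coboundary of `jump` vanishes, and `k` can be cancelled in `ℤ`. -/
lemma jump_cocycle (a b c d : ZMod k) :
    jump b c d - jump a c d + jump a b d - jump a b c = 0 := by
  have h1 := val_add_val_eq b c d
  have h2 := val_add_val_eq a c d
  have h3 := val_add_val_eq a b d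
  have h4 := val_add_val_eq a b c
  have hk : (k : ℤ) ≠ 0 := by exact_mod_cast NeZero.ne k
  push_cast at h1 h2 h3 h4
  have : (k : ℤ) * (jump b c d - jump a c d + jump a b d - jump a b c) = 0 := by linarith
  exact (mul_eq_zero.1 this).resolve_left hk

/-- Omitting the `i`-th entry of a sequence. -/
def skip {α : Type*} (i : ℕ) (h : ℕ → α) : ℕ → α := fun j => h (if j < i then j else j + 1)

/-- The product of `jump` over `p` consecutive pairs of steps, the `p`-fold cup power of `jump`. -/
def jumps : ℕ → (ℕ → ZMod k) → ℤ
  | 0, _ => 1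
  | p + 1, h => jump (h 0) (h 1) (h 2) * jumps p fun j => h (j + 2)

lemma jumps_congr {p : ℕ} {h h' : ℕ → ZMod k} (e : ∀ j ≤ 2 * p, h j = h' j) :
    jumps p h = jumps p h' := by
  induction p generalizing h h' with
  | zero => rfl
  | succ p ih =>
    rw [jumps, jumps, e 0 (by omega), e 1 (by omega), e 2 (by omega),
      ih fun j hj => e (j + 2) (by omega)]

lemma jumps_eq_ite (p : ℕ) (h : ℕ → ZMod k)
    [Decidable (∀ i < p, k ≤ (h (2 * i + 1) - h (2 * i)).val + (h (2 * i + 2) - h (2 * i + 1)).val)] :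
    jumps p h = if ∀ i < p,
      k ≤ (h (2 * i + 1) - h (2 * i)).val + (h (2 * i + 2) - h (2 * i + 1)).val then 1 else 0 := by
  classical
  induction p generalizing h with
  | zero => simp [jumps]
  | succ p ih =>
    rw [jumps, ih, jump, ite_zero_mul_ite_zero, mul_one]
    refine if_congr ?_ rfl rfl
    constructor
    · rintro ⟨h0, h1⟩ i hi
      cases i with
      | zero => exact h0
      | succ i => exact h1 i (by omega)
    · intro hi
      exact ⟨hi 0 (by omega), fun i hip => hi (i + 1) (by omega)⟩

lemma skip_zero {α : Type*} (h : ℕ → α) : skip 0 h = fun j => h (j + 1) := by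
  ext j; simp [skip]

lemma skip_succ_zero {α : Type*} (i : ℕ) (h : ℕ → α) : skip (i + 1) h 0 = h 0 := by
  simp [skip]

lemma skip_succ_succ {α : Type*} (i : ℕ) (h : ℕ → α) (j : ℕ) :
    skip (i + 1) h (j + 1) = skip i (fun j => h (j + 1)) j := by
  simp only [skip, Nat.add_lt_add_iff_right]
  split_ifs <;> rfl

/-- The Leibniz rule for the cup product. By induction, the faces with index at least `3` sum to
`-jump (h 0) (h 1) (h 2)` times the value of `jumps` on the tail from `h 3`. The first three faces
carry the same tail factor and complete the cocycle relation of `jump`. -/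
lemma jumps_cocycle (p : ℕ) (h : ℕ → ZMod k) :
    ∑ i ∈ Finset.range (2 * p + 2), (-1 : ℤ) ^ i * jumps p (skip i h) = 0 := by
  induction p generalizing h with
  | zero => simp [jumps, Finset.sum_range_succ]
  | succ p ih =>
    have h3 : ∀ i, jumps (p + 1) (skip (i + 3) h) =
        jump (h 0) (h 1) (h 2) * jumps p (skip (i + 1) fun j => h (j + 2)) := by
      intro i
      rw [jumps]
      have e : (fun j => skip (i + 3) h (j + 2)) = skip (i + 1) fun j => h (j + 2) := by
        funext j
        exact (skip_succ_succ _ _ _).trans (skip_succ_succ _ _ _)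
      rw [e]
      rfl
    have h0 : jumps (p + 1) (skip 0 h) = jump (h 1) (h 2) (h 3) * jumps p fun j => h (j + 3) := by
      rw [skip_zero]; rfl
    have h1 : jumps (p + 1) (skip 1 h) = jump (h 0) (h 2) (h 3) * jumps p fun j => h (j + 3) := by
      rfl
    have h2 : jumps (p + 1) (skip 2 h) = jump (h 0) (h 1) (h 3) * jumps p fun j => h (j + 3) := by
      rfl
    have ih' := ih fun j => h (j + 2)
    rw [Finset.sum_range_succ', skip_zero] at ih'
    rw [show 2 * (p + 1) + 2 = 2 * p + 1 + 1 + 1 + 1 by ring, Finset.sum_range_succ',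
      Finset.sum_range_succ', Finset.sum_range_succ']
    simp only [zero_add, Nat.reduceAdd, add_assoc]
    rw [h0, h1, h2]
    simp only [h3]
    have h4 : ∑ i ∈ Finset.range (2 * p + 1), (-1 : ℤ) ^ (i + 3) *
        (jump (h 0) (h 1) (h 2) * jumps p (skip (i + 1) fun j => h (j + 2))) =
        jump (h 0) (h 1) (h 2) * ∑ i ∈ Finset.range (2 * p + 1), (-1 : ℤ) ^ (i + 1) *
        jumps p (skip (i + 1) fun j => h (j + 2)) := by
      rw [Finset.mul_sum]
      refine Finset.sum_congr rfl fun i _ => ?_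
      ring
    rw [h4]
    have h5 : (∑ i ∈ Finset.range (2 * p + 1), (-1 : ℤ) ^ (i + 1) *
        jumps p (skip (i + 1) fun j => h (j + 2))) = - jumps p fun j => h (j + 3) := by
      rw [pow_zero, one_mul] at ih'
      exact eq_neg_of_add_eq_zero_left ih'
    rw [h5]
    have := jump_cocycle (h 0) (h 1) (h 2) (h 3)
    linear_combination (jumps p fun j => h (j + 3)) * this

/-- The group ring of `ZMod k`. -/
abbrev GroupRing (k : ℕ) : Type := AddMonoidAlgebra ℤ (ZMod k)

/-- The element `τ = g - e` of the group ring. -/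
def tauElt (k : ℕ) : GroupRing k := AddMonoidAlgebra.single 1 1 - 1

/-- The element of the group ring corresponding to `g : ZMod k`. -/
def groupElt {k : ℕ} (g : ZMod k) : GroupRing k := AddMonoidAlgebra.single g 1

lemma groupElt_mul (g h : ZMod k) : groupElt g * groupElt h = groupElt (g + h) := by
  simp [groupElt, AddMonoidAlgebra.single_mul_single]

lemma groupElt_zero : groupElt (0 : ZMod k) = 1 := rfl

lemma sigmaElt_add (a b : ℕ) :
    sigmaElt k (a + b) = sigmaElt k a + groupElt (a : ZMod k) * sigmaElt k b := by
  rw [sigmaElt, Finset.sum_range_add, sigmaElt, sigmaElt, Finset.mul_sum]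
  congr 1
  refine Finset.sum_congr rfl fun j _ => ?_
  change groupElt _ = groupElt _ * groupElt _
  rw [groupElt_mul]
  push_cast
  rfl

lemma tauElt_mul_sigmaElt (a : ℕ) : tauElt k * sigmaElt k a = groupElt (a : ZMod k) - 1 := by
  rw [sigmaElt, Finset.mul_sum]
  have : ∀ j ∈ Finset.range a, tauElt k * AddMonoidAlgebra.single (j : ZMod k) 1 =
      groupElt ((j + 1 : ℕ) : ZMod k) - groupElt (j : ZMod k) := by
    intro j _
    change (groupElt 1 - 1) * groupElt (j : ZMod k) = _
    rw [sub_mul, groupElt_mul, one_mul]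
    push_cast
    rw [add_comm]
  rw [Finset.sum_congr rfl this, Finset.sum_range_sub (fun j : ℕ => groupElt (j : ZMod k))]
  simp [groupElt_zero]

lemma sigmaElt_eq_sum : sigmaElt k k = ∑ g : ZMod k, groupElt g :=
  sum_range_natCast fun g => groupElt g

lemma groupElt_mul_sigmaElt (g : ZMod k) : groupElt g * sigmaElt k k = sigmaElt k k := by
  rw [sigmaElt_eq_sum, Finset.mul_sum]
  simp only [groupElt_mul]
  exact Fintype.sum_equiv (Equiv.addLeft g) _ _ fun _ => rfl

/-- The element `h₀ σ_a` with `h₀⁻¹ h₁ = g ^ a`. -/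
def arc (a b : ZMod k) : GroupRing k := groupElt a * sigmaElt k (b - a).val

lemma tauElt_mul_arc (a b : ZMod k) : tauElt k * arc a b = groupElt b - groupElt a := by
  rw [arc, mul_left_comm, tauElt_mul_sigmaElt, mul_sub, groupElt_mul, mul_one]
  simp

/-- Going from `a` to `b` and on to `c` covers the arc from `a` to `c`, plus one full turn `σ`
precisely when a carry occurs. -/
lemma arc_add_arc (a b c : ZMod k) :
    arc b c - arc a c + arc a b = jump a b c • sigmaElt k k := by
  have h : arc a b + arc b c = groupElt a * sigmaElt k ((b - a).val + (c - b).val) := by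
    rw [sigmaElt_add, arc, arc, mul_add, ← mul_assoc, groupElt_mul]
    simp
  have hs := val_add_val_eq a b c
  have h' : arc a b + arc b c = arc a c + jump a b c • sigmaElt k k := by
    rw [h]
    unfold jump at hs ⊢
    split_ifs at hs ⊢ with hk
    · have e : (b - a).val + (c - b).val = k + (c - a).val := by
        zify; push_cast at hs; linarith
      rw [e, sigmaElt_add, ZMod.natCast_self, groupElt_zero, one_mul, mul_add, groupElt_mul_sigmaElt,
        one_smul, arc, add_comm]
    · have e : (b - a).val + (c - b).val = (c - a).val := by
        zify; push_cast at hs; linarith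
      rw [e, zero_smul, add_zero, arc]
  rw [sub_add_eq_add_sub, add_comm, h']
  abel

/-- The chain map to the minimal resolution, in terms of sequences. -/
def sequenceValue (r : ℕ) (h : ℕ → ZMod k) : GroupRing k :=
  if Even r then jumps (r / 2) h • groupElt (h 0)
  else jumps (r / 2) (fun j => h (j + 1)) • arc (h 0) (h 1)

lemma sequenceValue_even (p : ℕ) (h : ℕ → ZMod k) :
    sequenceValue (2 * p) h = jumps p h • groupElt (h 0) := by
  rw [sequenceValue, if_pos (even_two_mul p), Nat.mul_div_cancel_left _ two_pos]

lemma sequenceValue_odd (p : ℕ) (h : ℕ → ZMod k) :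
    sequenceValue (2 * p + 1) h = jumps p (fun j => h (j + 1)) • arc (h 0) (h 1) := by
  rw [sequenceValue, if_neg (by simp), show (2 * p + 1) / 2 = p by omega]

lemma sequenceValue_congr {r : ℕ} {h h' : ℕ → ZMod k} (e : ∀ j ≤ r, h j = h' j) :
    sequenceValue r h = sequenceValue r h' := by
  rcases Nat.even_or_odd' r with ⟨p, rfl | rfl⟩
  · rw [sequenceValue_even, sequenceValue_even, jumps_congr e, e 0 (by omega)]
  · rw [sequenceValue_odd, sequenceValue_odd, jumps_congr fun j hj => e (j + 1) (by omega),
      e 0 (by omega), e 1 (by omega)]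

/-- `σ` in even degrees and `τ` in odd degrees, the boundary operator of the minimal resolution. -/
def minimalBdry (k r : ℕ) : GroupRing k := if Even r then sigmaElt k k else tauElt k

/-- The chain map property on one pattern. For even `r`, `τ` times an arc is the difference of its
endpoints: face `0` gives the term with `h 1`, and by the cocycle relation the other faces give the
term with `h 0`. For odd `r`, faces `0` and `1` give the arcs from `h 1` and from `h 0` to `h 2`,
while the cocycle relation on the tail turns all the others into the arc from `h 0` to `h 1`;
`arc_add_arc` combines the three into `σ`. -/
lemma sum_sequenceValue_skip (r : ℕ) (h : ℕ → ZMod k) :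
    ∑ i ∈ Finset.range (r + 2), (-1 : ℤ) ^ i • sequenceValue r (skip i h) =
      minimalBdry k (r + 1) * sequenceValue (r + 1) h := by
  rcases Nat.even_or_odd' r with ⟨p, rfl | rfl⟩
  · rw [minimalBdry, if_neg (by simp), sequenceValue_odd, mul_smul_comm, tauElt_mul_arc,
      Finset.sum_range_succ']
    have hc := jumps_cocycle p h
    rw [Finset.sum_range_succ', skip_zero, pow_zero, one_mul] at hc
    have h1 : ∀ i, sequenceValue (2 * p) (skip (i + 1) h) =
        jumps p (skip (i + 1) h) • groupElt (h 0) := by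
      intro i
      rw [sequenceValue_even, skip_succ_zero]
    simp only [h1, smul_smul]
    rw [← Finset.sum_smul, eq_neg_of_add_eq_zero_left hc, skip_zero, sequenceValue_even, pow_zero,
      one_smul, smul_sub]
    simp only [zero_add, neg_smul]
    abel
  · rw [minimalBdry, if_pos (by simp [Nat.even_add_one]),
      show 2 * p + 1 + 1 = 2 * (p + 1) by ring, sequenceValue_even, mul_smul_comm,
      mul_comm (sigmaElt k k), groupElt_mul_sigmaElt,
      show 2 * p + 1 + 2 = 2 * p + 1 + 1 + 1 by ring, Finset.sum_range_succ',
      Finset.sum_range_succ']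
    have hc := jumps_cocycle p fun j => h (j + 1)
    rw [Finset.sum_range_succ', skip_zero, pow_zero, one_mul] at hc
    have h2 : ∀ i, sequenceValue (2 * p + 1) (skip (i + 1 + 1) h) =
        jumps p (skip (i + 1) fun j => h (j + 1)) • arc (h 0) (h 1) := by
      intro i
      rw [sequenceValue_odd, skip_succ_zero, skip_succ_succ, skip_succ_zero]
      congr 2
      funext j
      exact skip_succ_succ _ _ _
    have h1 : sequenceValue (2 * p + 1) (skip (0 + 1) h) =
        jumps p (fun j => h (j + 2)) • arc (h 0) (h 2) := by
      rw [sequenceValue_odd]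
      rfl
    have h0 : sequenceValue (2 * p + 1) (skip 0 h) =
        jumps p (fun j => h (j + 2)) • arc (h 1) (h 2) := by
      rw [sequenceValue_odd, skip_zero]
    have h3 : ∀ i, (-1 : ℤ) ^ (i + 1 + 1) • sequenceValue (2 * p + 1) (skip (i + 1 + 1) h) =
        -(((-1 : ℤ) ^ (i + 1) * jumps p (skip (i + 1) fun j => h (j + 1))) • arc (h 0) (h 1)) := by
      intro i
      rw [h2, smul_smul, ← neg_smul]
      congr 1
      ring
    simp only [h3]
    rw [h0, h1, Finset.sum_neg_distrib, ← Finset.sum_smul, eq_neg_of_add_eq_zero_left hc, jumps,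
      mul_comm, mul_smul, ← arc_add_arc, smul_add, smul_sub]
    simp only [add_assoc, Nat.reduceAdd, zero_add, pow_one, pow_zero, neg_smul, one_smul]
    abel

/-- Extension of a tuple to a sequence. -/
def toSeq {α : Type*} {r : ℕ} (h : Fin (r + 1) → α) : ℕ → α := fun j => h (Fin.ofNat (r + 1) j)

lemma toSeq_of_lt {α : Type*} {r : ℕ} (h : Fin (r + 1) → α) {j : ℕ} (hj : j < r + 1) :
    toSeq h j = h ⟨j, hj⟩ := by
  rw [toSeq]
  congr 1
  ext
  simp [Nat.mod_eq_of_lt hj]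

lemma jumpsFrom_iff {r : ℕ} (a : ℕ) (h : Fin (r + 1) → ZMod k) :
    JumpsFrom a h ↔ ∀ i < (r - a) / 2, k ≤ (toSeq h (2 * i + 1 + a) - toSeq h (2 * i + a)).val +
      (toSeq h (2 * i + 2 + a) - toSeq h (2 * i + 1 + a)).val := by
  constructor
  · intro H i hi
    have := H i (by omega)
    rw [toSeq_of_lt h (j := 2 * i + 1 + a) (by omega), toSeq_of_lt h (j := 2 * i + a) (by omega),
      toSeq_of_lt h (j := 2 * i + 2 + a) (by omega)]
    convert this using 6 <;> omega
  · intro H i hi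
    have := H i (by omega)
    rw [toSeq_of_lt h (j := 2 * i + 1 + a) (by omega), toSeq_of_lt h (j := 2 * i + a) (by omega),
      toSeq_of_lt h (j := 2 * i + 2 + a) (by omega)] at this
    convert this using 6 <;> omega

/-- The condition `h 0 ≠ h 1` in odd degrees needs no separate treatment: if it fails, the arc from
`h 0` to `h 1` is an empty sum. -/
lemma patternValue_eq {r : ℕ} (h : Fin (r + 1) → ZMod k) :
    patternValue h = sequenceValue r (toSeq h) := by
  classical
  rw [patternValue, StronglyAlternating, sequenceValue]
  have e0 : toSeq h 0 = h 0 := rfl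
  have e1 : toSeq h 1 = h 1 := rfl
  split_ifs with hr hS hS
  · simp only [jumpsFrom_iff, Nat.sub_zero, add_zero] at hS
    rw [jumps_eq_ite, if_pos hS, one_smul, e0]
    rfl
  · simp only [jumpsFrom_iff, Nat.sub_zero, add_zero] at hS
    rw [jumps_eq_ite, if_neg hS, zero_smul]
  · have h2 := (jumpsFrom_iff _ _).1 hS.2
    rw [jumps_eq_ite, if_pos (by rw [show r / 2 = (r - 1) / 2 by grind]; exact h2), one_smul, e0, e1]
    rfl
  · rw [not_and_or, not_not] at hS
    rcases hS with hS | hS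
    · rw [e0, e1, hS, arc]
      simp [sigmaElt]
    · rw [jumpsFrom_iff] at hS
      rw [jumps_eq_ite, if_neg (by rw [show r / 2 = (r - 1) / 2 by grind]; exact hS), zero_smul]

lemma toSeq_comp_succAbove {α : Type*} {r : ℕ} (h : Fin (r + 2) → α) (i : Fin (r + 2)) (j : ℕ)
    (hj : j ≤ r) : toSeq (h ∘ i.succAbove) j = skip i (toSeq h) j := by
  rw [toSeq_of_lt _ (by omega), skip, Function.comp_apply, toSeq_of_lt _ (by split_ifs <;> omega)]
  congr 1
  ext
  simp only [Fin.succAbove, Fin.lt_def, Fin.val_castSucc]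
  split_ifs <;> simp

/-- The map to the minimal resolution is a chain map. -/
theorem toMinimal_orderedBdry (r : ℕ) (c : (Fin (r + 2) → ZMod k) →₀ ℤ) :
    toMinimal k r (orderedBdry _ r c) = minimalBdry k (r + 1) * toMinimal k (r + 1) c := by
  induction c using Finsupp.induction_linear with
  | zero => simp
  | add c d hc hd => simp only [map_add, hc, hd, mul_add]
  | single h n =>
    simp only [orderedBdry, toMinimal, Finsupp.linearCombination_single, map_smul, map_sum, one_smul,
      mul_smul_comm, patternValue_eq]
    rw [← sum_sequenceValue_skip, ← Fin.sum_univ_eq_sum_range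
      (fun i => (-1 : ℤ) ^ i • sequenceValue r (skip i (toSeq h)))]
    congr 1
    refine Finset.sum_congr rfl fun i _ => ?_
    rw [sequenceValue_congr (toSeq_comp_succAbove h i)]

/-- The action of `ZMod k` on formal sums of patterns. -/
def shiftPattern {n : ℕ} (g : ZMod k) :
    ((Fin n → ZMod k) →₀ ℤ) →ₗ[ℤ] ((Fin n → ZMod k) →₀ ℤ) :=
  Finsupp.lmapDomain ℤ ℤ fun h i => g + h i

lemma toMinimal_shiftPattern {r : ℕ} (g : ZMod k) (c : (Fin (r + 1) → ZMod k) →₀ ℤ) :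
    toMinimal k r (shiftPattern g c) = groupElt g * toMinimal k r c := by
  induction c using Finsupp.induction_linear with
  | zero => simp
  | add c d hc hd => simp only [map_add, hc, hd, mul_add]
  | single h n =>
    simp only [shiftPattern, toMinimal, Finsupp.linearCombination_single, Finsupp.lmapDomain_apply,
      Finsupp.mapDomain_single, mul_smul_comm]
    congr 1
    have hS : StronglyAlternating (fun i => g + h i) ↔ StronglyAlternating h := by
      simp only [StronglyAlternating, JumpsFrom, add_sub_add_left_eq_sub, ne_eq, add_right_inj]
    have e : ∀ a : ZMod k, groupElt g * AddMonoidAlgebra.single a (1 : ℤ) =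
      AddMonoidAlgebra.single (g + a) 1 := groupElt_mul g
    rw [patternValue, patternValue]
    by_cases h1 : StronglyAlternating h
    · rw [if_pos h1, if_pos (hS.2 h1)]
      split_ifs
      · rw [e]
      · rw [← mul_assoc, e, add_sub_add_left_eq_sub]
    · rw [if_neg h1, if_neg (mt hS.1 h1), mul_zero]

end Resolution

/-! ### The chain map given by a labelling -/

section Patterns

set_option linter.unusedSectionVars false

variable {k : ℕ} {E : Type*}

open Classical in
/-- The contribution of the ordered simplex `v` to `patterns l c`. -/
def patternTerm {r : ℕ} (l : E → ZMod k × ℕ) (c : (Fin (r + 1) → E) → ℤ) (v : Fin (r + 1) → E) :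
    (Fin (r + 1) → ZMod k) →₀ ℤ :=
  if StrictMono fun i => (l (v i)).2 then Finsupp.single (fun i => (l (v i)).1) (c v) else 0

lemma patterns_eq_finsum {r : ℕ} (l : E → ZMod k × ℕ) (c : (Fin (r + 1) → E) → ℤ) :
    patterns l c = ∑ᶠ v, patternTerm l c v := by
  classical
  rw [patterns]
  refine finsum_congr fun v => ?_
  rw [finsum_eq_if, patternTerm]

lemma support_patternTerm {r : ℕ} (l : E → ZMod k × ℕ) (c : (Fin (r + 1) → E) → ℤ) :
    Function.support (patternTerm l c) ⊆ Function.support c := by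
  intro v hv hc
  refine hv ?_
  rw [patternTerm, hc]
  simp

lemma patterns_eq_sum {r : ℕ} (l : E → ZMod k × ℕ) {c : (Fin (r + 1) → E) → ℤ}
    (S : Finset (Fin (r + 1) → E)) (hS : Function.support c ⊆ S) :
    patterns l c = ∑ v ∈ S, patternTerm l c v := by
  rw [patterns_eq_finsum, finsum_eq_sum_of_support_subset _ ((support_patternTerm l c).trans hS)]

lemma patterns_sub {r : ℕ} (l : E → ZMod k × ℕ) {c d : (Fin (r + 1) → E) → ℤ}
    (hc : (Function.support c).Finite) (hd : (Function.support d).Finite) :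
    patterns l (c - d) = patterns l c - patterns l d := by
  rw [patterns_eq_finsum, patterns_eq_finsum, patterns_eq_finsum, ← finsum_sub_distrib
    (hc.subset (support_patternTerm l c)) (hd.subset (support_patternTerm l d))]
  refine finsum_congr fun v => ?_
  simp only [patternTerm]
  split_ifs <;> simp

lemma patterns_sum {r : ℕ} (l : E → ZMod k × ℕ) {α : Type*} (s : Finset α)
    {c : α → (Fin (r + 1) → E) → ℤ} (hc : ∀ i ∈ s, (Function.support (c i)).Finite) :
    patterns l (∑ i ∈ s, c i) = ∑ i ∈ s, patterns l (c i) := by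
  simp only [patterns_eq_finsum]
  rw [← finsum_sum_comm _ _ fun i hi => (hc i hi).subset (support_patternTerm l (c i))]
  refine finsum_congr fun v => ?_
  simp only [patternTerm, Finset.sum_apply]
  split_ifs
  · rw [Finsupp.single_finsetSum]
  · simp

section Alternating

variable [AddCommGroup E] [Module ℝ E] {X : SimplicialComplex ℝ E}

lemma IsChain.cons_removeNth {r : ℕ} {c : (Fin (r + 2) → E) → ℤ} (hc : IsChain X (r + 1) c)
    (u : Fin (r + 2) → E) (j : Fin (r + 2)) :
    c (Fin.cons (u j) (u ∘ j.succAbove)) = (-1) ^ (j : ℕ) * c u := by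
  have h : (Fin.cons (u j) (u ∘ j.succAbove) : Fin (r + 2) → E) = u ∘ j.cycleRange.symm := by
    funext i
    refine Fin.cases ?_ (fun i => ?_) i
    · simp
    · simp
  rw [h, hc.alternating, Equiv.Perm.sign_symm, Fin.sign_cycleRange]
  simp

lemma IsChain.cons_swap {r : ℕ} {c : (Fin (r + 2) → E) → ℤ} (hc : IsChain X (r + 1) c)
    (v : E) (w : Fin (r + 1) → E) (i : Fin (r + 1)) :
    c (Fin.cons (w i) (Function.update w i v)) = - c (Fin.cons v w) := by
  have h : (Fin.cons (w i) (Function.update w i v) : Fin (r + 2) → E) =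
      (Fin.cons v w : Fin (r + 2) → E) ∘ Equiv.swap 0 i.succ := by
    funext j
    refine Fin.cases ?_ (fun j => ?_) j
    · simp
    · by_cases hj : j = i
      · subst hj; simp
      · have h1 : j.succ ≠ i.succ := by simpa using hj
        simp [Equiv.swap_apply_of_ne_of_ne (Fin.succ_ne_zero j) h1, hj]
  rw [h, hc.alternating, Equiv.Perm.sign_swap (Fin.succ_ne_zero i).symm]
  simp

open Classical in
/-- The faces of an ordered simplex with repeated colors contribute nothing in total. -/
lemma sum_repeated_color {l : E → ZMod k × ℕ} (hl : IsAdmissible X l) {r : ℕ}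
    {c : (Fin (r + 2) → E) → ℤ} (hc : IsChain X (r + 1) c) (V : Finset E) :
    ∑ p ∈ (V ×ˢ Fintype.piFinset fun _ : Fin (r + 1) => V) with
      ((StrictMono fun i => (l (p.2 i)).2) ∧ ∃ i, (l p.1).2 = (l (p.2 i)).2),
      Finsupp.single (fun i => (l (p.2 i)).1) (c (Fin.cons p.1 p.2)) = 0 := by
  have hcol : ∀ (v : E) (w : Fin (r + 1) → E) (i : Fin (r + 1)), (l v).2 = (l (w i)).2 →
      (fun j => (l (Function.update w i v j)).2) = fun j => (l (w j)).2 := by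
    intro v w i h
    funext j
    by_cases hj : j = i
    · subst hj; simpa using h
    · simp [hj]
  have hex : ∀ p : E × (Fin (r + 1) → E), ∃ i, (∃ i, (l p.1).2 = (l (p.2 i)).2) →
      (l p.1).2 = (l (p.2 i)).2 := by
    intro p
    by_cases h : ∃ i, (l p.1).2 = (l (p.2 i)).2
    · exact ⟨h.choose, fun _ => h.choose_spec⟩
    · exact ⟨0, fun h' => (h h').elim⟩
  choose idx hidx using hex
  refine Finset.sum_involution
    (fun p _ => (p.2 (idx p), Function.update p.2 (idx p) p.1)) ?_ ?_ ?_ ?_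
  · rintro ⟨v, w⟩ hp
    obtain ⟨-, hmono, hrep⟩ := Finset.mem_filter.1 hp
    have hi := hidx (v, w) hrep
    set i := idx (v, w)
    dsimp only at hi hmono ⊢
    rw [hc.cons_swap]
    by_cases h0 : c (Fin.cons v w) = 0
    · simp [h0]
    obtain ⟨-, s, hs, e⟩ := hc.supported _ h0
    have hv : v ∈ s := by rw [← Finset.mem_coe, e]; exact ⟨0, rfl⟩
    have hw : w i ∈ s := by rw [← Finset.mem_coe, e]; exact ⟨i.succ, rfl⟩
    -- Admissibility enters here: vertices of equal color have equal sign. Exchanging them keeps the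
    -- pattern and reverses the orientation, so the two terms cancel.
    have hsign : (l v).1 = (l (w i)).1 := (hl s hs v hv _ hw).resolve_left fun h => h hi
    have : (fun j => (l (Function.update w i v j)).1) = fun j => (l (w j)).1 := by
      funext j
      by_cases hj : j = i
      · subst hj; simpa using hsign
      · simp [hj]
    rw [this, ← Finsupp.single_add]
    simp
  · rintro ⟨v, w⟩ hp hne heq
    have h0 : c (Fin.cons v w) ≠ 0 := fun h => hne (by dsimp only; rw [h, Finsupp.single_zero])
    have hinj := (hc.supported _ h0).1
    have h1 : w (idx (v, w)) = v := congrArg Prod.fst heq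
    have h2 : (0 : Fin (r + 2)) = (idx (v, w)).succ := hinj (by simp [h1])
    exact (Fin.succ_ne_zero _) h2.symm
  · rintro ⟨v, w⟩ hp
    obtain ⟨hm, hmono, hrep⟩ := Finset.mem_filter.1 hp
    have hi := hidx (v, w) hrep
    rw [Finset.mem_product, Fintype.mem_piFinset] at hm
    rw [Finset.mem_filter, Finset.mem_product, Fintype.mem_piFinset]
    dsimp only at hi hmono hm ⊢
    refine ⟨⟨hm.2 _, fun j => ?_⟩, ?_, idx (v, w), ?_⟩
    · by_cases hj : j = idx (v, w)
      · subst hj; simpa using hm.1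
      · simpa [hj] using hm.2 j
    · rw [hcol v w _ hi]
      exact hmono
    · simpa using hi.symm
  · rintro ⟨v, w⟩ hp
    obtain ⟨hm, hmono, hrep⟩ := Finset.mem_filter.1 hp
    have hi := hidx (v, w) hrep
    dsimp only at hi hmono ⊢
    have hi' := hidx (w (idx (v, w)), Function.update w (idx (v, w)) v)
      ⟨idx (v, w), by simpa using hi.symm⟩
    set i := idx (v, w)
    set i' := idx (w i, Function.update w i v)
    -- The exchange does not alter the sorted colors, which are distinct; the repeated color
    -- therefore sits at the same index and the exchange is an involution.
    have : i' = i := by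
      apply hmono.injective
      have h1 := congrFun (hcol v w i hi) i'
      dsimp only at h1 hi' ⊢
      rw [← h1, ← hi']
    rw [this]
    simp

-- A facet `w` in color order together with a vertex `v` of a new color is the same as a simplex `u`
-- in color order with a marked position `j`. Moving the marked vertex to the front costs the sign
-- `(-1) ^ j`.
open Classical in
lemma sum_distinct_colors (l : E → ZMod k × ℕ) {r : ℕ}
    {c : (Fin (r + 2) → E) → ℤ} (hc : IsChain X (r + 1) c) (V : Finset E) :
    ∑ p ∈ (V ×ˢ Fintype.piFinset fun _ : Fin (r + 1) => V) with
      ((StrictMono fun i => (l (p.2 i)).2) ∧ ¬ ∃ i, (l p.1).2 = (l (p.2 i)).2),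
      Finsupp.single (fun i => (l (p.2 i)).1) (c (Fin.cons p.1 p.2)) =
    ∑ q ∈ ((Fintype.piFinset fun _ : Fin (r + 2) => V) ×ˢ (Finset.univ : Finset (Fin (r + 2)))) with
      (StrictMono fun i => (l (q.1 i)).2),
      Finsupp.single (fun i => (l (q.1 (q.2.succAbove i))).1) ((-1) ^ (q.2 : ℕ) * c q.1) := by
  symm
  refine Finset.sum_bij (fun q _ => (q.1 q.2, q.1 ∘ q.2.succAbove)) ?_ ?_ ?_ ?_
  · rintro ⟨u, j⟩ hq
    simp only [Finset.mem_filter, Finset.mem_product, Fintype.mem_piFinset, Finset.mem_univ,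
      and_true] at hq ⊢
    refine ⟨⟨hq.1 _, fun _ => hq.1 _⟩, hq.2.comp (Fin.strictMono_succAbove j), ?_⟩
    rintro ⟨i, hi⟩
    exact Fin.succAbove_ne j i (hq.2.injective hi).symm
  · rintro ⟨u, j⟩ hq ⟨u', j'⟩ hq' heq
    simp only [Finset.mem_filter, Finset.mem_product, Fintype.mem_piFinset, Finset.mem_univ,
      and_true] at hq hq'
    have h1 : u j = u' j' := congrArg Prod.fst heq
    have h2 : u ∘ j.succAbove = u' ∘ j'.succAbove := congrArg Prod.snd heq
    have hrange : ∀ (u : Fin (r + 2) → E) j, Set.range (fun i => (l (u i)).2) =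
        insert (l (u j)).2 (Set.range fun i => (l ((u ∘ j.succAbove) i)).2) := by
      intro u j
      ext x
      simp only [Set.mem_range, Set.mem_insert_iff, Fin.exists_iff_succAbove j, Function.comp_apply,
        eq_comm (b := x)]
    have h3 : (fun i => (l (u i)).2) = fun i => (l (u' i)).2 := by
      rw [← StrictMono.range_inj hq.2 hq'.2, hrange u j, hrange u' j', h1, h2]
    have h4 : j = j' := by
      apply hq.2.injective
      exact (congrArg (fun x => (l x).2) h1).trans (congrFun h3 j').symm
    subst h4
    have : u = u' := by
      funext i
      rcases eq_or_ne i j with rfl | hne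
      · exact h1
      · obtain ⟨b, rfl⟩ := Fin.exists_succAbove_eq hne
        exact congrFun h2 b
    rw [this]
  · rintro ⟨v, w⟩ hp
    simp only [Finset.mem_filter, Finset.mem_product, Fintype.mem_piFinset] at hp
    obtain ⟨⟨hv, hw⟩, hmono, hne⟩ := hp
    set u₀ : Fin (r + 2) → E := Fin.cons v w with hu₀
    set π := Tuple.sort fun i => (l (u₀ i)).2
    have hinj : Function.Injective fun i => (l (u₀ i)).2 := by
      intro a b
      refine Fin.cases ?_ (fun a => ?_) a <;> refine Fin.cases ?_ (fun b => ?_) b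
      · simp
      · intro h
        exact (hne ⟨b, by simpa [hu₀] using h⟩).elim
      · intro h
        exact (hne ⟨a, by simpa [hu₀] using h.symm⟩).elim
      · intro h
        rw [hmono.injective (by simpa [hu₀] using h : (l (w a)).2 = (l (w b)).2)]
    have hsm : StrictMono fun i => (l (u₀ (π i))).2 :=
      (Tuple.monotone_sort fun i => (l (u₀ i)).2).strictMono_of_injective (hinj.comp π.injective)
    have hsub : ∀ a, ∃ b, u₀ (π ((π.symm 0).succAbove a)) = w b := by
      intro a
      have : π ((π.symm 0).succAbove a) ≠ 0 := by
        intro h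
        rw [← Equiv.eq_symm_apply] at h
        exact Fin.succAbove_ne _ _ h
      obtain ⟨b, hb⟩ := Fin.exists_succ_eq.2 this
      exact ⟨b, by rw [← hb]; simp [hu₀]⟩
    have hsub' : ∀ b, ∃ a, u₀ (π ((π.symm 0).succAbove a)) = w b := by
      intro b
      have : π.symm b.succ ≠ π.symm 0 := by simp
      obtain ⟨a, ha⟩ := Fin.exists_succAbove_eq this
      exact ⟨a, by rw [ha]; simp [hu₀]⟩
    have hcol : (fun a => (l (u₀ (π ((π.symm 0).succAbove a)))).2) = fun a => (l (w a)).2 := by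
      refine (StrictMono.range_inj (hsm.comp (Fin.strictMono_succAbove _)) hmono).1 ?_
      ext x
      constructor
      · rintro ⟨a, rfl⟩
        obtain ⟨b, hb⟩ := hsub a
        exact ⟨b, by simp only [Function.comp_apply]; rw [hb]⟩
      · rintro ⟨b, rfl⟩
        obtain ⟨a, ha⟩ := hsub' b
        exact ⟨a, by simp only [Function.comp_apply]; rw [ha]⟩
    refine ⟨(u₀ ∘ π, π.symm 0), ?_, ?_⟩
    · simp only [Finset.mem_filter, Finset.mem_product, Fintype.mem_piFinset, Finset.mem_univ,
        and_true]
      refine ⟨fun a => ?_, hsm⟩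
      have : ∀ b, u₀ b ∈ V := fun b => by
        refine Fin.cases ?_ (fun b => ?_) b <;> simp [hu₀, hv, hw]
      exact this _
    · refine Prod.ext ?_ ?_
      · simp [hu₀]
      · funext a
        obtain ⟨b, hb⟩ := hsub a
        have : (l (u₀ (π ((π.symm 0).succAbove a)))).2 = (l (w a)).2 := congrFun hcol a
        rw [hb] at this
        rw [hmono.injective this] at hb
        exact hb
  · rintro ⟨u, j⟩ hq
    rw [hc.cons_removeNth]
    rfl

/-- The coefficients of the boundary are sums over an added vertex `v`. Terms in which `v` repeats a
color of the facet cancel in pairs; the others are, after sorting, the faces of the patterns. -/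
theorem patterns_bdry {l : E → ZMod k × ℕ} (hl : IsAdmissible X l) {r : ℕ}
    {c : (Fin (r + 2) → E) → ℤ} (hc : IsChain X (r + 1) c) :
    patterns l (bdry c) = orderedBdry (ZMod k) r (patterns l c) := by
  classical
  set V : Finset E := hc.finite.toFinset.biUnion fun u => Finset.univ.image u with hV
  have hmem : ∀ u, c u ≠ 0 → ∀ i, u i ∈ V := by
    intro u hu i
    rw [hV, Finset.mem_biUnion]
    exact ⟨u, hc.finite.mem_toFinset.2 hu, Finset.mem_image_of_mem u (Finset.mem_univ i)⟩
  have hb : ∀ w, bdry c w = ∑ v ∈ V, c (Fin.cons v w) := by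
    intro w
    refine finsum_eq_sum_of_support_subset _ fun v hv => ?_
    exact hmem _ hv 0
  rw [patterns_eq_sum l (c := bdry c) (Fintype.piFinset fun _ : Fin (r + 1) => V),
    patterns_eq_sum l (c := c) (Fintype.piFinset fun _ : Fin (r + 2) => V)]
  rotate_left
  · intro u hu
    exact Fintype.mem_piFinset.2 (hmem u hu)
  · intro w hw
    rw [Function.mem_support, hb] at hw
    obtain ⟨v, -, hv⟩ := Finset.exists_ne_zero_of_sum_ne_zero hw
    exact Fintype.mem_piFinset.2 fun i => hmem _ hv i.succ
  have h1 : ∑ w ∈ Fintype.piFinset (fun _ : Fin (r + 1) => V), patternTerm l (bdry c) w =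
      ∑ p ∈ (V ×ˢ Fintype.piFinset fun _ : Fin (r + 1) => V) with
        (StrictMono fun i => (l (p.2 i)).2),
        Finsupp.single (fun i => (l (p.2 i)).1) (c (Fin.cons p.1 p.2)) := by
    rw [Finset.sum_filter, Finset.sum_product_right]
    refine Finset.sum_congr rfl fun w _ => ?_
    rw [patternTerm, hb]
    split_ifs
    · rw [Finsupp.single_finsetSum]
    · simp
  have h2 : orderedBdry (ZMod k) r
      (∑ u ∈ Fintype.piFinset (fun _ : Fin (r + 2) => V), patternTerm l c u) =
      ∑ q ∈ ((Fintype.piFinset fun _ : Fin (r + 2) => V) ×ˢ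
        (Finset.univ : Finset (Fin (r + 2)))) with (StrictMono fun i => (l (q.1 i)).2),
        Finsupp.single (fun i => (l (q.1 (q.2.succAbove i))).1) ((-1) ^ (q.2 : ℕ) * c q.1) := by
    rw [map_sum, Finset.sum_filter, Finset.sum_product]
    refine Finset.sum_congr rfl fun u _ => ?_
    rw [patternTerm]
    split_ifs
    · rw [orderedBdry, Finsupp.linearCombination_single, Finset.smul_sum]
      refine Finset.sum_congr rfl fun j _ => ?_
      rw [smul_smul, Finsupp.smul_single, smul_eq_mul, mul_one, mul_comm]
      rfl
    · simp
  rw [h1, h2, ← sum_distinct_colors l hc V]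
  rw [← Finset.sum_filter_add_sum_filter_not _ fun p => ∃ i, (l p.1).2 = (l (p.2 i)).2,
    Finset.filter_filter, Finset.filter_filter, sum_repeated_color hl hc V, zero_add]

end Alternating

section Equivariance

variable {m : ℕ} [NeZero k] {X : SimplicialComplex ℝ (Space k m)}

lemma patterns_translate {l : Space k m → ZMod k × ℕ} (hl : IsEquivariantLabelling X l) {r : ℕ}
    {c : (Fin (r + 1) → Space k m) → ℤ} (hc : IsChain X r c) (g : ZMod k) :
    patterns l (translate g c) = shiftPattern g (patterns l c) := by
  classical
  have hfin : (Function.support (patternTerm l c)).Finite := hc.finite.subset (support_patternTerm l c)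
  rw [patterns_eq_finsum, patterns_eq_finsum, ← LinearMap.toAddMonoidHom_coe,
    AddMonoidHom.map_finsum _ hfin]
  rw [← finsum_comp_equiv (Equiv.piCongrRight fun _ : Fin (r + 1) =>
    (rot (k := k) (m := m) g).toEquiv)]
  refine finsum_congr fun v => ?_
  have hcv : translate g c (fun i => rot g (v i)) = c v := by
    refine congrArg c (funext fun i => ?_)
    rw [← rot_add, neg_add_cancel, rot_zero]
  change patternTerm l (translate g c) (fun i => rot g (v i)) = shiftPattern g (patternTerm l c v)
  rw [patternTerm, patternTerm, hcv]
  by_cases h0 : c v = 0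
  · simp [h0]
  obtain ⟨-, s, hs, e⟩ := hc.supported v h0
  have hlv : ∀ i, l (rot g (v i)) = (g + (l (v i)).1, (l (v i)).2) := by
    intro i
    refine hl g (v i) (X.down_closed hs ?_ (Finset.singleton_nonempty _))
    rw [Finset.singleton_subset_iff, ← Finset.mem_coe, e]
    exact ⟨i, rfl⟩
  simp only [hlv]
  split_ifs
  · rw [shiftPattern, Finsupp.lmapDomain_apply, Finsupp.mapDomain_single]
  · simp

end Equivariance

end Patterns

/-! ### The count modulo `k` -/

section Count

variable {k m : ℕ} [NeZero k] {X : SimplicialComplex ℝ (Space k m)}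

lemma coeff_sigmaElt_mul (y : GroupRing k) : (sigmaElt k k * y).coeff 0 = ∑ g, y.coeff g := by
  rw [sigmaElt_eq_sum, Finset.sum_mul, AddMonoidAlgebra.coeff_sum, Finsupp.finsetSum_apply]
  simp only [groupElt, AddMonoidAlgebra.coeff_single_mul_apply, one_mul, add_zero]
  exact Fintype.sum_equiv (Equiv.neg _) _ _ fun _ => rfl

/-- For `σ` the two sides are equal. For `τ`, a difference annihilated by `g - e` is invariant under
translation, so its coefficients are constant and their sum is a multiple of `k`. -/
lemma sum_coeff_modEq_of_minimalBdry_mul_eq {r : ℕ} {y z : GroupRing k}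
    (h : minimalBdry k r * y = minimalBdry k r * z) :
    (sigmaElt k k * y).coeff 0 ≡ (sigmaElt k k * z).coeff 0 [ZMOD k] := by
  rw [minimalBdry] at h
  split_ifs at h
  · rw [h]
  · have h0 : tauElt k * (y - z) = 0 := by rw [mul_sub, h, sub_self]
    have h1 : ∀ g : ZMod k, (y - z).coeff (g + 1) = (y - z).coeff g := by
      intro g
      have := congrArg (fun x : GroupRing k => x.coeff (g + 1)) h0
      simp only [tauElt, sub_mul, one_mul, AddMonoidAlgebra.coeff_sub, Finsupp.sub_apply,
        AddMonoidAlgebra.coeff_single_mul_apply, AddMonoidAlgebra.coeff_zero,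
        Finsupp.zero_apply] at this
      rw [show -1 + (g + 1) = g by ring] at this
      rw [AddMonoidAlgebra.coeff_sub, Finsupp.sub_apply, Finsupp.sub_apply]
      linarith
    have h2 : ∀ n : ℕ, (y - z).coeff (n : ZMod k) = (y - z).coeff 0 := by
      intro n
      induction n with
      | zero => simp
      | succ n ih => rw [Nat.cast_succ, h1, ih]
    have h3 : ∀ g : ZMod k, (y - z).coeff g = (y - z).coeff 0 := fun g => by
      rw [← h2 g.val, ZMod.natCast_zmod_val]
    refine (Int.modEq_iff_dvd.2 ⟨(y - z).coeff 0, ?_⟩).symm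
    rw [← Finsupp.sub_apply, ← AddMonoidAlgebra.coeff_sub, ← mul_sub, coeff_sigmaElt_mul,
      Finset.sum_congr rfl fun g _ => h3 g]
    simp [ZMod.card, mul_sub]

lemma IsChain.translate (hinv : IsInvariant X) {r : ℕ} {c : (Fin (r + 1) → Space k m) → ℤ}
    (hc : IsChain X r c) (g : ZMod k) : IsChain X r (translate g c) where
  alternating π v := hc.alternating π fun i => rot (-g) (v i)
  supported v hv := by
    obtain ⟨h1, h2⟩ := hc.supported _ hv
    exact ⟨fun a b h => h1 (by simp only [h]), (hinv.isFaceTuple_rot_iff (-g)).1 h2⟩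
  finite := by
    refine hc.finite.preimage (f := fun (v : Fin (r + 1) → Space k m) i => rot (-g) (v i)) ?_
    intro v _ w _ h
    funext i
    exact (rot (-g)).injective (congrFun h i)

/-- Both chain maps carry the relation `∂ c' = σ c` or `∂ c' = τ c` to the group ring, where the
boundary of the minimal resolution is multiplication by the same element. -/
lemma toMinimal_patterns_step (hinv : IsInvariant X) {l : Space k m → ZMod k × ℕ}
    (hl : IsAdmissible X l) (hle : IsEquivariantLabelling X l) {r : ℕ}
    {c : (Fin (r + 1) → Space k m) → ℤ} {c' : (Fin (r + 2) → Space k m) → ℤ}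
    (hc : IsChain X r c) (hc' : IsChain X (r + 1) c')
    (h : bdry c' = if Even (r + 1) then sigmaMul c else tauMul c) :
    minimalBdry k (r + 1) * toMinimal k (r + 1) (patterns l c') =
      minimalBdry k (r + 1) * toMinimal k r (patterns l c) := by
  rw [← toMinimal_orderedBdry, ← patterns_bdry hl hc', h, minimalBdry]
  have hg : ∀ g, toMinimal k r (patterns l (translate g c)) =
      groupElt g * toMinimal k r (patterns l c) := fun g => by
    rw [patterns_translate hle hc, toMinimal_shiftPattern]
  split_ifs
  · rw [sigmaMul, patterns_sum l _ fun j _ => (hc.translate hinv _).finite, map_sum, sigmaElt,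
      Finset.sum_mul]
    exact Finset.sum_congr rfl fun j _ => hg _
  · rw [tauMul, patterns_sub l (hc.translate hinv _).finite hc.finite, map_sub, hg, tauElt, sub_mul,
      one_mul]
    rfl

/-- The number of strongly alternating simplices of a generalized sphere is modulo `k` the number
of its points. -/
theorem IsGeneralizedSphere.alpha_modEq (hinv : IsInvariant X) {l : Space k m → ZMod k × ℕ}
    (hl : IsAdmissible X l) (hle : IsEquivariantLabelling X l) {n : ℕ}
    {x : (i : ℕ) → (Fin (i + 1) → Space k m) → ℤ} (hx : IsGeneralizedSphere X n x) :
    alpha l (x n) ≡ alpha l (x 0) [ZMOD k] := by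
  have h : ∀ i ≤ n, alpha l (x i) ≡ alpha l (x 0) [ZMOD k] := by
    intro i
    induction i with
    | zero => exact fun _ => rfl
    | succ i ih =>
      intro hi
      refine Int.ModEq.trans ?_ (ih (by omega))
      exact sum_coeff_modEq_of_minimalBdry_mul_eq (toMinimal_patterns_step hinv hl hle
        (hx.1 i (by omega)) (hx.1 (i + 1) hi) (hx.2 i (by omega)))
  exact h n le_rfl

/-- A vertex of the join cannot be subdivided further, so the starting chain is one vertex with
coefficient `1`, and patterns of length one are always strongly alternating. -/
lemma alpha_subdivChain_zero [NeZero m] (hsub : IsSubdivision X (joinComplex k m))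
    (l : Space k m → ZMod k × ℕ) : alpha l (subdivChain X 0) = 1 := by
  classical
  set p : ZMod k × Fin m := (0, Fin.ofNat m 0)
  set e : Space k m := Pi.single p 1 with he
  have hX := hsub.verticesInStd
  have hstd : ∀ x : Space k m, x ∈ stdFace {p} ↔ x = e := by
    intro x
    constructor
    · rintro ⟨⟨-, h1⟩, h2⟩
      ext i
      by_cases hi : i = p
      · rw [Finset.sum_eq_single p (fun j _ hj => h2 j hj) (by simp)] at h1
        rw [hi, h1, he, Pi.single_eq_same]
      · rw [h2 i hi, he, Pi.single_eq_of_ne hi]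
    · rintro rfl
      exact ⟨single_mem_stdSimplex ℝ p, fun i hi => Pi.single_eq_of_ne hi 1⟩
  have hvert : IsFaceTuple X (fun _ : Fin 1 => e) := by
    obtain ⟨F, -, hFX, hF⟩ := hsub.coversFace_range (t := fun _ : Fin 1 => p)
      fun a b _ => (Fin.subsingleton_one.elim a b :)
    rw [Set.range_const] at hF
    have hmem : e ∈ stdFace {p} := (hstd e).2 rfl
    rw [hF] at hmem
    obtain ⟨s, hs, hes⟩ := Set.mem_iUnion₂.1 hmem
    refine ⟨s, hFX hs, ?_⟩
    rw [Set.range_const]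
    have hall : ∀ v ∈ s, v = e := by
      intro v hv
      rw [← hstd, hF]
      exact Set.mem_biUnion hs (subset_convexHull ℝ _ hv)
    obtain ⟨v, hv⟩ := X.nonempty_of_mem_faces (hFX hs)
    ext u
    simp only [Finset.mem_coe, Set.mem_singleton_iff]
    exact ⟨hall u, fun h => by rw [h, ← hall v hv]; exact hv⟩
  have hsd : ∀ v, subdivChain X 0 v = if v = fun _ => e then 1 else 0 := by
    intro v
    have h1 : subdivChain X 0 v = subdiv X (fun _ : Fin 1 => p) v := by
      rw [subdivChain, joinChain, subdivHom, Finsupp.linearCombination_single, one_smul]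
    rw [h1, subdiv]
    have h2 : IsTupleIn X v (fun _ : Fin 1 => p) ↔ v = fun _ => e := by
      constructor
      · rintro ⟨h3, h4⟩
        funext a
        rw [← hstd]
        refine ⟨hX.tuple h3 a, fun i hi => h4 a i ?_⟩
        rwa [Set.range_const]
      · rintro rfl
        refine ⟨hvert, fun a i hi => ?_⟩
        rw [Set.range_const] at hi
        exact Pi.single_eq_of_ne hi 1
    by_cases hv : v = fun _ => e
    · rw [if_pos hv, if_pos (h2.2 hv), hv, Matrix.det_fin_one]
      simp [coordMatrix, he]
    · rw [if_neg hv, if_neg (mt h2.1 hv)]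
  have hpat : patterns l (subdivChain X 0) = Finsupp.single (fun _ => (l e).1) 1 := by
    rw [patterns_eq_sum l {fun _ => e}, Finset.sum_singleton, patternTerm, hsd, if_pos rfl, if_pos]
    · exact fun a b h => absurd h (Fin.subsingleton_one.elim a b ▸ lt_irrefl a)
    · intro v hv
      rw [Function.mem_support, hsd] at hv
      simpa using hv
  rw [alpha, hpat, coeff_sigmaElt_mul, toMinimal, Finsupp.linearCombination_single, one_smul,
    patternValue, if_pos, if_pos Even.zero]
  · simp [Finsupp.single_apply]
  · rw [StronglyAlternating, if_pos Even.zero]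
    intro i hi
    omega

end Count

/-! ### Coordinates on the regular `2k`-gon -/

section Planar

set_option linter.unusedSectionVars false

/-- The first coordinate of the `p`-th vertex of the regular `2 k`-gon. -/
def vertCos (k : ℕ) (p : ℤ) : ℝ := Real.cos (p * (Real.pi / k))

/-- The second coordinate of the `p`-th vertex of the regular `2 k`-gon. -/
def vertSin (k : ℕ) (p : ℤ) : ℝ := Real.sin (p * (Real.pi / k))

variable {k : ℕ} [NeZero k]

lemma angle_add (p t : ℤ) : ((p + 2 * k * t : ℤ) : ℝ) * (Real.pi / k) =
    p * (Real.pi / k) + t * (2 * Real.pi) := by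
  have : (k : ℝ) ≠ 0 := by exact_mod_cast NeZero.ne k
  push_cast
  field_simp

lemma vertCos_add (p t : ℤ) : vertCos k (p + 2 * k * t) = vertCos k p := by
  rw [vertCos, angle_add, Real.cos_add_int_mul_two_pi, vertCos]

lemma vertSin_add (p t : ℤ) : vertSin k (p + 2 * k * t) = vertSin k p := by
  rw [vertSin, angle_add, Real.sin_add_int_mul_two_pi, vertSin]

lemma exists_val_eq (n : ℤ) : ∃ t : ℤ, (((n : ZMod k).val : ℕ) : ℤ) = n + k * t := by
  refine ⟨-(n / k), ?_⟩
  rw [ZMod.val_intCast]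
  have := Int.emod_add_mul_ediv n k
  linarith

/-- Replacing `n` by its residue modulo `k` changes the angle by multiples of `2π`. -/
lemma vert_val (n j : ℤ) : vertCos k (2 * (n : ZMod k).val + j) = vertCos k (2 * n + j) ∧
    vertSin k (2 * (n : ZMod k).val + j) = vertSin k (2 * n + j) := by
  obtain ⟨t, ht⟩ := exists_val_eq (k := k) n
  have h : (2 * ((n : ZMod k).val : ℤ) + j) = 2 * n + j + 2 * k * t := by rw [ht]; ring
  rw [h, vertCos_add, vertSin_add]
  exact ⟨rfl, rfl⟩

lemma vertSin_nonneg {p : ℤ} (h0 : 0 ≤ p) (h1 : p ≤ k) : 0 ≤ vertSin k p := by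
  have hk : (0 : ℝ) < k := by exact_mod_cast NeZero.pos k
  have h0' : (0 : ℝ) ≤ p := by exact_mod_cast h0
  have h1' : (p : ℝ) ≤ k := by exact_mod_cast h1
  refine Real.sin_nonneg_of_nonneg_of_le_pi (by positivity) ?_
  calc (p : ℝ) * (Real.pi / k) ≤ k * (Real.pi / k) := by gcongr
    _ = Real.pi := by field_simp

lemma vertSin_neg (p : ℤ) : vertSin k (-p) = - vertSin k p := by
  rw [vertSin, vertSin, ← Real.sin_neg]
  push_cast
  ring_nf

lemma vertSin_add_k (p : ℤ) : vertSin k (p + k) = - vertSin k p := by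
  have hk : (k : ℝ) ≠ 0 := by exact_mod_cast NeZero.ne k
  rw [vertSin, vertSin, ← Real.sin_add_pi]
  push_cast
  congr 1
  field_simp

lemma vertSin_nonpos {p : ℤ} (h0 : k ≤ p) (h1 : p ≤ 2 * k) : vertSin k p ≤ 0 := by
  have h := vertSin_add_k (k := k) (p - k)
  rw [sub_add_cancel] at h
  rw [h]
  linarith [vertSin_nonneg (k := k) (p := p - k) (by linarith) (by linarith)]

lemma vertSin_one_pos (hk : 2 ≤ k) : 0 < vertSin k 1 := by
  have hk' : (2 : ℝ) ≤ k := by exact_mod_cast hk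
  refine Real.sin_pos_of_pos_of_lt_pi ?_ ?_
  · have := Real.pi_pos
    simp only [Int.cast_one, one_mul]
    positivity
  · rw [Int.cast_one, one_mul, div_lt_iff₀ (by linarith)]
    nlinarith [Real.pi_pos]

/-- The coefficient of the `j`-th vertex of the regular `2 k`-gon in the representation of `(X, Y)`
as a nonnegative combination of two adjacent vertices. -/
def vertexCoeff (k : ℕ) (j : ℤ) (X Y : ℝ) : ℝ :=
  max 0 (min (Y * vertCos k (j - 1) - X * vertSin k (j - 1))
    (X * vertSin k (j + 1) - Y * vertCos k (j + 1))) / vertSin k 1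

lemma vertSin_sub (p q : ℤ) :
    vertSin k (p - q) = vertSin k p * vertCos k q - vertCos k p * vertSin k q := by
  simp only [vertSin, vertCos]
  rw [← Real.sin_sub]
  push_cast
  ring_nf

/-- The two expressions in `vertexCoeff` are the determinants of `(X, Y)` with the neighbours of the
vertex `j`. Truncating their minimum at `0` gives the tent function that is `1` at this vertex,
vanishes at all others, and is linear on each sector. Coefficients on an edge can thus be read off
from the point. -/
lemma vertexCoeff_combination (hk : 2 ≤ k) (i j : ℤ) {α β : ℝ} (hα : 0 ≤ α) (hβ : 0 ≤ β) :
    vertexCoeff k j (α * vertCos k i + β * vertCos k (i + 1))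
      (α * vertSin k i + β * vertSin k (i + 1)) =
    (if (2 * k : ℤ) ∣ i - j then α else 0) + (if (2 * k : ℤ) ∣ i + 1 - j then β else 0) := by
  have hk' : (2 : ℤ) ≤ k := by exact_mod_cast hk
  have hs := vertSin_one_pos hk
  -- The representative of `i - j` in `[-1, 2k - 2]`: at `-1` and `0` the vertex `j` is an endpoint
  -- of the edge, and for larger `q` one of the two determinants is nonpositive.
  set q : ℤ := (i - j + 1) % (2 * k) - 1 with hq
  have hq0 : -1 ≤ q := by
    have := Int.emod_nonneg (i - j + 1) (b := 2 * k) (by linarith)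
    linarith
  have hq1 : q < 2 * k - 1 := by
    have := Int.emod_lt_of_pos (i - j + 1) (b := 2 * k) (by linarith)
    linarith
  set t : ℤ := (i - j + 1) / (2 * k) with ht
  have hi : i = j + q + 2 * k * t := by
    have := Int.emod_add_mul_ediv (i - j + 1) (2 * k)
    linarith
  have hA : (α * vertSin k i + β * vertSin k (i + 1)) * vertCos k (j - 1) -
      (α * vertCos k i + β * vertCos k (i + 1)) * vertSin k (j - 1) =
      α * vertSin k (q + 1) + β * vertSin k (q + 2) := by
    rw [← vertSin_add (q + 1) t, ← vertSin_add (q + 2) t,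
      show q + 1 + 2 * k * t = i - (j - 1) by rw [hi]; ring,
      show q + 2 + 2 * k * t = i + 1 - (j - 1) by rw [hi]; ring, vertSin_sub i, vertSin_sub (i + 1)]
    ring
  have hB : (α * vertCos k i + β * vertCos k (i + 1)) * vertSin k (j + 1) -
      (α * vertSin k i + β * vertSin k (i + 1)) * vertCos k (j + 1) =
      α * vertSin k (1 - q) + β * vertSin k (-q) := by
    rw [← vertSin_add (1 - q) (-t), ← vertSin_add (-q) (-t),
      show 1 - q + 2 * k * -t = (j + 1) - i by rw [hi]; ring,
      show -q + 2 * k * -t = (j + 1) - (i + 1) by rw [hi]; ring, vertSin_sub (j + 1) i,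
      vertSin_sub (j + 1) (i + 1)]
    ring
  have hd : ∀ n : ℤ, 0 < n → n < 2 * k → ∀ s, ¬ (2 * k : ℤ) ∣ n + 2 * k * s := by
    intro n h0 h1 s h
    rw [Int.dvd_add_left (Dvd.intro _ rfl)] at h
    linarith [Int.le_of_dvd h0 h]
  have hs0 : vertSin k 0 = 0 := by simp [vertSin]
  rw [vertexCoeff, hA, hB, show i - j = q + 2 * k * t by rw [hi]; ring,
    show i + 1 - j = q + 1 + 2 * k * t by rw [hi]; ring]
  have hs2 : 0 ≤ vertSin k 2 := vertSin_nonneg (by norm_num) hk'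
  rcases lt_trichotomy q 0 with h | h | h
  · have hq' : q = -1 := by omega
    rw [hq', if_neg, if_pos]
    · have e1 : vertSin k (-1 + 1) = 0 := by rw [neg_add_cancel]; exact hs0
      have e2 : vertSin k (-1 + 2) = vertSin k 1 := rfl
      have e3 : vertSin k (1 - -1) = vertSin k 2 := rfl
      have e4 : vertSin k (- -1) = vertSin k 1 := rfl
      rw [e1, e2, e3, e4, min_eq_left (by nlinarith [mul_nonneg hα hs2]), max_eq_right (by positivity)]
      field_simp
      ring
    · simp
    · have := hd (2 * k - 1) (by linarith) (by linarith) (t - 1)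
      rwa [show (2 * k - 1 + 2 * k * (t - 1) : ℤ) = -1 + 2 * k * t by ring] at this
  · rw [h, if_pos (by simp), if_neg (hd _ (by norm_num) (by linarith) t)]
    simp only [zero_add, sub_zero, neg_zero, hs0, mul_zero, add_zero]
    rw [min_eq_right (by nlinarith [mul_nonneg hβ hs2]), max_eq_right (by positivity)]
    field_simp
  · rw [if_neg (hd q h (by linarith) t), if_neg (hd (q + 1) (by linarith) (by linarith) t), add_zero]
    have hle : min (α * vertSin k (q + 1) + β * vertSin k (q + 2))
        (α * vertSin k (1 - q) + β * vertSin k (-q)) ≤ 0 := by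
      rcases le_total q k with hqk | hqk
      · refine min_le_of_right_le ?_
        have h1 := vertSin_nonneg (k := k) (p := q - 1) (by linarith) (by linarith)
        have h2 := vertSin_nonneg (k := k) (p := q) (by linarith) (by linarith)
        rw [show 1 - q = -(q - 1) by ring, vertSin_neg, vertSin_neg]
        nlinarith [mul_nonneg hα h1, mul_nonneg hβ h2]
      · refine min_le_of_left_le ?_
        have h1 := vertSin_nonpos (k := k) (p := q + 1) (by linarith) (by linarith)
        have h2 := vertSin_nonpos (k := k) (p := q + 2) (by linarith) (by linarith)
        nlinarith [mul_nonneg hα (neg_nonneg.2 h1), mul_nonneg hβ (neg_nonneg.2 h2)]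
    rw [max_eq_left hle, zero_div]

/-- The coordinates of a combination of the vertices of the regular `2 k`-gon, given by the
coefficients `x` of the even vertices and `y` of the odd ones. -/
def polyX (x y : ZMod k → ℝ) : ℝ :=
  ∑ a, (x a * vertCos k (2 * a.val + 0) + y a * vertCos k (2 * a.val + 1))

/-- The second coordinate of the point determined by a pair of weights; see `polyX`. -/
def polyY (x y : ZMod k → ℝ) : ℝ :=
  ∑ a, (x a * vertSin k (2 * a.val + 0) + y a * vertSin k (2 * a.val + 1))

/-- The coefficients `x` and `y` are supported on the edge of the regular `2 k`-gon between the even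
vertex `b` and the odd vertex `a`. -/
def IsEdgePair (a b : ZMod k) (x y : ZMod k → ℝ) : Prop :=
  (b = a ∨ b = a + 1) ∧ (∀ c, 0 ≤ x c) ∧ (∀ c, 0 ≤ y c) ∧ (∀ c, c ≠ b → x c = 0) ∧
    ∀ c, c ≠ a → y c = 0

lemma IsEdgePair.poly_eq {a b : ZMod k} {x y : ZMod k → ℝ} (h : IsEdgePair a b x y) :
    polyX x y = x b * vertCos k (2 * b.val + 0) + y a * vertCos k (2 * a.val + 1) ∧
    polyY x y = x b * vertSin k (2 * b.val + 0) + y a * vertSin k (2 * a.val + 1) := by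
  obtain ⟨-, -, -, hx, hy⟩ := h
  constructor
  · rw [polyX, Finset.sum_add_distrib, Finset.sum_eq_single b, Finset.sum_eq_single a] <;>
      simp +contextual [hx, hy]
  · rw [polyY, Finset.sum_add_distrib, Finset.sum_eq_single b, Finset.sum_eq_single a] <;>
      simp +contextual [hx, hy]

lemma two_mul_dvd_iff (a c : ZMod k) (n : ℤ) :
    (2 * k : ℤ) ∣ 2 * a.val + 2 * n - 2 * c.val ↔ c = a + n := by
  rw [show (2 * a.val + 2 * n - 2 * c.val : ℤ) = 2 * (a.val + n - c.val) by ring,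
    mul_dvd_mul_iff_left two_ne_zero, ← ZMod.intCast_zmod_eq_zero_iff_dvd]
  push_cast
  rw [ZMod.natCast_zmod_val, ZMod.natCast_zmod_val, sub_eq_zero, eq_comm]

lemma not_two_mul_dvd {n : ℤ} (hn : ¬ Even n) : ¬ (2 * k : ℤ) ∣ n := fun h =>
  hn ((even_iff_two_dvd).2 (dvd_of_mul_right_dvd h))

lemma IsEdgePair.vertexCoeff_poly (hk : 2 ≤ k) {a b : ZMod k} {x y : ZMod k → ℝ}
    (h : IsEdgePair a b x y) (c : ZMod k) :
    vertexCoeff k (2 * c.val) (polyX x y) (polyY x y) = x c ∧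
    vertexCoeff k (2 * c.val + 1) (polyX x y) (polyY x y) = y c := by
  rw [h.poly_eq.1, h.poly_eq.2]
  obtain ⟨hab, hx0, hy0, hx, hy⟩ := h
  have key0 := two_mul_dvd_iff a c 0
  have key1 := two_mul_dvd_iff a c 1
  simp only [mul_zero, add_zero, Int.cast_zero, Int.cast_one, mul_one] at key0 key1
  have hodd : ∀ n : ℤ, ¬ (2 * k : ℤ) ∣ 2 * n + 1 := fun n => not_two_mul_dvd (by simp)
  have hxc : ∀ c, (if c = b then x b else 0) = x c := by
    intro c
    split_ifs with e
    · rw [e]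
    · rw [hx c e]
  have hyc : ∀ c, (if c = a then y a else 0) = y c := by
    intro c
    split_ifs with e
    · rw [e]
    · rw [hy c e]
  rcases hab with rfl | rfl
  · simp only [add_zero]
    rw [vertexCoeff_combination hk _ _ (hx0 _) (hy0 _), vertexCoeff_combination hk _ _ (hx0 _) (hy0 _)]
    constructor
    · rw [if_neg (c := (2 * k : ℤ) ∣ 2 * b.val + 1 - 2 * c.val), add_zero, if_congr key0 rfl rfl, hxc]
      rw [show (2 * b.val + 1 - 2 * c.val : ℤ) = 2 * (b.val - c.val) + 1 by ring]
      exact hodd _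
    · rw [if_neg (c := (2 * k : ℤ) ∣ 2 * b.val - (2 * c.val + 1)), zero_add,
        show (2 * b.val + 1 - (2 * c.val + 1) : ℤ) = 2 * b.val - 2 * c.val by ring,
        if_congr key0 rfl rfl, hyc]
      rw [show (2 * b.val - (2 * c.val + 1) : ℤ) = 2 * (b.val - c.val - 1) + 1 by ring]
      exact hodd _
  -- For `b = a + 1` the integer representative of `b` may wrap to `0`; its polygon vertex may still
  -- be written with index `2 * (a.val + 1)`.
  · have hv := vert_val (k := k) (a.val + 1) 0
    push_cast at hv
    rw [ZMod.natCast_zmod_val] at hv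
    rw [hv.1, hv.2, show (2 * (a.val + 1) + 0 : ℤ) = 2 * a.val + 1 + 1 by ring, add_comm,
      add_comm (x (a + 1) * _)]
    rw [vertexCoeff_combination hk _ _ (hy0 _) (hx0 _), vertexCoeff_combination hk _ _ (hy0 _) (hx0 _)]
    constructor
    · rw [if_neg (c := (2 * k : ℤ) ∣ 2 * a.val + 1 - 2 * c.val), zero_add,
        show (2 * a.val + 1 + 1 - 2 * c.val : ℤ) = 2 * a.val + 2 - 2 * c.val by ring,
        if_congr key1 rfl rfl, hxc]
      rw [show (2 * a.val + 1 - 2 * c.val : ℤ) = 2 * (a.val - c.val) + 1 by ring]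
      exact hodd _
    · rw [if_neg (c := (2 * k : ℤ) ∣ 2 * a.val + 1 + 1 - (2 * c.val + 1)), add_zero,
        show (2 * a.val + 1 - (2 * c.val + 1) : ℤ) = 2 * a.val - 2 * c.val by ring,
        if_congr key0 rfl rfl, hyc]
      rw [show (2 * a.val + 1 + 1 - (2 * c.val + 1) : ℤ) = 2 * (a.val - c.val) + 1 by ring]
      exact hodd _

/-- Polar coordinates: the argument selects a sector of angle `π / k`, and the sine rule gives the
coefficients along its two boundary rays. -/
lemma exists_combination_eq (hk : 2 ≤ k) (X Y : ℝ) : ∃ (i : ℤ) (α β : ℝ), 0 ≤ α ∧ 0 ≤ β ∧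
    α * vertCos k i + β * vertCos k (i + 1) = X ∧ α * vertSin k i + β * vertSin k (i + 1) = Y := by
  have hs := vertSin_one_pos hk
  have hk0 : (0 : ℝ) < k := by exact_mod_cast NeZero.pos k
  have hk1 : (1 : ℝ) ≤ k := by exact_mod_cast NeZero.pos k
  set z : ℂ := ⟨X, Y⟩
  set θ : ℝ := Real.pi / k with hθ
  have hθ0 : 0 < θ := div_pos Real.pi_pos hk0
  have hθ1 : θ ≤ Real.pi := div_le_self Real.pi_pos.le hk1
  set i : ℤ := ⌊z.arg / θ⌋
  set δ : ℝ := z.arg - i * θ with hδ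
  have hδ0 : 0 ≤ δ := by
    have := (le_div_iff₀ hθ0).1 (Int.floor_le (z.arg / θ))
    simp only [hδ]; linarith
  have hδ1 : δ ≤ θ := by
    have := (div_lt_iff₀ hθ0).1 (Int.lt_floor_add_one (z.arg / θ))
    simp only [hδ]; linarith
  have hX : ‖z‖ * Real.cos (i * θ + δ) = X := by
    rw [hδ, add_sub_cancel]; exact Complex.norm_mul_cos_arg z
  have hY : ‖z‖ * Real.sin (i * θ + δ) = Y := by
    rw [hδ, add_sub_cancel]; exact Complex.norm_mul_sin_arg z
  have hs1 : vertSin k 1 = Real.sin θ := by simp [vertSin, hθ]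
  rw [hs1] at hs
  refine ⟨i, ‖z‖ * Real.sin (θ - δ) / Real.sin θ, ‖z‖ * Real.sin δ / Real.sin θ, ?_, ?_, ?_, ?_⟩
  · have := Real.sin_nonneg_of_nonneg_of_le_pi (x := θ - δ) (by linarith) (by linarith)
    positivity
  · have := Real.sin_nonneg_of_nonneg_of_le_pi hδ0 (by linarith)
    positivity
  · rw [← hX, vertCos, vertCos]
    push_cast
    rw [← hθ, add_mul, one_mul, Real.cos_add, Real.cos_add, Real.sin_sub]
    field_simp
    ring
  · rw [← hY, vertSin, vertSin]
    push_cast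
    rw [← hθ, add_mul, one_mul, Real.sin_add, Real.sin_add, Real.sin_sub]
    field_simp
    ring

lemma exists_isEdgePair (hk : 2 ≤ k) (X Y : ℝ) : ∃ (a b : ZMod k) (x y : ZMod k → ℝ),
    IsEdgePair a b x y ∧ polyX x y = X ∧ polyY x y = Y := by
  classical
  obtain ⟨i, α, β, hα, hβ, hX, hY⟩ := exists_combination_eq hk X Y
  have hpair : ∀ (a b : ZMod k) (u v : ℝ), 0 ≤ u → 0 ≤ v → (b = a ∨ b = a + 1) →
      IsEdgePair a b (Pi.single b u) (Pi.single a v) := by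
    intro a b u v hu hv hab
    refine ⟨hab, fun c => ?_, fun c => ?_, fun c hc => Pi.single_eq_of_ne hc _,
      fun c hc => Pi.single_eq_of_ne hc _⟩ <;>
    · rw [Pi.single_apply]; split_ifs <;> simp [hu, hv]
  rcases Int.even_or_odd' i with ⟨n, rfl | rfl⟩
  · have h := hpair n n α β hα hβ (Or.inl rfl)
    refine ⟨n, n, _, _, h, ?_, ?_⟩
    · rw [h.poly_eq.1, (vert_val n 0).1, (vert_val n 1).1, Pi.single_eq_same, Pi.single_eq_same,
        add_zero, hX]
    · rw [h.poly_eq.2, (vert_val n 0).2, (vert_val n 1).2, Pi.single_eq_same, Pi.single_eq_same,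
        add_zero, hY]
  · have h := hpair n ((n + 1 : ℤ) : ZMod k) β α hβ hα (Or.inr (by push_cast; rfl))
    refine ⟨n, ((n + 1 : ℤ) : ZMod k), _, _, h, ?_, ?_⟩
    · rw [h.poly_eq.1, (vert_val (n + 1) 0).1, (vert_val n 1).1, Pi.single_eq_same,
        Pi.single_eq_same, show 2 * (n + 1) + 0 = 2 * n + 1 + 1 by ring, add_comm, hX]
    · rw [h.poly_eq.2, (vert_val (n + 1) 0).2, (vert_val n 1).2, Pi.single_eq_same,
        Pi.single_eq_same, show 2 * (n + 1) + 0 = 2 * n + 1 + 1 by ring, add_comm, hY]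

end Planar

/-! ### From a linear bijection on a cone to a sphere -/

section Cones

variable {V W : Type*} [AddCommGroup V] [Module ℝ V] [TopologicalSpace V]
  [NormedAddCommGroup W] [NormedSpace ℝ W]

/-- If a continuous linear map is a bijection from a cone to a normed space, it identifies a compact
slice of the cone with the unit sphere. -/
theorem nonempty_homeomorph_sphere {C : Set V} {φ : V →ₗ[ℝ] ℝ} {L : V →ₗ[ℝ] W}
    (hL : Continuous L) (hzero : 0 ∈ C) (hsmul : ∀ x ∈ C, ∀ t : ℝ, 0 < t → t • x ∈ C)
    (hφ : ∀ x ∈ C, x ≠ 0 → 0 < φ x) (hinj : Set.InjOn L C) (hsurj : Set.SurjOn L C Set.univ)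
    (hcomp : IsCompact {x | x ∈ C ∧ φ x = 1}) :
    Nonempty ({x | x ∈ C ∧ φ x = 1} ≃ₜ Metric.sphere (0 : W) 1) := by
  have hne : ∀ x ∈ C, φ x = 1 → L x ≠ 0 := by
    intro x hx h1 h0
    have : x = 0 := hinj hx hzero (by rw [h0, map_zero])
    rw [this, map_zero] at h1
    exact zero_ne_one h1
  have : CompactSpace {x | x ∈ C ∧ φ x = 1} := isCompact_iff_compactSpace.1 hcomp
  -- Radial projection of the image. It is a continuous bijection from a compact space to a
  -- Hausdorff space; the functional `φ` recovers the scaling that the projection loses.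
  set f : {x | x ∈ C ∧ φ x = 1} → Metric.sphere (0 : W) 1 := fun x =>
    ⟨‖L x‖⁻¹ • L x, by
      have := hne x x.2.1 x.2.2
      rw [mem_sphere_zero_iff_norm, norm_smul, norm_inv, norm_norm,
        inv_mul_cancel₀ (norm_ne_zero_iff.2 this)]⟩ with hf
  have hcont : Continuous f := by
    refine Continuous.subtype_mk ?_ _
    have hc : Continuous fun x : {x | x ∈ C ∧ φ x = 1} => L x := hL.comp continuous_subtype_val
    exact (hc.norm.inv₀ fun x => norm_ne_zero_iff.2 (hne x x.2.1 x.2.2)).smul hc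
  have hbij : Function.Bijective f := by
    constructor
    · rintro ⟨x, hx, hx1⟩ ⟨y, hy, hy1⟩ h
      have h' : ‖L x‖⁻¹ • L x = ‖L y‖⁻¹ • L y := congrArg Subtype.val h
      have hnx := norm_pos_iff.2 (hne x hx hx1)
      have hny := norm_pos_iff.2 (hne y hy hy1)
      rw [← map_smul, ← map_smul] at h'
      have h2 := hinj (hsmul x hx _ (inv_pos.2 hnx)) (hsmul y hy _ (inv_pos.2 hny)) h'
      have h3 := congrArg φ h2
      rw [map_smul, map_smul, hx1, hy1, smul_eq_mul, smul_eq_mul, mul_one, mul_one] at h3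
      rw [h3] at h2
      exact Subtype.ext (smul_right_injective V (inv_pos.2 hny).ne' h2)
    · rintro ⟨y, hy⟩
      rw [mem_sphere_zero_iff_norm] at hy
      obtain ⟨x, hx, hxy⟩ := hsurj (Set.mem_univ y)
      have hx0 : x ≠ 0 := by
        rintro rfl
        rw [map_zero] at hxy
        rw [← hxy, norm_zero] at hy
        exact zero_ne_one hy
      have hpos := hφ x hx hx0
      refine ⟨⟨(φ x)⁻¹ • x, hsmul x hx _ (inv_pos.2 hpos), ?_⟩, ?_⟩
      · rw [map_smul, smul_eq_mul, inv_mul_cancel₀ hpos.ne']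
      · apply Subtype.ext
        simp only [hf]
        rw [map_smul, hxy, norm_smul, hy, mul_one, norm_inv, Real.norm_of_nonneg hpos.le, inv_inv,
          smul_smul, mul_inv_cancel₀ hpos.ne', one_smul]
  exact ⟨Continuous.homeoOfEquivCompactToT2 (f := Equiv.ofBijective f hbij) hcont⟩

end Cones

/-! ### The subcomplex is a sphere -/

section JoinSphere

set_option linter.unusedSectionVars false

variable {k m : ℕ} [NeZero k] [NeZero m]

/-- The cone over the sphere described by `GoodSigns`. -/
def joinCone (k m : ℕ) : Set (Space k m) :=
  {x | (∀ i, 0 ≤ x i) ∧ ∃ σ : ℕ → ZMod k, GoodSigns m σ ∧ ∀ i, i.1 ≠ σ i.2 → x i = 0}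

/-- The coordinates of `x` in the copy `c`. -/
def slice (x : Space k m) (c : ℕ) : ZMod k → ℝ := fun a => x (a, Fin.ofNat m c)

lemma polyX_add (x y x' y' : ZMod k → ℝ) : polyX (x + x') (y + y') = polyX x y + polyX x' y' := by
  simp only [polyX, ← Finset.sum_add_distrib, Pi.add_apply]
  exact Finset.sum_congr rfl fun _ _ => by ring

lemma polyY_add (x y x' y' : ZMod k → ℝ) : polyY (x + x') (y + y') = polyY x y + polyY x' y' := by
  simp only [polyY, ← Finset.sum_add_distrib, Pi.add_apply]
  exact Finset.sum_congr rfl fun _ _ => by ring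

lemma polyX_smul (t : ℝ) (x y : ZMod k → ℝ) : polyX (t • x) (t • y) = t * polyX x y := by
  simp only [polyX, Finset.mul_sum, Pi.smul_apply, smul_eq_mul]
  exact Finset.sum_congr rfl fun _ _ => by ring

lemma polyY_smul (t : ℝ) (x y : ZMod k → ℝ) : polyY (t • x) (t • y) = t * polyY x y := by
  simp only [polyY, Finset.mul_sum, Pi.smul_apply, smul_eq_mul]
  exact Finset.sum_congr rfl fun _ _ => by ring

/-- The linear map that places the vertices in each pair of consecutive copies of `ZMod k` at the
vertices of a regular `2 k`-gon, and two vertices of a single last copy at `1` and `-1`. -/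
def sphereMap (k m : ℕ) [NeZero k] [NeZero m] : Space k m →ₗ[ℝ] (Fin m → ℝ) where
  toFun x c := if Even (c : ℕ) then
      if (c : ℕ) + 1 < m then polyX (slice x c) (slice x (c + 1)) else slice x c 0 - slice x c 1
    else polyY (slice x (c - 1)) (slice x c)
  map_add' x y := by
    ext c
    have h : ∀ c, slice (x + y) c = slice x c + slice y c := fun _ => rfl
    simp only [h, polyX_add, polyY_add, Pi.add_apply]
    split_ifs <;> ring
  map_smul' t x := by
    ext c
    have h : ∀ c, slice (t • x) c = t • slice x c := fun _ => rfl
    simp only [h, polyX_smul, polyY_smul, Pi.smul_apply, smul_eq_mul, RingHom.id_apply]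
    split_ifs <;> ring

lemma ofNat_val_of_lt {c : ℕ} (hc : c < m) : ((Fin.ofNat m c : Fin m) : ℕ) = c :=
  Nat.mod_eq_of_lt hc

lemma ofNat_val (c : Fin m) : Fin.ofNat m c = c := by
  ext; exact Nat.mod_eq_of_lt c.2

lemma sphereMap_even (x : Space k m) {c : ℕ} (hc : Even c) (hcm : c + 1 < m) :
    sphereMap k m x (Fin.ofNat m c) = polyX (slice x c) (slice x (c + 1)) ∧
    sphereMap k m x (Fin.ofNat m (c + 1)) = polyY (slice x c) (slice x (c + 1)) := by
  have h : ¬ Even (c + 1) := by rwa [Nat.even_add_one, not_not]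
  simp only [sphereMap, LinearMap.coe_mk, AddHom.coe_mk, ofNat_val_of_lt hcm,
    ofNat_val_of_lt (show c < m by omega), if_pos hc, if_pos hcm, if_neg h, Nat.add_sub_cancel]
  exact ⟨trivial, trivial⟩

lemma sphereMap_last (x : Space k m) {c : ℕ} (hc : Even c) (hcm : c + 1 = m) :
    sphereMap k m x (Fin.ofNat m c) = slice x c 0 - slice x c 1 := by
  simp only [sphereMap, LinearMap.coe_mk, AddHom.coe_mk,
    ofNat_val_of_lt (show c < m by omega), if_pos hc, if_neg (show ¬ c + 1 < m by omega)]

lemma isEdgePair_slice {x : Space k m} (hx : ∀ i, 0 ≤ x i) {σ : ℕ → ZMod k} (hσ : GoodSigns m σ)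
    (h : ∀ i : ZMod k × Fin m, i.1 ≠ σ i.2 → x i = 0) {c : ℕ} (hc : Even c) (hcm : c + 1 < m) :
    IsEdgePair (σ (c + 1)) (σ c) (slice x c) (slice x (c + 1)) := by
  refine ⟨hσ.1 c hc hcm, fun _ => hx _, fun _ => hx _, fun a ha => h _ ?_, fun a ha => h _ ?_⟩
  · rwa [ofNat_val_of_lt (by omega)]
  · rwa [ofNat_val_of_lt hcm]

/-- At most one of the coordinates with signs `0` and `1` is nonzero, so they are the positive and
negative parts of their difference. -/
lemma slice_last (hk : 2 ≤ k) {x : Space k m} (hx : ∀ i, 0 ≤ x i) {σ : ℕ → ZMod k}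
    (hσ : GoodSigns m σ) (h : ∀ i : ZMod k × Fin m, i.1 ≠ σ i.2 → x i = 0) {c : ℕ} (hc : Even c)
    (hcm : c + 1 = m) (a : ZMod k) : slice x c a =
      if a = 0 then max 0 (sphereMap k m x (Fin.ofNat m c)) else
      if a = 1 then max 0 (-sphereMap k m x (Fin.ofNat m c)) else 0 := by
  have : Fact (1 < k) := ⟨hk⟩
  have h' : ∀ a, a ≠ σ c → slice x c a = 0 := fun a ha => h _ (by
    rwa [ofNat_val_of_lt (by omega)])
  have h0 : ∀ a, 0 ≤ slice x c a := fun _ => hx _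
  rw [sphereMap_last x hc hcm]
  rcases hσ.2 c hc hcm with e | e
  · rw [e] at h'
    rw [h' 1 one_ne_zero]
    split_ifs with ha ha'
    · rw [ha, sub_zero, max_eq_right (h0 0)]
    · rw [ha', h' 1 one_ne_zero, sub_zero, max_eq_left (neg_nonpos.2 (h0 0))]
    · exact h' a ha
  · rw [e] at h'
    rw [h' 0 zero_ne_one]
    split_ifs with ha ha'
    · rw [ha, h' 0 zero_ne_one, zero_sub, max_eq_left (neg_nonpos.2 (h0 1))]
    · rw [ha', zero_sub, neg_neg, max_eq_right (h0 1)]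
    · exact h' a ha'

/-- Each slice is recovered from the image alone, by `vertexCoeff` in a pair of copies and by
`slice_last` in an unpaired copy. The sign sequences of the two points need not agree. -/
lemma injOn_sphereMap (hk : 2 ≤ k) : Set.InjOn (sphereMap k m) (joinCone k m) := by
  rintro x ⟨hx, σ, hσ, hxσ⟩ y ⟨hy, σ', hσ', hyσ'⟩ hxy
  have hslice : ∀ c < m, slice x c = slice y c := by
    intro c hc
    funext a
    rcases Nat.even_or_odd' c with ⟨p, rfl | rfl⟩
    · rcases Nat.lt_or_eq_of_le (show 2 * p + 1 ≤ m by omega) with h | h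
      · have e := even_two_mul p
        rw [← ((isEdgePair_slice hx hσ hxσ e h).vertexCoeff_poly hk a).1,
          ← ((isEdgePair_slice hy hσ' hyσ' e h).vertexCoeff_poly hk a).1,
          ← (sphereMap_even x e h).1, ← (sphereMap_even x e h).2,
          ← (sphereMap_even y e h).1, ← (sphereMap_even y e h).2, hxy]
      · rw [slice_last hk hx hσ hxσ (even_two_mul p) h, slice_last hk hy hσ' hyσ' (even_two_mul p) h,
          hxy]
    · have e := even_two_mul p
      rw [← ((isEdgePair_slice hx hσ hxσ e hc).vertexCoeff_poly hk a).2,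
        ← ((isEdgePair_slice hy hσ' hyσ' e hc).vertexCoeff_poly hk a).2,
        ← (sphereMap_even x e hc).1, ← (sphereMap_even x e hc).2,
        ← (sphereMap_even y e hc).1, ← (sphereMap_even y e hc).2, hxy]
  ext ⟨a, c⟩
  have := congrFun (hslice c c.2) a
  simpa [slice, ofNat_val] using this

/-- The blocks of coordinates are independent: a polygon edge is chosen separately for each planar
component, and a sign for the last real component if it is unpaired. -/
lemma surjOn_sphereMap (hk : 2 ≤ k) : Set.SurjOn (sphereMap k m) (joinCone k m) Set.univ := by
  classical
  have : Fact (1 < k) := ⟨hk⟩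
  intro y _
  choose A B P Q hE hX hY using fun X Y : ℝ => exists_isEdgePair hk X Y
  set z : ℕ → ℝ := fun c => y (Fin.ofNat m c) with hz
  set σ : ℕ → ZMod k := fun c => if Even c then
    if c + 1 < m then B (z c) (z (c + 1)) else if 0 ≤ z c then 0 else 1
    else A (z (c - 1)) (z c) with hσdef
  set x : Space k m := fun i => if Even (i.2 : ℕ) then
    if (i.2 : ℕ) + 1 < m then P (z i.2) (z (i.2 + 1)) i.1
    else if i.1 = σ i.2 then |z i.2| else 0
    else Q (z (i.2 - 1)) (z i.2) i.1 with hxdef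
  have hodd : ∀ c, Even c → ¬ Even (c + 1) := fun c hc => by rwa [Nat.even_add_one, not_not]
  have hs1 : ∀ c, Even c → c + 1 < m → slice x c = P (z c) (z (c + 1)) := by
    intro c hc hcm
    funext a
    simp only [slice, hxdef, ofNat_val_of_lt (show c < m by omega), if_pos hc, if_pos hcm]
  have hs2 : ∀ c, Even c → c + 1 < m → slice x (c + 1) = Q (z c) (z (c + 1)) := by
    intro c hc hcm
    funext a
    simp only [slice, hxdef, ofNat_val_of_lt hcm, if_neg (hodd c hc), Nat.add_sub_cancel]
  have hs3 : ∀ c, Even c → c + 1 = m → ∀ a, slice x c a = if a = σ c then |z c| else 0 := by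
    intro c hc hcm a
    simp only [slice, hxdef, ofNat_val_of_lt (show c < m by omega), if_pos hc,
      if_neg (show ¬ c + 1 < m by omega)]
  have hσ3 : ∀ c, Even c → c + 1 = m → σ c = if 0 ≤ z c then 0 else 1 := by
    intro c hc hcm
    simp only [hσdef, if_pos hc, if_neg (show ¬ c + 1 < m by omega)]
  refine ⟨x, ⟨fun i => ?_, σ, ⟨fun c hc hcm => ?_, fun c hc hcm => ?_⟩, fun i hi => ?_⟩, ?_⟩
  · simp only [hxdef]
    split_ifs
    · exact (hE _ _).2.1 _
    · exact abs_nonneg _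
    · exact le_rfl
    · exact (hE _ _).2.2.1 _
  · simp only [hσdef, if_pos hc, if_pos hcm, if_neg (hodd c hc), Nat.add_sub_cancel]
    exact (hE _ _).1
  · rw [hσ3 c hc hcm]
    split_ifs
    · exact Or.inl rfl
    · exact Or.inr rfl
  · simp only [hxdef]
    split_ifs with h1 h2
    · refine (hE _ _).2.2.2.1 _ ?_
      simpa only [hσdef, if_pos h1, if_pos h2] using hi
    · rfl
    · refine (hE _ _).2.2.2.2 _ ?_
      simpa only [hσdef, if_neg h1] using hi
  · funext c
    obtain ⟨c, hc⟩ := c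
    have hcof : (⟨c, hc⟩ : Fin m) = Fin.ofNat m c := by ext; exact (ofNat_val_of_lt hc).symm
    rw [hcof]
    rcases Nat.even_or_odd' c with ⟨p, rfl | rfl⟩
    · have e := even_two_mul p
      rcases Nat.lt_or_eq_of_le (show 2 * p + 1 ≤ m by omega) with h | h
      · rw [(sphereMap_even x e h).1, hs1 _ e h, hs2 _ e h, hX]
      · rw [sphereMap_last x e h, hs3 _ e h, hs3 _ e h, hσ3 _ e h]
        by_cases h0 : 0 ≤ z (2 * p)
        · rw [if_pos h0, if_pos rfl, if_neg one_ne_zero, sub_zero, abs_of_nonneg h0]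
        · rw [if_neg h0, if_neg zero_ne_one, if_pos rfl, zero_sub, abs_of_neg (not_le.1 h0),
            neg_neg]
    · have e := even_two_mul p
      rw [(sphereMap_even x e hc).2, hs1 _ e hc, hs2 _ e hc, hY]

lemma isCompact_stdFace {ι : Type*} [Fintype ι] (T : Set ι) : IsCompact (stdFace T) := by
  have h : stdFace T = stdSimplex ℝ ι ∩ ⋂ i ∈ Tᶜ, {x | x i = 0} := by
    ext x; simp [stdFace]
  rw [h]
  refine (isCompact_stdSimplex ℝ ι).inter_right ?_
  exact isClosed_biInter fun i _ => isClosed_eq (continuous_apply i) continuous_const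

lemma notMem_range_levelTuple_iff {σ : ℕ → ZMod k} {i : ZMod k × Fin m} :
    i ∉ Set.range (levelTuple m m σ) ↔ i.1 ≠ σ i.2 := by
  rw [not_iff_not]
  constructor
  · rintro ⟨j, rfl⟩
    have hj := j.2
    simp only [levelTuple]
    rw [ofNat_val_of_lt (by omega)]
  · intro h
    have hi := i.2.2
    refine ⟨⟨m - 1 - i.2, by omega⟩, ?_⟩
    have e : m - 1 - (m - 1 - (i.2 : ℕ)) = i.2 := by omega
    simp only [levelTuple, e]
    rw [← h, ofNat_val]

/-- The sphere described by `GoodSigns` is a sphere. -/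
theorem nonempty_homeomorph_sphere_of_goodSigns (hk : 2 ≤ k) :
    Nonempty ({x : Space k m | ∃ σ : ℕ → ZMod k, GoodSigns m σ ∧
      x ∈ stdFace (Set.range (levelTuple m m σ))} ≃ₜ
      Metric.sphere (0 : EuclideanSpace ℝ (Fin m)) 1) := by
  set φ : Space k m →ₗ[ℝ] ℝ := ∑ i, LinearMap.proj i with hφ
  have hφx : ∀ x, φ x = ∑ i, x i := fun x => by simp [hφ]
  have hS : {x : Space k m | ∃ σ : ℕ → ZMod k, GoodSigns m σ ∧
      x ∈ stdFace (Set.range (levelTuple m m σ))} = {x | x ∈ joinCone k m ∧ φ x = 1} := by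
    ext x
    simp only [Set.mem_ofPred_eq, joinCone, stdFace, notMem_range_levelTuple_iff, hφx, stdSimplex]
    constructor
    · rintro ⟨σ, h1, ⟨h2, h3⟩, h4⟩
      exact ⟨⟨h2, σ, h1, h4⟩, h3⟩
    · rintro ⟨⟨h2, σ, h1, h4⟩, h3⟩
      exact ⟨σ, h1, ⟨h2, h3⟩, h4⟩
  have hcomp : IsCompact {x : Space k m | ∃ σ : ℕ → ZMod k, GoodSigns m σ ∧
      x ∈ stdFace (Set.range (levelTuple m m σ))} := by
    have : {x : Space k m | ∃ σ : ℕ → ZMod k, GoodSigns m σ ∧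
      x ∈ stdFace (Set.range (levelTuple m m σ))} =
      ⋃ T ∈ {T : Set (ZMod k × Fin m) | ∃ σ : ℕ → ZMod k, GoodSigns m σ ∧
        Set.range (levelTuple m m σ) = T}, stdFace T := by
      ext x
      simp
    rw [this]
    -- There are infinitely many sign sequences, but only finitely many vertex sets `T`.
    exact (Set.toFinite _).isCompact_biUnion fun T _ => isCompact_stdFace T
  rw [hS] at hcomp ⊢
  have hinj := injOn_sphereMap (m := m) hk
  have hsurj := surjOn_sphereMap (m := m) hk
  set e := (WithLp.linearEquiv 2 ℝ (Fin m → ℝ)).symm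
  refine nonempty_homeomorph_sphere (L := e.toLinearMap ∘ₗ sphereMap k m)
    (LinearMap.continuous_of_finiteDimensional _) ?_ ?_ ?_ ?_ ?_ hcomp
  · refine ⟨fun _ => le_rfl, fun _ => 0, ⟨fun _ _ _ => Or.inl rfl, fun _ _ _ => Or.inl rfl⟩,
      fun _ _ => rfl⟩
  · rintro x ⟨hx, σ, hσ, h⟩ t ht
    refine ⟨fun i => mul_nonneg ht.le (hx i), σ, hσ, fun i hi => ?_⟩
    simp [h i hi]
  · rintro x ⟨hx, -⟩ hne
    rw [hφx]
    refine (Finset.sum_nonneg fun i _ => hx i).lt_of_ne' fun h => hne ?_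
    funext i
    exact (Finset.sum_eq_zero_iff_of_nonneg fun i _ => hx i).1 h i (Finset.mem_univ i)
  · exact e.injective.comp_injOn hinj
  · intro y _
    obtain ⟨x, hx, hxy⟩ := hsurj (Set.mem_univ (e.symm y))
    exact ⟨x, hx, by simp [hxy]⟩

end JoinSphere

end ZkTucker

end

/-! ### Assembly of the theorem -/

theorem corollary5p6 (k : ℕ) (hk : 2 ≤ k) (d : ℕ)
    (X : Geometry.SimplicialComplex ℝ (ZkTucker.Space k (d + 2)))
    (hsub : ZkTucker.IsSubdivision X (ZkTucker.joinComplex k (d + 2)))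
    (hinv : ZkTucker.IsInvariant X) :
    ∃ Y : Geometry.SimplicialComplex ℝ (ZkTucker.Space k (d + 2)),
      Y ≤ X ∧
      Nonempty (Y.space ≃ₜ Metric.sphere (0 : EuclideanSpace ℝ (Fin (d + 2))) 1) ∧
      ∃ x : (i : ℕ) → (Fin (i + 1) → ZkTucker.Space k (d + 2)) → ℤ,
        ZkTucker.IsGeneralizedSphere X (d + 1) x ∧
        ZkTucker.IsOrientationChain Y d
          (if Even (d + 1) then ZkTucker.tauMul (x (d + 1)) else ZkTucker.sigmaMul (x (d + 1))) ∧
        (∀ v, x (d + 1) v ≠ 0 → ∀ g : ZMod k, g ≠ 0 → ZkTucker.translate g (x (d + 1)) v = 0) ∧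
        ∀ l : ZkTucker.Space k (d + 2) → ZMod k × ℕ,
          ZkTucker.IsAdmissible X l → ZkTucker.IsEquivariantLabelling X l →
          ZkTucker.alpha l (x (d + 1)) ≡ 1 [ZMOD k] := by

  have : NeZero k := ⟨by omega⟩
  refine ⟨ZkTucker.sphereComplex X, ZkTucker.sphereComplex_le, ?_, ZkTucker.subdivChain X, ?_, ?_,
    ?_, ?_⟩
  · rw [ZkTucker.sphereComplex_space hsub]
    exact ZkTucker.nonempty_homeomorph_sphere_of_goodSigns hk
  · exact ZkTucker.isGeneralizedSphere_subdivChain hk hsub hinv (by omega)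
  · have h := ZkTucker.isOrientationChain_sphereOf hk hsub
    rw [← ZkTucker.sphereOf_subdivChain hinv] at h
    exact h
  · exact fun v hv g hg => ZkTucker.translate_subdivChain_disjoint hk hinv (by omega) hv hg
  · intro l hadm hl
    have hgen := ZkTucker.isGeneralizedSphere_subdivChain hk hsub hinv (n := d + 1) (by omega)
    have h := ZkTucker.IsGeneralizedSphere.alpha_modEq hinv hadm hl hgen
    rwa [ZkTucker.alpha_subdivChain_zero hsub] at h
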